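/- Let $\hat g$ be the Euclidean metric on $\mathbb R^3$ and let $\Omega\subset\mathbb R^3$ be a compact domain with the conformally flat metric $g=f^4\hat g$, where $f>0$ is continuous on $\Omega$. Let $S(0)\subset\Omega$ be the set on which $f$ attains its maximum over $\Omega$, and suppose that $f$ is smooth near every point of $\Omega\setminus S(0)$. Suppose that $\Omega$ carries a convex equipotential foliation: there are $\sigma_0>0$ and smooth coordinates $(\sigma,x^2,x^3)$, $0<\sigma\le\sigma_0$, $(x^2,x^3)\in S^2$ (smooth up to and slightly beyond $\sigma=\sigma_0$), which cover exactly $\Omega\setminus S(0)$ and in which $$g=f^4(\sigma)\,[\hat g_{\sigma\sigma}\,d\sigma^2+\hat g_{ij}\,dx^i dx^j]\qquad(i,j=2,3),$$ such that the surfaces $\sigma=\mathrm{const}$ are the level surfaces of $f$ in $\Omega\setminus S(0)$ (distinct leaves have distinct values $f(\sigma)$), each of them is a smoothly embedded closed convex surface of Euclidean space, and $\sigma$ increases outwards. Thus $S(0)$ is the degenerate leaf $\sigma=0$; suppose that it is a (possibly degenerate) flat disk, i.e. that it lies in a plane. Let $\Sigma=\{\sigma=\sigma_0\}=\partial\Omega$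 and suppose that $\Sigma$ has positive Gauss curvature. Let $k$ be the mean curvature of $\Sigma$ in $(\Omega,g)$ (the divergence of the outward $g$-unit normal $n$), let $d\Sigma$ be the $g$-area element, let $n_\sigma$ and $n^\sigma$ be the co- and contravariant $\sigma$-components of $n$, and let $(n_\sigma k)_{max}$ be the maximum of $n_\sigma k$ over $\Sigma$. Let $$\mathfrak m_{BY}(\Sigma,g)=\frac1{8\pi}\int_\Sigma(k_0-k)\,d\Sigma$$ be the Brown–York mass, where $k_0$ is the mean curvature, with respect to the outward unit normal, of a Weyl embedding of $\Sigma$, i.e. of a smooth isometric embedding of $\Sigma$, with the metric induced by $g$, onto a closed convex surface of Euclidean $\mathbb R^3$ (any such embedding may be used). Put $$C(s)=\frac1{4\pi}\int_{\{\sigma=s\}}\hat K\,\hat n_\sigma\,d\hat\Sigma,\qquad \hat n_\sigma=\sqrt{\hat g_{\sigma\sigma}},$$ where $\hat K$ and $d\hat\Sigma$ are the Gauss curvature and the area element of the leaf $\sigma=s$ in Euclidean space, and let $\sup l(S(0))$ be the largest flat radius of $S(0)$, i.e. half of its Euclidean diameter. If $$\mathfrak m_{BY}(\Sigma,g)>\frac1{8\pi}\int_\Sigma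 n^\sigma\,[(n_\sigma k)_{max}-n_\sigma k]\,d\Sigma+\frac{f^2(\sigma_0)\,\pi}{4}\,\sup l(S(0))+f^2(\sigma_0)\int_0^{\sigma_0}C(s)\,ds,$$ then $\Sigma$ is a pointwise trapped surface: $k<0$ everywhere on $\Sigma$. -/

import Mathlib

open scoped ContDiff RealInnerProductSpace
open MeasureTheory

noncomputable section

namespace ConformallyFlat

/-- Euclidean three-space. -/
abbrev E3 : Type := EuclideanSpace ℝ (Fin 3)

/-- The round unit two-sphere, the domain of the quasi-angle variables. -/
abbrev S2 : Type := Metric.sphere (0 : E3) 1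

/-! ### Metrics on (subsets of) three-space -/

/-- A (candidate) metric tensor: `g x v w` is the product of `v` and `w` at the point `x`. -/
abbrev MetricTensor : Type := E3 → E3 → E3 → ℝ

/-- The Euclidean metric. -/
def flatMetric : MetricTensor := fun _ v w => ⟪v, w⟫

/-- The conformally flat metric with conformal factor `f`, i.e. `f ^ 4` times the flat metric. -/
def conformalMetric (f : E3 → ℝ) : MetricTensor := fun x v w => f x ^ 4 * ⟪v, w⟫

/-- Christoffel symbols of the first kind of the Levi-Civita connection of `g`: the product
`g (∇_v W) z` at `x`, for constant vector fields `v`, `w`, `z`. -/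
def christoffel (g : MetricTensor) (x v w z : E3) : ℝ :=
  (fderiv ℝ (fun y => g y w z) x v + fderiv ℝ (fun y => g y v z) x w
    - fderiv ℝ (fun y => g y v w) x z) / 2

/-! ### Surfaces parametrised by the two-sphere

A parametrised surface is the restriction to the unit sphere of a map `X` that is smooth near
the sphere.  Only the values of `X` on the sphere, hence only derivatives in directions tangent
to the sphere, enter the definitions below. -/

/-- An orthonormal frame of the tangent plane of the unit sphere at `u`. -/
def tangentFrame (u : S2) (i : Fin 2) : E3 :=
  haveI : Fact (Module.finrank ℝ E3 = 2 + 1) := ⟨by simp⟩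
  (OrthonormalBasis.fromOrthogonalSpanSingleton (𝕜 := ℝ) 2
    (ne_zero_of_mem_unit_sphere u) i : E3)

/-- First fundamental form (the metric induced by `g`), in the frame `tangentFrame u`. -/
def firstForm (g : MetricTensor) (X : E3 → E3) (u : S2) : Matrix (Fin 2) (Fin 2) ℝ :=
  Matrix.of fun i j =>
    g (X u) (fderiv ℝ X u (tangentFrame u i)) (fderiv ℝ X u (tangentFrame u j))

/-- Second fundamental form `g (∇_i n) (∂_j X)` with respect to a `g`-unit normal field `n`
along the surface, with `∇` the Levi-Civita connection of `g`. -/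
def secondForm (g : MetricTensor) (X n : E3 → E3) (u : S2) : Matrix (Fin 2) (Fin 2) ℝ :=
  Matrix.of fun i j =>
    g (X u) (fderiv ℝ n u (tangentFrame u i)) (fderiv ℝ X u (tangentFrame u j))
      + christoffel g (X u) (fderiv ℝ X u (tangentFrame u i)) (n u)
          (fderiv ℝ X u (tangentFrame u j))

/-- Mean curvature (sum of the principal curvatures), i.e. the divergence of the unit normal. -/
def meanCurvature (g : MetricTensor) (X n : E3 → E3) (u : S2) : ℝ :=
  ((firstForm g X u)⁻¹ * secondForm g X n u).trace

/-- Gauss curvature of a surface in Euclidean space. -/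
def gaussCurvature (X n : E3 → E3) (u : S2) : ℝ :=
  (secondForm flatMetric X n u).det / (firstForm flatMetric X u).det

/-- Density of the `g`-area of the surface with respect to the area of the round sphere. -/
def areaDensity (g : MetricTensor) (X : E3 → E3) (u : S2) : ℝ :=
  √((firstForm g X u).det)

/-- The integral of `h` over the surface with respect to the `g`-area. -/
def surfaceIntegral (g : MetricTensor) (X : E3 → E3) (h : S2 → ℝ) : ℝ :=
  ∫ u : S2, h u * areaDensity g X u ∂((volume : Measure E3).toSphere)

/-! ### Equipotential foliations -/

/-- The coordinate vector field `∂_σ` of the coordinates `Φ σ x`. -/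
def coordVector (Φ : ℝ → E3 → E3) (s : ℝ) (x : E3) : E3 := deriv (fun t => Φ t x) s

/-- The `g`-unit normal of the leaves, pointing to increasing `σ`, for coordinates in which
`∂_σ` is orthogonal to the leaves. -/
def unitNormal (g : MetricTensor) (Φ : ℝ → E3 → E3) (s : ℝ) (x : E3) : E3 :=
  (√(g (Φ s x) (coordVector Φ s x) (coordVector Φ s x)))⁻¹ • coordVector Φ s x

/-- The covariant component `n_σ = g (n, ∂_σ)` of the unit normal. -/
def normalLower (g : MetricTensor) (Φ : ℝ → E3 → E3) (s : ℝ) (u : S2) : ℝ :=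
  g (Φ s u) (unitNormal g Φ s u) (coordVector Φ s u)

/-- The contravariant component `n^σ = n_σ / g_σσ` of the unit normal (there are no mixed
components of the metric). -/
def normalUpper (g : MetricTensor) (Φ : ℝ → E3 → E3) (s : ℝ) (u : S2) : ℝ :=
  normalLower g Φ s u / g (Φ s u) (coordVector Φ s u) (coordVector Φ s u)

/-- The set of points of `Ω` at which `f` attains its maximum over `Ω`. -/
def maxSet (f : E3 → ℝ) (Ω : Set E3) : Set E3 := {x | x ∈ Ω ∧ ∀ y ∈ Ω, f y ≤ f x}

/-- A set contained in an affine plane. -/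
def IsPlanar (S : Set E3) : Prop := ∃ a : E3, a ≠ 0 ∧ ∃ c : ℝ, ∀ x ∈ S, ⟪a, x⟫ = c

/-- `Φ` gives coordinates (`σ`, quasi-angles) of an equipotential foliation of the compact domain
`Ω` by convex level surfaces of the conformal factor `f`, with outermost leaf `σ = σ₀` and with
`F σ` the value of `f` on the leaf `σ`; the degenerate leaf `σ = 0` is the set on which `f`
attains its maximum. -/
structure IsConvexEquipotentialFoliation
    (f : E3 → ℝ) (Ω : Set E3) (σ₀ : ℝ) (F : ℝ → ℝ) (Φ : ℝ → E3 → E3) : Prop where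
  pos : 0 < σ₀
  isCompact : IsCompact Ω
  /-- the conformal factor -/
  factor_pos : ∀ x ∈ Ω, 0 < f x
  factor_continuous : ContinuousOn f Ω
  factor_smooth : ∀ x ∈ Ω \ maxSet f Ω, ContDiffAt ℝ ∞ f x
  /-- the leaves with `0 < σ ≤ σ₀` fill the domain outside the leaf `σ = 0` -/
  cover : {x | ∃ s ∈ Set.Ioc 0 σ₀, ∃ u : S2, Φ s u = x} = Ω \ maxSet f Ω
  boundary : frontier Ω = Set.range fun u : S2 => Φ σ₀ u
  /-- the leaves are level surfaces of the conformal factor -/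
  factor_eq : ∀ s ∈ Set.Ioc 0 σ₀, ∀ u : S2, f (Φ s u) = F s
  level_inj : Set.InjOn F (Set.Ioc 0 σ₀)
  /-- `Φ` is a smooth system of coordinates -/
  smooth : ∀ s ∈ Set.Ioc 0 σ₀, ∀ u : S2, ContDiffAt ℝ ∞ (fun p : ℝ × E3 => Φ p.1 p.2) (s, (u : E3))
  inj : ∀ s ∈ Set.Ioc 0 σ₀, Function.Injective fun u : S2 => Φ s u
  immersion : ∀ s ∈ Set.Ioc 0 σ₀, ∀ u : S2, ∀ v : E3, ⟪(u : E3), v⟫ = 0 →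
    fderiv ℝ (Φ s) u v = 0 → v = 0
  coordVector_ne : ∀ s ∈ Set.Ioc 0 σ₀, ∀ u : S2, coordVector Φ s u ≠ 0
  /-- the metric has no mixed components -/
  orthogonal : ∀ s ∈ Set.Ioc 0 σ₀, ∀ u : S2, ∀ v : E3, ⟪(u : E3), v⟫ = 0 →
    ⟪coordVector Φ s u, fderiv ℝ (Φ s) u v⟫ = 0
  /-- each leaf is a convex surface of Euclidean space, and `σ` increases outwards -/
  convex : ∀ s ∈ Set.Ioc 0 σ₀, ∀ u v : S2, ⟪unitNormal flatMetric Φ s u, Φ s v - Φ s u⟫ ≤ 0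

/-! ### Brown-York mass and the terms of the criterion -/

/-- `Y` is a Weyl embedding, with outward unit normal `ν`, of the surface `X` with the metric
induced by `g`: an isometric embedding onto a closed convex surface of Euclidean space. -/
structure IsWeylEmbedding (g : MetricTensor) (X : E3 → E3) (Y ν : E3 → E3) : Prop where
  smooth : ∀ u : S2, ContDiffAt ℝ ∞ Y u
  inj : Function.Injective fun u : S2 => Y u
  isometric : ∀ u : S2, ∀ v w : E3, ⟪(u : E3), v⟫ = 0 → ⟪(u : E3), w⟫ = 0 →
    ⟪fderiv ℝ Y u v, fderiv ℝ Y u w⟫ = g (X u) (fderiv ℝ X u v) (fderiv ℝ X u w)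
  normal_smooth : ∀ u : S2, ContDiffAt ℝ ∞ ν u
  normal_unit : ∀ u : S2, ‖ν u‖ = 1
  normal_orthogonal : ∀ u : S2, ∀ v : E3, ⟪(u : E3), v⟫ = 0 → ⟪ν u, fderiv ℝ Y u v⟫ = 0
  /-- the image is a convex surface and `ν` points outwards -/
  convex : ∀ u v : S2, ⟪ν u, Y v - Y u⟫ ≤ 0

/-- Mean curvature of the leaf `σ = s` with respect to the metric `g`. -/
def leafMeanCurvature (g : MetricTensor) (Φ : ℝ → E3 → E3) (s : ℝ) (u : S2) : ℝ :=
  meanCurvature g (Φ s) (unitNormal g Φ s) u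

/-- Gauss curvature of the leaf `σ = s` with the metric induced from the Euclidean one. -/
def leafGaussCurvature (Φ : ℝ → E3 → E3) (s : ℝ) (u : S2) : ℝ :=
  gaussCurvature (Φ s) (unitNormal flatMetric Φ s) u

/-- The Brown-York mass of the leaf `σ = s` in the metric `g`, computed from the Weyl embedding
`Y` with outward unit normal `ν`. -/
def brownYorkMass (g : MetricTensor) (Φ : ℝ → E3 → E3) (s : ℝ) (Y ν : E3 → E3) : ℝ :=
  (1 / (8 * Real.pi)) * surfaceIntegral g (Φ s)
    (fun u => meanCurvature flatMetric Y ν u - leafMeanCurvature g Φ s u)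

/-- The boundary term: the integral of `n^σ ((n_σ k)_max - n_σ k)`, divided by `8 π`. -/
def boundaryTerm (g : MetricTensor) (Φ : ℝ → E3 → E3) (s : ℝ) : ℝ :=
  (1 / (8 * Real.pi)) * surfaceIntegral g (Φ s) (fun u => normalUpper g Φ s u *
    ((⨆ v : S2, normalLower g Φ s v * leafMeanCurvature g Φ s v)
      - normalLower g Φ s u * leafMeanCurvature g Φ s u))

/-- The hoop density `C(s)`, with `8 π C(s)` twice the integral of the Gauss curvature times `n_σ`
over the leaf `σ = s`, all with respect to the Euclidean metric. -/
def hoopDensity (Φ : ℝ → E3 → E3) (s : ℝ) : ℝ :=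
  (1 / (8 * Real.pi)) * (2 * surfaceIntegral flatMetric (Φ s)
    (fun u => leafGaussCurvature Φ s u * normalLower flatMetric Φ s u))

/-- The largest flat radius: half of the Euclidean diameter. -/
def flatRadius (S : Set E3) : ℝ := Metric.diam S / 2

/-- The leaf `σ = s` is (pointwise) trapped: its mean curvature is negative everywhere. -/
def IsTrapped (g : MetricTensor) (Φ : ℝ → E3 → E3) (s : ℝ) : Prop :=
  ∀ u : S2, leafMeanCurvature g Φ s u < 0

end ConformallyFlat

end

open ConformallyFlat

/-!
The criterion follows from a lower bound for the boundary term and an upper bound for the total mean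
curvature of the Weyl embedding, which together contradict the hypothesis on the Brown-York mass if
the mean curvature `k` is non-negative somewhere.

If `0 ≤ k` at a point, then the maximum of `n_σ k` is non-negative; since `n^σ n_σ = 1`, the boundary
term is at least `-(8 π)⁻¹ ∫ k` (`IsConvexEquipotentialFoliation.neg_integral_le_boundaryTerm`).  It
remains to show that `∫ k₀ ≤ F(σ₀)² (8 π ∫ C + π² diam S(0))`
(`IsConvexEquipotentialFoliation.surfaceIntegral_meanCurvature_le`).

The metric of the boundary is that of the Euclidean surface `Φ σ₀` dilated by `F(σ₀)²`.  Herglotz's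
integral inequality for isometric convex surfaces (`IsConvexSurface.integral_mixed_le_of_isometric`)
bounds `∫ k₀` by the total mean curvature of the dilated surface.  This avoids the rigidity theorem:
only the comparison of total mean curvatures is needed.

The total mean curvature `M(s)` of the Euclidean leaf `σ = s` satisfies `M' = 8 π C ≥ 0`
(`IsConvexEquipotentialFoliation.hasDerivAt_totalMeanCurvature`), so
`M(σ₀) = M(s) + 8 π ∫_s^σ₀ C`.  By compactness there are leaves arbitrarily close to the degenerate
leaf `S(0)` (`IsConvexEquipotentialFoliation.exists_leaf_close`).  By Minkowski's formula `M(s)` is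
twice the integral of the support function against the Gauss curvature, and by the change of
variables formula for the Gauss map this is at most twice the integral over the unit sphere of the
support function of a neighbourhood of `S(0)`.  As `S(0)` lies in a plane, that integral is at most
`π² diam S(0) / 2` up to an error that tends to zero
(`IsConvexSurface.integral_mixed_le_of_planar`).

All integral formulas are obtained from a single density on the sphere, `mixed A B C`, which is
`det (A, dB ∧ dC)`.  Its integral is symmetric in `A`, `B`, `C` by Stokes' theorem
(`integral_mixed_swap`).  The densities of the mean curvature, the Gauss curvature and the area of a
surface are obtained when the entries are the surface and its normal, up to a factor `1 / 2` for the
last two and a sign `ε` that compares orientations (`IsOrientation`).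
-/

noncomputable section

namespace ConformallyFlat

/-! ### Vector algebra in Euclidean three-space -/

/-- The vector product. -/
def cross (a b : E3) : E3 :=
  !₂[a 1 * b 2 - a 2 * b 1, a 2 * b 0 - a 0 * b 2, a 0 * b 1 - a 1 * b 0]

/-- The scalar triple product, i.e. the determinant with columns `a`, `b`, `c`. -/
def det3 (a b c : E3) : ℝ :=
  a 0 * (b 1 * c 2 - b 2 * c 1) + a 1 * (b 2 * c 0 - b 0 * c 2) + a 2 * (b 0 * c 1 - b 1 * c 0)

@[simp] lemma cross_apply_zero (a b : E3) : cross a b 0 = a 1 * b 2 - a 2 * b 1 := rfl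
@[simp] lemma cross_apply_one (a b : E3) : cross a b 1 = a 2 * b 0 - a 0 * b 2 := rfl
@[simp] lemma cross_apply_two (a b : E3) : cross a b 2 = a 0 * b 1 - a 1 * b 0 := rfl

lemma inner_eq (a b : E3) : ⟪a, b⟫ = a 0 * b 0 + a 1 * b 1 + a 2 * b 2 := by
  simp [PiLp.inner_apply, Fin.sum_univ_three, mul_comm]

lemma inner_cross (a b c : E3) : ⟪a, cross b c⟫ = det3 a b c := by
  simp [inner_eq, det3]

lemma ext3 {a b : E3} (h0 : a 0 = b 0) (h1 : a 1 = b 1) (h2 : a 2 = b 2) : a = b := by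
  ext i; fin_cases i <;> assumption

section det3
variable (a a' b b' c c' : E3) (r : ℝ)

lemma det3_add_mid : det3 a (b + b') c = det3 a b c + det3 a b' c := by
  simp only [det3, PiLp.add_apply]; ring
lemma det3_add_right : det3 a b (c + c') = det3 a b c + det3 a b c' := by
  simp only [det3, PiLp.add_apply]; ring
lemma det3_sub_left : det3 (a - a') b c = det3 a b c - det3 a' b c := by
  simp only [det3, PiLp.sub_apply]; ring
lemma det3_smul_left : det3 (r • a) b c = r * det3 a b c := by
  simp only [det3, PiLp.smul_apply, smul_eq_mul]; ring
lemma det3_smul_mid : det3 a (r • b) c = r * det3 a b c := by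
  simp only [det3, PiLp.smul_apply, smul_eq_mul]; ring
lemma det3_smul_right : det3 a b (r • c) = r * det3 a b c := by
  simp only [det3, PiLp.smul_apply, smul_eq_mul]; ring
@[simp] lemma det3_self_right : det3 a b b = 0 := by simp only [det3]; ring
@[simp] lemma det3_self_left : det3 a a b = 0 := by simp only [det3]; ring
lemma det3_swap_right : det3 a b c = -det3 a c b := by simp only [det3]; ring
lemma det3_swap_left : det3 a b c = -det3 b a c := by simp only [det3]; ring

/-- The product of two triple products is a Gram determinant. -/
lemma det3_mul_det3 : det3 a b c * det3 a' b' c' =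
    ⟪a, a'⟫ * (⟪b, b'⟫ * ⟪c, c'⟫ - ⟪b, c'⟫ * ⟪c, b'⟫)
    - ⟪a, b'⟫ * (⟪b, a'⟫ * ⟪c, c'⟫ - ⟪b, c'⟫ * ⟪c, a'⟫)
    + ⟪a, c'⟫ * (⟪b, a'⟫ * ⟪c, b'⟫ - ⟪b, b'⟫ * ⟪c, a'⟫) := by
  simp only [det3, inner_eq]; ring

lemma det3_normal_mul {n : E3} (hn : ⟪n, n⟫ = 1) (hb : ⟪n, b'⟫ = 0) (hc : ⟪n, c'⟫ = 0) :
    det3 n b c * det3 n b' c' = ⟪b, b'⟫ * ⟪c, c'⟫ - ⟪b, c'⟫ * ⟪c, b'⟫ := by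
  rw [det3_mul_det3, hn, hb, hc]; ring

/-- Three vectors with a common non-zero normal are linearly dependent. -/
lemma det3_mul_apply_eq_zero {a b c z : E3} (ha : ⟪a, z⟫ = 0) (hb : ⟪b, z⟫ = 0) (hc : ⟪c, z⟫ = 0)
    (i : Fin 3) : det3 a b c * z i = 0 := by
  rw [inner_eq] at ha hb hc
  fin_cases i <;> simp only [det3, Fin.zero_eta, Fin.mk_one, Fin.reduceFinMk]
  · linear_combination (b 1 * c 2 - b 2 * c 1) * ha - (a 1 * c 2 - a 2 * c 1) * hb
      + (a 1 * b 2 - a 2 * b 1) * hc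
  · linear_combination (b 2 * c 0 - b 0 * c 2) * ha - (a 2 * c 0 - a 0 * c 2) * hb
      + (a 2 * b 0 - a 0 * b 2) * hc
  · linear_combination (b 0 * c 1 - b 1 * c 0) * ha - (a 0 * c 1 - a 1 * c 0) * hb
      + (a 0 * b 1 - a 1 * b 0) * hc

lemma det3_eq_zero_of_perp {a b c n : E3} (hn : ⟪n, n⟫ = 1) (ha : ⟪a, n⟫ = 0) (hb : ⟪b, n⟫ = 0)
    (hc : ⟪c, n⟫ = 0) : det3 a b c = 0 := by
  by_contra h
  have : n = 0 := by
    ext i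
    exact (mul_eq_zero.1 (det3_mul_apply_eq_zero ha hb hc i)).resolve_left h
  simp [this] at hn

lemma det3_of_perp {b c n : E3} (hn : ⟪n, n⟫ = 1) (hb : ⟪b, n⟫ = 0) (hc : ⟪c, n⟫ = 0) (z : E3) :
    det3 z b c = ⟪z, n⟫ * det3 n b c := by
  have h : det3 (z - ⟪z, n⟫ • n) b c = 0 := by
    refine det3_eq_zero_of_perp hn ?_ hb hc
    rw [inner_sub_left, real_inner_smul_left, hn]; ring
  rw [det3_sub_left, det3_smul_left] at h
  linarith

end det3

/-- A positively oriented orthonormal frame `u`, `v`, `w`. -/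
structure IsFrame (u v w : E3) : Prop where
  uu : ⟪u, u⟫ = 1
  vv : ⟪v, v⟫ = 1
  uv : ⟪u, v⟫ = 0
  w_eq : w = cross u v

namespace IsFrame
variable {u v w : E3}
lemma uw (h : IsFrame u v w) : ⟪u, w⟫ = 0 := by
  rw [h.w_eq, inner_cross, det3_self_left]

lemma vw (h : IsFrame u v w) : ⟪v, w⟫ = 0 := by
  rw [h.w_eq, inner_cross, det3_swap_left, det3_swap_right]; simp

lemma ww (h : IsFrame u v w) : ⟪w, w⟫ = 1 := by
  have : ⟪w, w⟫ = ⟪u, u⟫ * ⟪v, v⟫ - ⟪u, v⟫ ^ 2 := by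
    rw [h.w_eq]; simp only [inner_eq, cross_apply_zero, cross_apply_one, cross_apply_two]; ring
  rw [this, h.uu, h.vv, h.uv]; norm_num

lemma det (h : IsFrame u v w) : det3 u v w = 1 := by
  have : ⟪w, w⟫ = det3 u v w := by
    conv_lhs => rw [h.w_eq]
    rw [inner_eq]; simp only [cross_apply_zero, cross_apply_one, cross_apply_two]
    rw [h.w_eq]; simp only [det3, cross_apply_zero, cross_apply_one, cross_apply_two]; ring
  rw [← this, h.ww]

lemma exists_of_unit {u v : E3} (hu : ⟪u, u⟫ = 1) (hv : ⟪v, v⟫ = 1) (huv : ⟪u, v⟫ = 0) :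
    IsFrame u v (cross u v) := ⟨hu, hv, huv, rfl⟩

/-- Completeness of the frame, in coordinates. -/
lemma completeness (h : IsFrame u v w) (i j : Fin 3) :
    u i * u j + v i * v j + w i * w j = if i = j then 1 else 0 := by
  have huu := h.uu; have hvv := h.vv; have huv := h.uv
  have huw := h.uw; have hvw := h.vw; have hww := h.ww
  rw [inner_eq] at huu hvv huv huw hvw hww
  set U : Matrix (Fin 3) (Fin 3) ℝ := !![u 0, u 1, u 2; v 0, v 1, v 2; w 0, w 1, w 2] with hU
  have h1 : U * U.transpose = 1 := by
    ext i j
    fin_cases i <;> fin_cases j <;> simp [hU, Matrix.mul_apply, Fin.sum_univ_three] <;> linarith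
  have h2 : U.transpose * U = 1 := mul_eq_one_comm.mp h1
  have h3 := congrFun (congrFun h2 i) j
  rw [Matrix.one_apply] at h3
  rw [← h3]
  fin_cases i <;> fin_cases j <;> simp [hU, Matrix.mul_apply, Fin.sum_univ_three]

lemma expand (h : IsFrame u v w) (z : E3) : z = ⟪u, z⟫ • u + ⟪v, z⟫ • v + ⟪w, z⟫ • w := by
  have c := h.completeness
  refine ext3 ?_ ?_ ?_ <;>
    simp only [inner_eq, PiLp.add_apply, PiLp.smul_apply, smul_eq_mul]
  · have c0 := c 0 0; have c1 := c 1 0; have c2 := c 2 0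
    simp at c0 c1 c2; linear_combination (-z 0) * c0 - z 1 * c1 - z 2 * c2
  · have c0 := c 0 1; have c1 := c 1 1; have c2 := c 2 1
    simp at c0 c1 c2; linear_combination (-z 0) * c0 - z 1 * c1 - z 2 * c2
  · have c0 := c 0 2; have c1 := c 1 2; have c2 := c 2 2
    simp at c0 c1 c2; linear_combination (-z 0) * c0 - z 1 * c1 - z 2 * c2

lemma cross_vu (h : IsFrame u v w) : cross v u = -w := by
  rw [h.w_eq]; refine ext3 ?_ ?_ ?_ <;> simp <;> ring

lemma cross_wu (h : IsFrame u v w) : cross w u = v := by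
  have huu := h.uu; have huv := h.uv
  rw [inner_eq] at huu huv
  rw [h.w_eq]
  refine ext3 ?_ ?_ ?_ <;> simp only [cross_apply_zero, cross_apply_one, cross_apply_two]
  · linear_combination (v 0) * huu - u 0 * huv
  · linear_combination (v 1) * huu - u 1 * huv
  · linear_combination (v 2) * huu - u 2 * huv

lemma cross_left (h : IsFrame u v w) (z : E3) : cross z u = ⟪w, z⟫ • v + (-⟪v, z⟫) • w := by
  have e : cross (⟪u, z⟫ • u + ⟪v, z⟫ • v + ⟪w, z⟫ • w) u
      = ⟪w, z⟫ • cross w u + ⟪v, z⟫ • cross v u := by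
    refine ext3 ?_ ?_ ?_ <;>
      simp only [cross_apply_zero, cross_apply_one, cross_apply_two, PiLp.add_apply,
        PiLp.smul_apply, smul_eq_mul] <;> ring
  rw [← h.expand z, h.cross_vu, h.cross_wu] at e
  rw [e, smul_neg, neg_smul]

end IsFrame

/-- The standard basis vectors. -/
def stdVec (j : Fin 3) : E3 := EuclideanSpace.single j 1

lemma inner_stdVec (z : E3) (j : Fin 3) : ⟪z, stdVec j⟫ = z j := by
  simp [stdVec, EuclideanSpace.inner_single_right]

lemma stdVec_apply (j i : Fin 3) : stdVec j i = if i = j then 1 else 0 := by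
  simp [stdVec]

/-- The value on a positively oriented orthonormal frame of `uᗮ` of the two-form
`(v, w) ↦ det3 a (P v) (Q w) - det3 a (P w) (Q v)`, written without choosing a frame;
see `mixedAt_eq`. -/
def mixedAt (a : E3) (P Q : E3 →L[ℝ] E3) (u : E3) : ℝ :=
  ∑ j, det3 a (P (cross (stdVec j) u)) (Q (stdVec j))

lemma mixedAt_eq {u v w : E3} (h : IsFrame u v w) (a : E3) (P Q : E3 →L[ℝ] E3) :
    mixedAt a P Q u = det3 a (P v) (Q w) - det3 a (P w) (Q v) := by
  have key : ∀ j, det3 a (P (cross (stdVec j) u)) (Q (stdVec j)) =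
      (w j * u j) * det3 a (P v) (Q u) - (u j * v j) * det3 a (P w) (Q u)
        + (w j * w j) * det3 a (P v) (Q w)
        + (w j * v j) * det3 a (P v) (Q v) - (v j * w j) * det3 a (P w) (Q w)
        - (v j * v j) * det3 a (P w) (Q v) := by
    intro j
    have e := h.expand (stdVec j)
    simp only [inner_stdVec] at e
    have c : cross (stdVec j) u = (w j) • v + (-(v j)) • w := by
      simpa only [inner_stdVec] using h.cross_left (stdVec j)
    rw [c]
    conv_lhs => rw [e]
    simp only [map_add, map_smul, det3_add_mid, det3_add_right,
      det3_smul_mid, det3_smul_right]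
    ring
  have hv := h.vv; have hw := h.ww; have hvw := h.vw; have huv := h.uv
  have huw := h.uw
  rw [inner_eq] at hv hw hvw huv huw
  simp only [mixedAt, key, Fin.sum_univ_three]
  linear_combination det3 a (P v) (Q w) * hw - det3 a (P w) (Q v) * hv
    + (det3 a (P v) (Q v) - det3 a (P w) (Q w)) * hvw
    + det3 a (P v) (Q u) * huw - det3 a (P w) (Q u) * huv

lemma mixedAt_comm (a : E3) (P Q : E3 →L[ℝ] E3) (u : E3) :
    mixedAt a P Q u = mixedAt a Q P u := by
  have e : ∀ L : E3 →L[ℝ] E3, ∀ z : E3,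
      L z = z 0 • L (stdVec 0) + z 1 • L (stdVec 1) + z 2 • L (stdVec 2) := by
    intro L z
    rw [← map_smul, ← map_smul, ← map_smul, ← map_add, ← map_add]
    congr 1
    refine ext3 ?_ ?_ ?_ <;> simp [stdVec_apply]
  simp only [mixedAt, Fin.sum_univ_three]
  rw [e P (cross (stdVec 0) u), e P (cross (stdVec 1) u), e P (cross (stdVec 2) u),
    e Q (cross (stdVec 0) u), e Q (cross (stdVec 1) u), e Q (cross (stdVec 2) u)]
  simp only [cross_apply_zero, cross_apply_one, cross_apply_two, stdVec_apply, det3_add_mid,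
    det3_smul_mid]
  simp [det3]
  ring

/-- The triple product is a derivation in each of its arguments. -/
lemma fderiv_det3 {G : Type*} [NormedAddCommGroup G] [NormedSpace ℝ G] {A B C : G → E3} {x : G}
    (hA : DifferentiableAt ℝ A x) (hB : DifferentiableAt ℝ B x) (hC : DifferentiableAt ℝ C x)
    (v : G) :
    fderiv ℝ (fun y => det3 (A y) (B y) (C y)) x v =
      det3 (fderiv ℝ A x v) (B x) (C x) + det3 (A x) (fderiv ℝ B x v) (C x)
        + det3 (A x) (B x) (fderiv ℝ C x v) := by
  have coord : ∀ {A : G → E3}, DifferentiableAt ℝ A x → ∀ i : Fin 3,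
      HasFDerivAt (fun y => A y i)
        ((EuclideanSpace.proj i : E3 →L[ℝ] ℝ).comp (fderiv ℝ A x)) x := fun h i =>
    (EuclideanSpace.proj i : E3 →L[ℝ] ℝ).hasFDerivAt.comp x h.hasFDerivAt
  have a := coord hA; have b := coord hB; have c := coord hC
  have := ((((a 0).mul (((b 1).mul (c 2)).sub ((b 2).mul (c 1)))).add
    ((a 1).mul (((b 2).mul (c 0)).sub ((b 0).mul (c 2))))).add
    ((a 2).mul (((b 0).mul (c 1)).sub ((b 1).mul (c 0))))).fderiv
  unfold det3
  erw [this]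
  simp
  ring

lemma contDiff_det3 {n : WithTop ℕ∞} :
    ContDiff ℝ n (fun p : E3 × E3 × E3 => det3 p.1 p.2.1 p.2.2) := by
  unfold det3
  fun_prop

lemma contDiffAt_det3 {G : Type*} [NormedAddCommGroup G] [NormedSpace ℝ G] {A B C : G → E3}
    {x : G} {n : WithTop ℕ∞} (hA : ContDiffAt ℝ n A x) (hB : ContDiffAt ℝ n B x)
    (hC : ContDiffAt ℝ n C x) :
    ContDiffAt ℝ n (fun y => det3 (A y) (B y) (C y)) x :=
  contDiff_det3.contDiffAt.comp x (hA.prodMk (hB.prodMk hC))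

/-! ### Integration over the unit sphere -/

/-- The area measure of the round unit sphere. -/
abbrev sphereMeasure : Measure S2 := (volume : Measure E3).toSphere

/-- The radial projection to the unit sphere (with the junk value `0` at the origin). -/
def radialProj (x : E3) : E3 := ‖x‖⁻¹ • x

lemma norm_radialProj {x : E3} (hx : x ≠ 0) : ‖radialProj x‖ = 1 := by
  simp [radialProj, norm_smul, hx]

lemma radialProj_ne_zero {x : E3} (hx : x ≠ 0) : radialProj x ≠ 0 := by
  intro h; simpa [h] using norm_radialProj hx

lemma radialProj_of_norm_eq_one {x : E3} (hx : ‖x‖ = 1) : radialProj x = x := by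
  simp [radialProj, hx]

lemma S2.norm_eq (u : S2) : ‖(u : E3)‖ = 1 := by simp

lemma S2.ne_zero (u : S2) : (u : E3) ≠ 0 := ne_zero_of_mem_unit_sphere u

/-- Integration in polar coordinates. -/
lemma integral_norm_mul_radialProj (φ : ℝ → ℝ) (h : E3 → ℝ) :
    ∫ x : E3, φ ‖x‖ * h (radialProj x) =
      (∫ u : S2, h u ∂sphereMeasure) * ∫ r in Set.Ioi (0 : ℝ), r ^ 2 * φ r := by
  have hd : Module.finrank ℝ E3 - 1 = 2 := by simp
  have mp := (volume : Measure E3).measurePreserving_homeomorphUnitSphereProd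
  rw [hd] at mp
  calc
    _ = ∫ x : ({(0)}ᶜ : Set E3), φ ‖x.1‖ * h (radialProj x.1)
        ∂((volume : Measure E3).comap (↑)) := by
      rw [integral_subtype_comap (measurableSet_singleton _).compl
        fun x : E3 ↦ φ ‖x‖ * h (radialProj x), restrict_compl_singleton]
    _ = ∫ x, h x.1 * φ x.2 ∂sphereMeasure.prod (.volumeIoiPow 2) := by
      rw [← mp.integral_comp (Homeomorph.measurableEmbedding _)]
      congr 1
      ext x
      simp [radialProj, mul_comm]
    _ = (∫ u : S2, h u ∂sphereMeasure) * ∫ x : Set.Ioi (0 : ℝ), φ x ∂.volumeIoiPow 2 :=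
      integral_prod_mul (fun u : S2 => h u) (fun x : Set.Ioi (0 : ℝ) => φ x)
    _ = _ := by
      congr 1
      simp only [Measure.volumeIoiPow, ENNReal.ofReal]
      rw [integral_withDensity_eq_integral_smul,
        integral_subtype_comap measurableSet_Ioi fun a ↦ Real.toNNReal (a ^ 2) • φ a,
        setIntegral_congr_fun measurableSet_Ioi fun x hx ↦ ?_]
      · rw [NNReal.smul_def, Real.coe_toNNReal _ (pow_nonneg hx.out.le _), smul_eq_mul]
      · exact (measurable_subtype_coe.pow_const _).real_toNNReal

/-- The integral over the sphere as an integral over the unit ball. -/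
lemma integral_ball_radialProj (h : E3 → ℝ) :
    ∫ x in Metric.ball (0 : E3) 1, h (radialProj x) = (∫ u : S2, h u ∂sphereMeasure) * (1 / 3) := by
  have e := integral_norm_mul_radialProj ((Set.Iio 1).indicator fun _ => 1) h
  have h1 : ∫ r in Set.Ioi (0 : ℝ), r ^ 2 * (Set.Iio (1 : ℝ)).indicator (fun _ => (1 : ℝ)) r
      = 1 / 3 := by
    have : ∀ r : ℝ, r ^ 2 * (Set.Iio (1 : ℝ)).indicator (fun _ => (1 : ℝ)) r
        = (Set.Iio (1 : ℝ)).indicator (fun r => r ^ 2) r := by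
      intro r; by_cases hr : r ∈ Set.Iio (1 : ℝ) <;> simp [hr]
    simp_rw [this]
    rw [setIntegral_indicator measurableSet_Iio, Set.Ioi_inter_Iio, ← integral_Ioc_eq_integral_Ioo,
      ← intervalIntegral.integral_of_le zero_le_one, integral_pow]
    norm_num
  rw [h1] at e
  rw [← e, ← integral_indicator measurableSet_ball]
  congr 1
  ext x
  by_cases hx : ‖x‖ < 1 <;> simp [Set.indicator, hx]

/-- The area of the sphere is invariant under linear isometries. -/
lemma integral_sphere_comp_isometry (T : E3 ≃ₗᵢ[ℝ] E3) (h : E3 → ℝ) :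
    ∫ u : S2, h (T u) ∂sphereMeasure = ∫ u : S2, h u ∂sphereMeasure := by
  have e1 := integral_ball_radialProj (fun x => h (T x))
  have e2 := integral_ball_radialProj h
  have hT : ∀ x, T (radialProj x) = radialProj (T x) := by
    intro x; simp [radialProj]
  have : ∫ x in Metric.ball (0 : E3) 1, h (T (radialProj x))
      = ∫ x in Metric.ball (0 : E3) 1, h (radialProj x) := by
    simp_rw [hT]
    rw [← (T.measurePreserving).setIntegral_preimage_emb T.toHomeomorph.measurableEmbedding
      (fun x => h (radialProj x))]
    congr 2
    ext x; simp
  rw [e1, e2] at this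
  linarith

lemma integrable_sphere {h : S2 → ℝ} (hh : Continuous h) : Integrable h sphereMeasure :=
  hh.integrable_of_hasCompactSupport (HasCompactSupport.of_compactSpace h)

/-- Differentiation under the integral over the sphere. -/
lemma hasDerivAt_integral_sphere {h : ℝ × E3 → ℝ} {s : ℝ}
    (hh : ∀ u : S2, ContDiffAt ℝ 1 h (s, (u : E3))) :
    HasDerivAt (fun t => ∫ u : S2, h (t, u) ∂sphereMeasure)
      (∫ u : S2, fderiv ℝ h (s, (u : E3)) (1, 0) ∂sphereMeasure) s := by
  -- a tube around `{s} × S²` on which `h` is continuously differentiable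
  have hopen : IsOpen {p : ℝ × S2 | ContDiffAt ℝ 1 h (p.1, (p.2 : E3))} := by
    have : IsOpen {p : ℝ × E3 | ContDiffAt ℝ 1 h p} :=
      isOpen_iff_eventually.2 fun p (hp : ContDiffAt ℝ 1 h p) => hp.eventually (by simp)
    exact this.preimage (f := fun p : ℝ × S2 => (p.1, (p.2 : E3))) (by fun_prop)
  obtain ⟨U, V, hU, hV, hsU, hVS, hUV⟩ := generalized_tube_lemma (s := {s})
    (t := (Set.univ : Set S2)) isCompact_singleton isCompact_univ hopen (by
      rintro ⟨t, u⟩ ⟨ht, -⟩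
      simp only [Set.mem_singleton_iff] at ht
      subst ht
      exact hh u)
  obtain ⟨δ, hδ, hδU⟩ := Metric.nhds_basis_closedBall.mem_iff.1 (hU.mem_nhds (hsU rfl))
  have hC : ∀ t ∈ Metric.closedBall s δ, ∀ u : S2, ContDiffAt ℝ 1 h (t, (u : E3)) :=
    fun t ht u => hUV (Set.mk_mem_prod (hδU ht) (hVS (Set.mem_univ u)))
  have hcont : ContinuousOn (fun p : ℝ × S2 => fderiv ℝ h (p.1, (p.2 : E3)) (1, 0))
      (Metric.closedBall s δ ×ˢ Set.univ) := by
    rintro ⟨t, u⟩ ⟨ht, -⟩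
    have h1 : ContinuousAt (fun p => fderiv ℝ h p (1, 0)) (t, (u : E3)) :=
      ((hC t ht u).fderiv_right (m := 0) (by simp)).continuousAt.clm_apply continuousAt_const
    exact (ContinuousAt.comp (f := fun p : ℝ × S2 => (p.1, (p.2 : E3))) (x := (t, u)) h1
      (by fun_prop)).continuousWithinAt
  obtain ⟨K, hK⟩ := ((isCompact_closedBall s δ).prod isCompact_univ).exists_bound_of_continuousOn
    hcont
  have hcs : ∀ t ∈ Metric.closedBall s δ, Continuous fun u : S2 => h (t, (u : E3)) := by
    intro t ht
    refine continuous_iff_continuousAt.2 fun u => ?_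
    exact ContinuousAt.comp (f := fun u : S2 => (t, (u : E3))) (hC t ht u).continuousAt
      (by fun_prop)
  have hnhds : Metric.closedBall s δ ∈ nhds s := Metric.closedBall_mem_nhds s hδ
  have hss : s ∈ Metric.closedBall s δ := Metric.mem_closedBall_self hδ.le
  refine (hasDerivAt_integral_of_dominated_loc_of_deriv_le (bound := fun _ => K)
    (F' := fun t (u : S2) => fderiv ℝ h (t, (u : E3)) (1, 0)) hnhds ?_ ?_ ?_ ?_ ?_ ?_).2
  · filter_upwards [hnhds] with t ht using (hcs t ht).aestronglyMeasurable
  · exact integrable_sphere (hcs s hss)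
  · have : Continuous fun u : S2 => fderiv ℝ h (s, (u : E3)) (1, 0) := by
      have := hcont.comp_continuous (f := fun u : S2 => (s, u)) (by fun_prop)
        (fun u => ⟨hss, Set.mem_univ u⟩)
      exact this
    exact this.aestronglyMeasurable
  · exact Filter.Eventually.of_forall fun u t ht => hK (t, u) ⟨ht, Set.mem_univ u⟩
  · exact integrable_const K
  · refine Filter.Eventually.of_forall fun u t ht => ?_
    have h1 := ((hC t ht u).differentiableAt (by simp)).hasFDerivAt
    have h2 : HasDerivAt (fun t : ℝ => (t, (u : E3))) ((1 : ℝ), (0 : E3)) t :=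
      (hasDerivAt_id t).prodMk (hasDerivAt_const t (u : E3))
    exact h1.comp_hasDerivAt t h2

/-! ### Stokes' theorem on the sphere -/

/-- Rotation about the unit axis `a` by the angle `t`, given by Rodrigues' formula. -/
def rotate (a : E3) (t : ℝ) (x : E3) : E3 :=
  Real.cos t • x + Real.sin t • cross a x + ((1 - Real.cos t) * ⟪a, x⟫) • a

lemma exists_rotation {a : E3} (ha : ⟪a, a⟫ = 1) (t : ℝ) :
    ∃ T : E3 ≃ₗᵢ[ℝ] E3, ∀ x, T x = rotate a t x := by
  let L : E3 →ₗ[ℝ] E3 :=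
    { toFun := rotate a t
      map_add' := fun x y => by
        refine ext3 ?_ ?_ ?_ <;> simp [rotate, inner_eq] <;> ring
      map_smul' := fun c x => by
        refine ext3 ?_ ?_ ?_ <;> simp [rotate, inner_eq] <;> ring }
  have hL : ∀ x, ‖L x‖ = ‖x‖ := by
    intro x
    have : ⟪L x, L x⟫ = ⟪x, x⟫ := by
      change ⟪rotate a t x, rotate a t x⟫ = ⟪x, x⟫
      have hsc := Real.sin_sq_add_cos_sq t
      rw [inner_eq] at ha
      simp only [rotate, inner_eq, PiLp.add_apply, PiLp.smul_apply, smul_eq_mul, cross_apply_zero,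
        cross_apply_one, cross_apply_two]
      linear_combination (x 0 * x 0 + x 1 * x 1 + x 2 * x 2
          - (a 0 * x 0 + a 1 * x 1 + a 2 * x 2) ^ 2) * hsc
        + (Real.sin t ^ 2 * (x 0 * x 0 + x 1 * x 1 + x 2 * x 2)
          + (1 - Real.cos t) ^ 2 * (a 0 * x 0 + a 1 * x 1 + a 2 * x 2) ^ 2) * ha
    rw [real_inner_self_eq_norm_sq, real_inner_self_eq_norm_sq] at this
    exact (sq_eq_sq₀ (norm_nonneg _) (norm_nonneg _)).1 this
  exact ⟨(⟨L, hL⟩ : E3 →ₗᵢ[ℝ] E3).toLinearIsometryEquiv rfl, fun x => rfl⟩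

/-- The derivative of a function in the direction of an infinitesimal rotation has mean zero, since
the area of the sphere is invariant under rotations.  This form of Stokes' theorem is the only one
that is used. -/
lemma integral_fderiv_cross {h : E3 → ℝ} (hh : ∀ u : S2, ContDiffAt ℝ 1 h u) {a : E3}
    (ha : ⟪a, a⟫ = 1) : ∫ u : S2, fderiv ℝ h u (cross a u) ∂sphereMeasure = 0 := by
  set k : ℝ × E3 → ℝ := fun p => h (rotate a p.1 p.2) with hk
  have hr : ContDiff ℝ 1 (fun p : ℝ × E3 => rotate a p.1 p.2) := by
    rw [contDiff_euclidean]
    intro i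
    fin_cases i <;> simp [rotate, inner_eq] <;> fun_prop
  have hr0 : ∀ u, rotate a 0 u = u := by intro u; simp [rotate]
  have hk1 : ∀ u : S2, ContDiffAt ℝ 1 k (0, (u : E3)) := fun u =>
    ContDiffAt.comp (g := h) (f := fun p : ℝ × E3 => rotate a p.1 p.2) (0, (u : E3))
      (by simpa [hr0] using hh u) hr.contDiffAt
  have hd := hasDerivAt_integral_sphere hk1
  have hconst : (fun t => ∫ u : S2, k (t, u) ∂sphereMeasure)
      = fun _ => ∫ u : S2, h u ∂sphereMeasure := by
    funext t
    obtain ⟨T, hT⟩ := exists_rotation ha t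
    rw [← integral_sphere_comp_isometry T h]
    simp [hk, hT]
  rw [hconst] at hd
  have hz := hd.unique (hasDerivAt_const 0 _)
  rw [← hz]
  congr 1
  ext u
  have h2 : HasDerivAt (fun t : ℝ => (t, (u : E3))) ((1 : ℝ), (0 : E3)) 0 :=
    (hasDerivAt_id _).prodMk (hasDerivAt_const _ (u : E3))
  have h3 := ((hk1 u).differentiableAt (by simp)).hasFDerivAt.comp_hasDerivAt 0 h2
  have h4 : HasDerivAt (fun t : ℝ => rotate a t u) (cross a u) 0 := by
    have c := (Real.hasDerivAt_cos 0)
    have := ((c.smul_const (u : E3)).add ((Real.hasDerivAt_sin 0).smul_const (cross a u))).add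
      (((c.const_sub 1).mul_const ⟪a, (u : E3)⟫).smul_const a)
    simpa [rotate] using! this
  have h5 : HasFDerivAt h (fderiv ℝ h u) (rotate a 0 u) := by
    rw [hr0]; exact ((hh u).differentiableAt (by simp)).hasFDerivAt
  exact (h5.comp_hasDerivAt 0 h4).unique h3

/-- The density `det (A, dB ∧ dC)` on the unit sphere, up to the factor given in `mixedAt_eq`. -/
def mixed (A B C : E3 → E3) (u : E3) : ℝ := mixedAt (A u) (fderiv ℝ B u) (fderiv ℝ C u) u

lemma mixed_comm (A B C : E3 → E3) (u : E3) : mixed A B C u = mixed A C B u :=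
  mixedAt_comm _ _ _ _

lemma inner_stdVec_self (j : Fin 3) : ⟪stdVec j, stdVec j⟫ = 1 := by
  rw [inner_stdVec]; simp [stdVec_apply]

lemma contDiffAt_fderiv_const {A : E3 → E3} {x : E3} (hA : ContDiffAt ℝ ∞ A x) (v : E3) :
    ContDiffAt ℝ ∞ (fun y => fderiv ℝ A y v) x :=
  (hA.fderiv_right (m := ∞) (by simp)).clm_apply contDiffAt_const

lemma contDiffAt_mixed {A B C : E3 → E3} {x : E3} (hA : ContDiffAt ℝ ∞ A x)
    (hB : ContDiffAt ℝ ∞ B x) (hC : ContDiffAt ℝ ∞ C x) : ContDiffAt ℝ ∞ (mixed A B C) x := by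
  unfold mixed mixedAt
  refine ContDiffAt.sum fun j _ => contDiffAt_det3 hA ?_ (contDiffAt_fderiv_const hC _)
  refine (hB.fderiv_right (m := ∞) (by simp)).clm_apply ?_
  refine ContDiff.contDiffAt ?_
  rw [contDiff_euclidean]
  intro i
  fin_cases i <;> simp <;> fun_prop

section
variable {V : Type*} [NormedAddCommGroup V] [NormedSpace ℝ V] {A : V → E3} {x : V}

lemma fderiv_fderiv_const (hA : ContDiffAt ℝ ∞ A x) (v w : V) :
    fderiv ℝ (fun y => fderiv ℝ A y w) x v = fderiv ℝ (fderiv ℝ A) x v w := by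
  rw [fderiv_clm_apply ((hA.fderiv_right (m := ∞) (by simp)).differentiableAt (by simp))
    (differentiableAt_const _)]
  simp

lemma fderiv_fderiv_symm (hA : ContDiffAt ℝ ∞ A x) (v w : V) :
    fderiv ℝ (fderiv ℝ A) x v w = fderiv ℝ (fderiv ℝ A) x w v :=
  (hA.isSymmSndFDerivAt (by simpa using ENat.LEInfty.out)).eq v w

end

lemma continuous_sphere_of_contDiffAt {h : E3 → ℝ} (hh : ∀ u : S2, ContDiffAt ℝ ∞ h u) :
    Continuous fun u : S2 => h u :=
  continuous_iff_continuousAt.2 fun u =>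
    ContinuousAt.comp (f := fun u : S2 => (u : E3)) (hh u).continuousAt (by fun_prop)

/-- Stokes' theorem for the one-form `det (A, B, dC)`: the integral of `det (A, dB ∧ dC)` over the
sphere is symmetric in `A` and `B`. -/
lemma integral_mixed_swap {A B C : E3 → E3} (hA : ∀ u : S2, ContDiffAt ℝ ∞ A u)
    (hB : ∀ u : S2, ContDiffAt ℝ ∞ B u) (hC : ∀ u : S2, ContDiffAt ℝ ∞ C u) :
    ∫ u : S2, mixed A B C u ∂sphereMeasure = ∫ u : S2, mixed B A C u ∂sphereMeasure := by
  have h1 : ∀ j, ∀ u : S2,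
      ContDiffAt ℝ ∞ (fun y => det3 (A y) (B y) (fderiv ℝ C y (stdVec j))) u := fun j u =>
    contDiffAt_det3 (hA u) (hB u) (contDiffAt_fderiv_const (hC u) _)
  have h2 := fun j => integral_fderiv_cross
    (fun u => (h1 j u).of_le (m := 1) ENat.LEInfty.out) (inner_stdVec_self j)
  have hsym : ∀ u : S2, ∀ v w, fderiv ℝ (fun y => fderiv ℝ C y w) u v
      = fderiv ℝ (fun y => fderiv ℝ C y v) u w := by
    intro u v w
    rw [fderiv_fderiv_const (hC u), fderiv_fderiv_const (hC u), fderiv_fderiv_symm (hC u)]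
  have hsum : ∀ u : S2, mixed A B C u - mixed B A C u =
      ∑ j, fderiv ℝ (fun y => det3 (A y) (B y) (fderiv ℝ C y (stdVec j))) u
        (cross (stdVec j) u) := by
    intro u
    have hd : ∀ w, DifferentiableAt ℝ (fun y => fderiv ℝ C y w) u := fun w =>
      (contDiffAt_fderiv_const (hC u) w).differentiableAt (by simp)
    have e1 : ∀ j, fderiv ℝ (fun y => det3 (A y) (B y) (fderiv ℝ C y (stdVec j))) u
        (cross (stdVec j) u) = _ := fun j => fderiv_det3 ((hA u).differentiableAt (by simp))
          ((hB u).differentiableAt (by simp)) (hd _) _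
    simp only [e1, mixed, mixedAt, Finset.sum_add_distrib]
    have e3 : ∑ j, det3 (A u) (B u) (fderiv ℝ (fun y => fderiv ℝ C y (stdVec j)) u
        (cross (stdVec j) u)) = 0 := by
      have e : ∀ L : E3 →L[ℝ] E3, ∀ z : E3,
          L z = z 0 • L (stdVec 0) + z 1 • L (stdVec 1) + z 2 • L (stdVec 2) := by
        intro L z
        rw [← map_smul, ← map_smul, ← map_smul, ← map_add, ← map_add]
        congr 1
        refine ext3 ?_ ?_ ?_ <;> simp [stdVec_apply]
      rw [Fin.sum_univ_three]
      simp only [e _ (cross _ _), cross_apply_zero, cross_apply_one, cross_apply_two, stdVec_apply,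
        det3_add_right, det3_smul_right]
      rw [hsym u (stdVec 1) (stdVec 0), hsym u (stdVec 2) (stdVec 0),
        hsym u (stdVec 2) (stdVec 1)]
      simp
      ring
    rw [e3, add_zero, sub_eq_neg_add, ← Finset.sum_neg_distrib]
    congr 1
    exact Finset.sum_congr rfl fun j _ => (det3_swap_left _ _ _).symm
  have hint : ∀ {A B : E3 → E3}, (∀ u : S2, ContDiffAt ℝ ∞ A u) →
      (∀ u : S2, ContDiffAt ℝ ∞ B u) → Integrable (fun u : S2 => mixed A B C u) sphereMeasure :=
    fun hA hB => integrable_sphere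
      (continuous_sphere_of_contDiffAt fun u => contDiffAt_mixed (hA u) (hB u) (hC u))
  rw [← sub_eq_zero, ← integral_sub (hint hA hB) (hint hB hA)]
  simp_rw [hsum]
  rw [integral_finsetSum]
  · simp [h2]
  · intro j _
    refine integrable_sphere ?_
    refine continuous_iff_continuousAt.2 fun u => ?_
    have h3 : ContinuousAt (fun y => fderiv ℝ
        (fun y => det3 (A y) (B y) (fderiv ℝ C y (stdVec j))) y (cross (stdVec j) y)) (u : E3) := by
      refine (((h1 j u).fderiv_right (m := ∞) (by simp)).continuousAt).clm_apply ?_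
      have : ContDiff ℝ ∞ (fun y => cross (stdVec j) y) := by
        rw [contDiff_euclidean]
        intro i
        fin_cases i <;> simp <;> fun_prop
      exact this.continuous.continuousAt
    exact ContinuousAt.comp (f := fun u : S2 => (u : E3)) h3 (by fun_prop)

/-! ### Radial extensions -/

lemma tangentFrame_inner (u : S2) (i j : Fin 2) :
    ⟪tangentFrame u i, tangentFrame u j⟫ = if i = j then 1 else 0 := by
  have : Fact (Module.finrank ℝ E3 = 2 + 1) := ⟨by simp⟩
  have := (OrthonormalBasis.fromOrthogonalSpanSingleton (𝕜 := ℝ) 2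
    (ne_zero_of_mem_unit_sphere u)).orthonormal
  rw [orthonormal_iff_ite] at this
  exact this i j

lemma inner_tangentFrame (u : S2) (i : Fin 2) : ⟪(u : E3), tangentFrame u i⟫ = 0 := by
  have : Fact (Module.finrank ℝ E3 = 2 + 1) := ⟨by simp⟩
  exact Submodule.mem_orthogonal_singleton_iff_inner_right.1
    ((OrthonormalBasis.fromOrthogonalSpanSingleton (𝕜 := ℝ) 2
    (ne_zero_of_mem_unit_sphere u)) i).2

lemma S2.inner_self (u : S2) : ⟪(u : E3), (u : E3)⟫ = 1 := by
  rw [real_inner_self_eq_norm_sq, S2.norm_eq]; norm_num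

lemma isFrame_tangentFrame (u : S2) :
    IsFrame u (tangentFrame u 0) (cross u (tangentFrame u 0)) :=
  IsFrame.exists_of_unit u.inner_self ((tangentFrame_inner u 0 0).trans (if_pos rfl))
    (inner_tangentFrame u 0)

lemma hasFDerivAt_norm_of_ne_zero {x : E3} (hx : x ≠ 0) :
    HasFDerivAt (fun y : E3 => ‖y‖) (innerSL ℝ (radialProj x)) x := by
  have h1 := (hasStrictFDerivAt_norm_sq x).hasFDerivAt.sqrt (by simpa using hx)
  have e : (fun y : E3 => √(‖y‖ ^ 2)) = fun y => ‖y‖ := by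
    funext y; exact Real.sqrt_sq (norm_nonneg y)
  rw [e] at h1
  refine h1.congr_fderiv ?_
  ext v
  have : ‖x‖ ≠ 0 := by simpa using hx
  simp [radialProj, Real.sqrt_sq]
  field_simp

lemma hasFDerivAt_radialProj {x : E3} (hx : x ≠ 0) :
    HasFDerivAt radialProj (‖x‖⁻¹ • (ContinuousLinearMap.id ℝ E3
      - (innerSL ℝ (radialProj x)).smulRight (radialProj x))) x := by
  have h0 : ‖x‖ ≠ 0 := by simpa using hx
  have h1 := ((hasDerivAt_inv h0).comp_hasFDerivAt x (hasFDerivAt_norm_of_ne_zero hx)).smul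
    (hasFDerivAt_id x)
  refine h1.congr_fderiv ?_
  ext v i
  simp [radialProj]
  field_simp
  ring

lemma contDiffAt_radialProj {x : E3} (hx : x ≠ 0) {n : WithTop ℕ∞} :
    ContDiffAt ℝ n radialProj x :=
  ((contDiffAt_norm ℝ hx).inv (by simpa using hx)).smul contDiffAt_id

/-- The point of the unit sphere in the direction of `x ≠ 0`. -/
def toS2 {x : E3} (hx : x ≠ 0) : S2 := ⟨radialProj x, by simpa using norm_radialProj hx⟩

@[simp] lemma coe_toS2 {x : E3} (hx : x ≠ 0) : (toS2 hx : E3) = radialProj x := rfl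

/-- The extension of a map from the unit sphere that is constant along rays. -/
def radial (A : E3 → E3) (x : E3) : E3 := A (radialProj x)

lemma radial_coe (A : E3 → E3) (u : S2) : radial A u = A u := by
  rw [radial, radialProj_of_norm_eq_one u.norm_eq]

lemma contDiffAt_radial {A : E3 → E3} (hA : ∀ u : S2, ContDiffAt ℝ ∞ A u) {x : E3} (hx : x ≠ 0) :
    ContDiffAt ℝ ∞ (radial A) x :=
  ContDiffAt.comp x (hA (toS2 hx)) (contDiffAt_radialProj hx)

/-- The component of `v` tangent to the sphere of radius `‖x‖`, rescaled to the unit sphere. -/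
def tangentPart (x v : E3) : E3 := ‖x‖⁻¹ • (v - ⟪radialProj x, v⟫ • radialProj x)

lemma inner_tangentPart {x : E3} (hx : x ≠ 0) (v : E3) :
    ⟪radialProj x, tangentPart x v⟫ = 0 := by
  have := (toS2 hx).inner_self
  rw [coe_toS2] at this
  rw [tangentPart, inner_smul_right, inner_sub_right, inner_smul_right, this]
  ring

lemma tangentPart_coe (u : S2) {v : E3} (hv : ⟪(u : E3), v⟫ = 0) : tangentPart u v = v := by
  rw [tangentPart, radialProj_of_norm_eq_one u.norm_eq, hv, u.norm_eq]; simp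

lemma fderiv_radial {A : E3 → E3} {x : E3} (hx : x ≠ 0)
    (hA : DifferentiableAt ℝ A (radialProj x)) (v : E3) :
    fderiv ℝ (radial A) x v = fderiv ℝ A (radialProj x) (tangentPart x v) := by
  have := (hA.hasFDerivAt.comp x (hasFDerivAt_radialProj hx)).fderiv
  change fderiv ℝ (A ∘ radialProj) x v = _
  rw [this]
  simp [tangentPart]

lemma fderiv_radial_coe {A : E3 → E3} {u : S2} (hA : DifferentiableAt ℝ A u) {v : E3}
    (hv : ⟪(u : E3), v⟫ = 0) : fderiv ℝ (radial A) u v = fderiv ℝ A u v := by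
  have e := radialProj_of_norm_eq_one u.norm_eq
  rw [fderiv_radial u.ne_zero (by rwa [e]), tangentPart_coe u hv, e]

/-- The integrand `mixed` only depends on the restrictions of the maps to the sphere. -/
lemma mixed_congr {A B C A' B' C' : E3 → E3} (u : S2) (hA : A u = A' u)
    (hB : ∀ v, ⟪(u : E3), v⟫ = 0 → fderiv ℝ B u v = fderiv ℝ B' u v)
    (hC : ∀ v, ⟪(u : E3), v⟫ = 0 → fderiv ℝ C u v = fderiv ℝ C' u v) :
    mixed A B C u = mixed A' B' C' u := by
  have h := isFrame_tangentFrame u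
  rw [mixed, mixed, mixedAt_eq h, mixedAt_eq h, hA, hB _ h.uv, hB _ h.uw, hC _ h.uv, hC _ h.uw]

/-! ### The Gauss map -/

lemma det3_map (L : E3 →L[ℝ] E3) (a b c : E3) :
    det3 (L a) (L b) (L c) = L.det * det3 a b c := by
  set e := (EuclideanSpace.basisFun (Fin 3) ℝ).toBasis with he
  have key : ∀ a b c : E3, e.det ![a, b, c] = det3 a b c := by
    intro a b c
    rw [Module.Basis.det_apply, Matrix.det_fin_three]
    simp [he, Module.Basis.toMatrix_apply, det3]
    ring
  rw [← key, ← key]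
  have := Module.Basis.det_comp e (L : E3 →ₗ[ℝ] E3) ![a, b, c]
  rw [ContinuousLinearMap.det, ← this]
  congr 1
  ext i j
  fin_cases i <;> rfl

/-- The Jacobian of the Gauss map `n`. -/
def gaussJacobian (n : E3 → E3) (u : E3) : ℝ := mixed n n n u / 2

lemma gaussJacobian_eq (n : E3 → E3) {u v w : E3} (h : IsFrame u v w) :
    gaussJacobian n u = det3 (n u) (fderiv ℝ n u v) (fderiv ℝ n u w) := by
  rw [gaussJacobian, mixed, mixedAt_eq h, det3_swap_right _ (fderiv ℝ n u w)]
  ring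

/-- The degree-one homogeneous extension of the Gauss map to space. -/
def gaussCone (n : E3 → E3) (x : E3) : E3 := ‖x‖ • radial n x

lemma hasFDerivAt_gaussCone {n : E3 → E3} (hn : ∀ u : S2, ContDiffAt ℝ ∞ n u) {x : E3}
    (hx : x ≠ 0) : ∃ L : E3 →L[ℝ] E3, HasFDerivAt (gaussCone n) L x ∧
      L.det = gaussJacobian n (radialProj x) := by
  have h1 := ((contDiffAt_radial hn hx).differentiableAt (by simp)).hasFDerivAt
  have h2 := (hasFDerivAt_norm_of_ne_zero hx).smul h1
  refine ⟨_, h2, ?_⟩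
  set L := ‖x‖ • fderiv ℝ (radial n) x
    + (innerSL ℝ (radialProj x)).smulRight (radial n x) with hL
  have hdn : DifferentiableAt ℝ n (radialProj x) :=
    (hn (toS2 hx)).differentiableAt (by simp)
  have h := isFrame_tangentFrame (toS2 hx)
  rw [coe_toS2] at h
  set v := tangentFrame (toS2 hx) 0
  set w := cross (radialProj x) v
  have h0 : ‖x‖ ≠ 0 := by simpa using hx
  have hL1 : L (radialProj x) = n (radialProj x) := by
    simp only [hL, add_apply, smul_apply,
      ContinuousLinearMap.smulRight_apply, innerSL_apply_apply, fderiv_radial hx hdn]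
    rw [tangentPart, h.uu]
    simp [radial]
  have hL2 : ∀ z, ⟪radialProj x, z⟫ = 0 → L z = fderiv ℝ n (radialProj x) z := by
    intro z hz
    simp only [hL, add_apply, smul_apply,
      ContinuousLinearMap.smulRight_apply, innerSL_apply_apply, fderiv_radial hx hdn]
    rw [tangentPart, hz]
    simp [h0]
  have := det3_map L (radialProj x) v w
  rw [h.det, mul_one, hL1, hL2 v h.uv, hL2 w h.uw, ← gaussJacobian_eq n h] at this
  exact this.symm

/-- A point of a closed convex surface at which the Jacobian of the Gauss map does not vanish is
determined by its normal. -/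
lemma gaussMap_injective {X n : E3 → E3} (hX : ∀ u : S2, ContDiffAt ℝ ∞ X u)
    (hn : ∀ u : S2, ContDiffAt ℝ ∞ n u)
    (horth : ∀ u : S2, ∀ v, ⟪(u : E3), v⟫ = 0 → ⟪n u, fderiv ℝ X u v⟫ = 0)
    (hconv : ∀ u v : S2, ⟪n u, X v - X u⟫ ≤ 0)
    {u v : S2} (huv : n u = n v) (hJ : gaussJacobian n u ≠ 0) : X u = X v := by
  have e1 : ⟪n u, X v - X u⟫ = 0 := by
    have h1 := hconv u v
    have h2 := hconv v u
    rw [← huv, ← neg_sub, inner_neg_right] at h2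
    linarith
  -- the function `w ↦ ⟪n w, X v - X w⟫` is maximal at `u`
  set g : E3 → ℝ := fun x => ⟪radial n x, X v - radial X x⟫ with hg
  have hmax : IsLocalMax g u := by
    have : ∀ᶠ x in nhds (u : E3), x ≠ 0 := isOpen_ne.mem_nhds u.ne_zero
    filter_upwards [this] with x hx
    simp only [hg, radial_coe, e1]
    exact hconv (toS2 hx) v
  have hdn : DifferentiableAt ℝ (radial n) u :=
    (contDiffAt_radial hn u.ne_zero).differentiableAt (by simp)
  have hdX : DifferentiableAt ℝ (radial X) u :=
    (contDiffAt_radial hX u.ne_zero).differentiableAt (by simp)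
  have h0 := hmax.fderiv_eq_zero
  set z := X v - X u with hz
  have hperp : ∀ w, ⟪(u : E3), w⟫ = 0 → ⟪fderiv ℝ n u w, z⟫ = 0 := by
    intro w hw
    have h1 : fderiv ℝ g u w = 0 := by rw [h0]; rfl
    have h2 := fderiv_inner_apply ℝ hdn (hdX.const_sub (X v)) w
    rw [hg, h2, fderiv_const_sub, radial_coe, radial_coe,
      fderiv_radial_coe ((hn u).differentiableAt (by simp)) hw, neg_apply,
      fderiv_radial_coe ((hX u).differentiableAt (by simp)) hw, inner_neg_right, horth u w hw] at h1
    simpa using h1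
  have h := isFrame_tangentFrame u
  rw [gaussJacobian_eq n h] at hJ
  -- `z` is orthogonal to the three linearly independent vectors `n u`, `dn v`, `dn w`
  have hz0 : z = 0 := by
    ext i
    exact (mul_eq_zero.1
      (det3_mul_apply_eq_zero e1 (hperp _ h.uv) (hperp _ h.uw) i)).resolve_left hJ
  rw [hz, sub_eq_zero] at hz0
  exact hz0.symm

/-- The spherical image of a closed convex surface covers the sphere at most once, in the form of a
bound for integrals.  This is the change of variables formula in the unit ball for the homogeneous
extension of the Gauss map, restricted to the open set where it is a local diffeomorphism; no
regularity of the set of parabolic points is needed. -/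
lemma integral_gaussMap_le {X n : E3 → E3} (hX : ∀ u : S2, ContDiffAt ℝ ∞ X u)
    (hn : ∀ u : S2, ContDiffAt ℝ ∞ n u) (hunit : ∀ u : S2, ‖n u‖ = 1)
    (horth : ∀ u : S2, ∀ v, ⟪(u : E3), v⟫ = 0 → ⟪n u, fderiv ℝ X u v⟫ = 0)
    (hconv : ∀ u v : S2, ⟪n u, X v - X u⟫ ≤ 0) (hinj : Function.Injective fun u : S2 => X u)
    {φ : E3 → ℝ} (hφ : Continuous φ) (hφ0 : ∀ u : S2, 0 ≤ φ u) :
    ∫ u : S2, φ (n u) * |gaussJacobian n u| ∂sphereMeasure ≤ ∫ u : S2, φ u ∂sphereMeasure := by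
  have hJc : ∀ x : E3, x ≠ 0 → ContinuousAt (fun x => gaussJacobian n (radialProj x)) x := by
    intro x hx
    have h1 : ContinuousAt (gaussJacobian n) (radialProj x) :=
      ((contDiffAt_mixed (hn (toS2 hx)) (hn (toS2 hx)) (hn (toS2 hx))).continuousAt).div_const 2
    exact ContinuousAt.comp h1 (contDiffAt_radialProj (n := 1) hx).continuousAt
  -- the part of the ball on which the extended Gauss map is injective and non-degenerate
  set S : Set E3 := {x | x ∈ Metric.ball 0 1 ∧ x ≠ 0 ∧ gaussJacobian n (radialProj x) ≠ 0} with hS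
  have hSo : IsOpen S := by
    rw [isOpen_iff_mem_nhds]
    rintro x ⟨hx1, hx0, hx2⟩
    filter_upwards [Metric.isOpen_ball.mem_nhds hx1, isOpen_ne.mem_nhds hx0,
      (hJc x hx0).eventually_ne hx2] with y h1 h2 h3 using ⟨h1, h2, h3⟩
  have hN : ∀ x, x ≠ 0 → ‖gaussCone n x‖ = ‖x‖ := by
    intro x hx
    rw [gaussCone, norm_smul, radial, ← coe_toS2 hx, hunit]; simp
  have hNp : ∀ x, x ≠ 0 → radialProj (gaussCone n x) = n (radialProj x) := by
    intro x hx
    rw [radialProj, hN x hx, gaussCone, smul_smul, inv_mul_cancel₀ (by simpa using hx), one_smul]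
    rfl
  have hNinj : Set.InjOn (gaussCone n) S := by
    rintro x ⟨-, hx0, hx2⟩ y ⟨-, hy0, -⟩ hxy
    have h1 : ‖x‖ = ‖y‖ := by rw [← hN x hx0, ← hN y hy0, hxy]
    have h2 : n (toS2 hx0) = n (toS2 hy0) := by
      rw [coe_toS2, coe_toS2, ← hNp x hx0, ← hNp y hy0, hxy]
    have h3 := hinj (gaussMap_injective hX hn horth hconv h2 hx2)
    have h4 : radialProj x = radialProj y := congrArg Subtype.val h3
    have h5 : ∀ x : E3, x ≠ 0 → x = ‖x‖ • radialProj x := by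
      intro x hx
      rw [radialProj, smul_smul, mul_inv_cancel₀ (by simpa using hx), one_smul]
    rw [h5 x hx0, h5 y hy0, h1, h4]
  have hL : ∀ x : E3, ∃ L : E3 →L[ℝ] E3, x ≠ 0 → HasFDerivAt (gaussCone n) L x ∧
      L.det = gaussJacobian n (radialProj x) := by
    intro x
    by_cases hx : x = 0
    · exact ⟨0, fun h => absurd hx h⟩
    · obtain ⟨L, h⟩ := hasFDerivAt_gaussCone hn hx
      exact ⟨L, fun _ => h⟩
  choose N' hN' using hL
  have hcov := integral_image_eq_integral_abs_det_fderiv_smul volume hSo.measurableSet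
    (fun x hx => (hN' x hx.2.1).1.hasFDerivWithinAt) hNinj (fun y => φ (radialProj y))
  have himg : gaussCone n '' S ⊆ Metric.ball 0 1 := by
    rintro _ ⟨x, hx, rfl⟩
    have := hx.1
    simp only [Metric.mem_ball, dist_zero_right] at this ⊢
    rwa [hN x hx.2.1]
  have hφmeas : Measurable fun y : E3 => φ (radialProj y) := by
    refine hφ.measurable.comp ?_
    unfold radialProj
    fun_prop
  have hint : IntegrableOn (fun y : E3 => φ (radialProj y)) (Metric.ball 0 1) := by
    obtain ⟨K, hK⟩ := (isCompact_closedBall (0 : E3) 1).exists_bound_of_continuousOn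
      hφ.continuousOn
    refine Measure.integrableOn_of_bounded (M := K) measure_ball_lt_top.ne
      hφmeas.aestronglyMeasurable (Filter.Eventually.of_forall fun y => hK _ ?_)
    by_cases hy : y = 0
    · simp [hy, radialProj]
    · simp [norm_radialProj hy]
  have hnull : ∀ᵐ x : E3, x ≠ 0 := by
    simp [ae_iff]
  have hle : ∫ y in gaussCone n '' S, φ (radialProj y)
      ≤ ∫ y in Metric.ball (0 : E3) 1, φ (radialProj y) := by
    refine setIntegral_mono_set hint ?_ himg.eventuallyLE
    refine ae_restrict_of_ae ?_
    filter_upwards [hnull] with y hy using hφ0 (toS2 hy)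
  have hlhs : ∫ x in Metric.ball (0 : E3) 1, φ (n (radialProj x)) * |gaussJacobian n (radialProj x)|
      = ∫ x in S, |(N' x).det| • φ (radialProj (gaussCone n x)) := by
    rw [← integral_indicator measurableSet_ball, ← integral_indicator hSo.measurableSet]
    refine integral_congr_ae ?_
    filter_upwards [hnull] with x hx
    by_cases h1 : x ∈ Metric.ball (0 : E3) 1
    · by_cases h2 : gaussJacobian n (radialProj x) = 0
      · have : x ∉ S := fun h => h.2.2 h2
        simp [h1, this, h2]
      · have : x ∈ S := ⟨h1, hx, h2⟩
        rw [Set.indicator_of_mem h1, Set.indicator_of_mem this, (hN' x hx).2, hNp x hx, smul_eq_mul,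
          mul_comm]
    · have : x ∉ S := fun h => h1 h.1
      rw [Set.indicator_of_notMem h1, Set.indicator_of_notMem this]
  rw [hcov, ← hlhs, integral_ball_radialProj (fun u => φ (n u) * |gaussJacobian n u|),
    integral_ball_radialProj] at hle
  linarith

/-! ### Closed convex surfaces -/

/-- A closed convex surface of Euclidean space, parametrised by the sphere, with outward unit
normal `n`. -/
structure IsConvexSurface (X n : E3 → E3) : Prop where
  smooth : ∀ u : S2, ContDiffAt ℝ ∞ X u
  normal_smooth : ∀ u : S2, ContDiffAt ℝ ∞ n u
  normal_unit : ∀ u : S2, ‖n u‖ = 1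
  normal_orthogonal : ∀ u : S2, ∀ v, ⟪(u : E3), v⟫ = 0 → ⟪n u, fderiv ℝ X u v⟫ = 0
  immersion : ∀ u : S2, ∀ v, ⟪(u : E3), v⟫ = 0 → fderiv ℝ X u v = 0 → v = 0
  inj : Function.Injective fun u : S2 => X u
  convex : ∀ u v : S2, ⟪n u, X v - X u⟫ ≤ 0

/-- For a symmetric positive semidefinite quadratic form in two variables. -/
lemma sq_le_of_psd {a b c : ℝ} (h : ∀ s t : ℝ, 0 ≤ a * s ^ 2 + 2 * b * s * t + c * t ^ 2) :
    b ^ 2 ≤ a * c := by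
  have ha := h 1 0
  have hc := h 0 1
  have h1 := h (-b) a
  have h2 := h c (-b)
  have h3 := h 1 1
  have h4 := h 1 (-1)
  by_contra hlt
  push Not at hlt
  have ha0 : a = 0 := by
    by_contra hne
    have : 0 < a := lt_of_le_of_ne (by linarith) (Ne.symm hne)
    nlinarith
  have hc0 : c = 0 := by
    by_contra hne
    have : 0 < c := lt_of_le_of_ne (by linarith) (Ne.symm hne)
    nlinarith
  subst ha0; subst hc0
  have : b = 0 := by linarith
  simp [this] at hlt

namespace IsConvexSurface
variable {X n : E3 → E3}

lemma normal_inner_self (h : IsConvexSurface X n) (u : S2) : ⟪n u, n u⟫ = 1 := by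
  rw [real_inner_self_eq_norm_sq, h.normal_unit]; norm_num

lemma radial_orthogonal (h : IsConvexSurface X n) {x : E3} (hx : x ≠ 0) (v : E3) :
    ⟪radial n x, fderiv ℝ (radial X) x v⟫ = 0 := by
  rw [fderiv_radial hx ((h.smooth (toS2 hx)).differentiableAt (by simp))]
  exact h.normal_orthogonal (toS2 hx) _ (inner_tangentPart hx v)

lemma inner_fderiv_radial_normal (h : IsConvexSurface X n) {x : E3} (hx : x ≠ 0) (v : E3) :
    ⟪fderiv ℝ (radial n) x v, radial n x⟫ = 0 := by
  have hd : DifferentiableAt ℝ (radial n) x :=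
    (contDiffAt_radial h.normal_smooth hx).differentiableAt (by simp)
  have h1 : (fun y => ⟪radial n y, radial n y⟫) =ᶠ[nhds x] fun _ => (1 : ℝ) := by
    filter_upwards [isOpen_ne.mem_nhds hx] with y hy using h.normal_inner_self (toS2 hy)
  have h2 := fderiv_inner_apply ℝ hd hd v
  rw [h1.fderiv_eq, real_inner_comm] at h2
  simp at h2
  linarith

lemma inner_fderiv_normal (h : IsConvexSurface X n) (u : S2) {v : E3} (hv : ⟪(u : E3), v⟫ = 0) :
    ⟪fderiv ℝ n u v, n u⟫ = 0 := by
  have := h.inner_fderiv_radial_normal u.ne_zero v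
  rwa [fderiv_radial_coe ((h.normal_smooth u).differentiableAt (by simp)) hv, radial_coe] at this

/-- The second fundamental form is symmetric. -/
lemma secondForm_symm (h : IsConvexSurface X n) (u : S2) {v w : E3} (hv : ⟪(u : E3), v⟫ = 0)
    (hw : ⟪(u : E3), w⟫ = 0) :
    ⟪fderiv ℝ n u v, fderiv ℝ X u w⟫ = ⟪fderiv ℝ n u w, fderiv ℝ X u v⟫ := by
  have hX := contDiffAt_radial h.smooth u.ne_zero
  have hn := contDiffAt_radial h.normal_smooth u.ne_zero
  have hdX : DifferentiableAt ℝ (fderiv ℝ (radial X)) u :=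
    (hX.fderiv_right (m := ∞) (by simp)).differentiableAt (by simp)
  have key : ∀ v w : E3, ⟪fderiv ℝ (radial n) u v, fderiv ℝ (radial X) u w⟫
      = -⟪radial n u, fderiv ℝ (fderiv ℝ (radial X)) u v w⟫ := by
    intro v w
    have h1 : (fun y => ⟪radial n y, fderiv ℝ (radial X) y w⟫) =ᶠ[nhds (u : E3)]
        fun _ => (0 : ℝ) := by
      filter_upwards [isOpen_ne.mem_nhds u.ne_zero] with y hy using h.radial_orthogonal hy w
    have h2 := fderiv_inner_apply ℝ (hn.differentiableAt (by simp))
      (hdX.clm_apply (differentiableAt_const w)) v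
    rw [h1.fderiv_eq, fderiv_clm_apply hdX (differentiableAt_const _)] at h2
    simp at h2
    linarith
  have hs := (hX.isSymmSndFDerivAt (by simpa using ENat.LEInfty.out)).eq v w
  have k1 := key v w
  have k2 := key w v
  rw [fderiv_radial_coe ((h.normal_smooth u).differentiableAt (by simp)) hv,
    fderiv_radial_coe ((h.smooth u).differentiableAt (by simp)) hw] at k1
  rw [fderiv_radial_coe ((h.normal_smooth u).differentiableAt (by simp)) hw,
    fderiv_radial_coe ((h.smooth u).differentiableAt (by simp)) hv] at k2
  rw [k1, k2, hs]

/-- The second fundamental form of a convex surface is positive semidefinite, because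
`⟪n x - n y, X x - X y⟫ ≥ 0`. -/
lemma secondForm_nonneg (h : IsConvexSurface X n) (u : S2) {v : E3} (hv : ⟪(u : E3), v⟫ = 0) :
    0 ≤ ⟪fderiv ℝ n u v, fderiv ℝ X u v⟫ := by
  have hcurve : ∀ {A : E3 → E3}, (∀ u : S2, ContDiffAt ℝ ∞ A u) →
      Filter.Tendsto (slope (fun t : ℝ => radial A (u + t • v)) 0) (nhdsWithin 0 {0}ᶜ)
        (nhds (fderiv ℝ A u v)) := by
    intro A hA
    rw [← hasDerivAt_iff_tendsto_slope]
    have h1 : HasDerivAt (fun t : ℝ => (u : E3) + t • v) v 0 := by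
      simpa using ((hasDerivAt_id (0 : ℝ)).smul_const v).const_add (u : E3)
    have h2 := ((contDiffAt_radial hA u.ne_zero).differentiableAt (by simp)).hasFDerivAt
    rw [← fderiv_radial_coe ((hA u).differentiableAt (by simp)) hv]
    exact HasFDerivAt.comp_hasDerivAt (f := fun t : ℝ => (u : E3) + t • v) 0 (by simpa using h2) h1
  refine ge_of_tendsto ((hcurve h.normal_smooth).inner (hcurve h.smooth)) ?_
  have hne : ∀ᶠ t : ℝ in nhds 0, (u : E3) + t • v ≠ 0 := by
    have : ContinuousAt (fun t : ℝ => (u : E3) + t • v) 0 := by fun_prop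
    exact this.eventually_ne (by simpa using u.ne_zero)
  filter_upwards [hne.filter_mono nhdsWithin_le_nhds] with t ht
  have e1 := h.convex u (toS2 ht)
  have e2 := h.convex (toS2 ht) u
  simp only [slope_def_module, sub_zero, zero_smul, add_zero, radial_coe, real_inner_smul_left,
    real_inner_smul_right]
  rw [← mul_assoc]
  refine mul_nonneg (mul_self_nonneg _) ?_
  change 0 ≤ ⟪n (toS2 ht) - n u, X (toS2 ht) - X u⟫
  rw [inner_sub_left]
  rw [← neg_sub, inner_neg_right] at e2
  linarith

/-- The signed area density in a positively oriented orthonormal frame does not vanish. -/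
lemma det3_fderiv_ne_zero (h : IsConvexSurface X n) (u : S2) {v w : E3} (hf : IsFrame u v w) :
    det3 (n u) (fderiv ℝ X u v) (fderiv ℝ X u w) ≠ 0 := by
  intro h0
  have hv := h.normal_orthogonal u v hf.uv
  have hw := h.normal_orthogonal u w hf.uw
  set a := fderiv ℝ X u v with ha
  set b := fderiv ℝ X u w with hb
  have hg := det3_normal_mul a a b b (h.normal_inner_self u) hv hw
  rw [h0] at hg
  have hz : fderiv ℝ X u (⟪a, a⟫ • w - ⟪b, a⟫ • v) = 0 := by
    rw [map_sub, map_smul, map_smul, ← ha, ← hb, ← inner_self_eq_zero (𝕜 := ℝ)]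
    simp only [inner_sub_left, inner_sub_right, real_inner_smul_left, real_inner_smul_right]
    rw [real_inner_comm a b] at hg ⊢
    linear_combination (-⟪a, a⟫) * hg
  have h1 := h.immersion u _ (by
    rw [inner_sub_right, real_inner_smul_right, real_inner_smul_right, hf.uv, hf.uw]; ring) hz
  have h2 : ⟪w, ⟪a, a⟫ • w - ⟪b, a⟫ • v⟫ = 0 := by rw [h1, inner_zero_right]
  rw [inner_sub_right, real_inner_smul_right, real_inner_smul_right, hf.ww,
    real_inner_comm v w, hf.vw] at h2
  have h3 : a = 0 := by
    rw [← inner_self_eq_zero (𝕜 := ℝ)]; linarith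
  have h4 := h.immersion u v hf.uv h3
  have := hf.vv
  simp [h4] at this

lemma orientation_ne_zero (h : IsConvexSurface X n) (u : S2) : mixed n X X u ≠ 0 := by
  have hf := isFrame_tangentFrame u
  rw [mixed, mixedAt_eq hf, det3_swap_right _ (fderiv ℝ X u (cross _ _))]
  have := h.det3_fderiv_ne_zero u hf
  intro h0
  apply this
  linarith

end IsConvexSurface

lemma isPreconnected_univ_S2 : IsPreconnected (Set.univ : Set S2) := by
  have : IsPreconnected (Metric.sphere (0 : E3) 1) :=
    isPreconnected_sphere (by
      rw [← Module.finrank_eq_rank]; simp) 0 1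
  have := Subtype.preconnectedSpace this
  exact isPreconnected_univ

/-- `ε` is the orientation of the surface: `ε = 1` if the parametrisation by the sphere preserves
the orientations given by the outward normals, and `ε = -1` otherwise. -/
def IsOrientation (X n : E3 → E3) (ε : ℝ) : Prop :=
  (ε = 1 ∨ ε = -1) ∧ ∀ u : S2, 0 < ε * mixed n X X u

namespace IsConvexSurface
variable {X n : E3 → E3} {ε : ℝ}

lemma exists_isOrientation (h : IsConvexSurface X n) : ∃ ε, IsOrientation X n ε := by
  have hc : Continuous fun u : S2 => mixed n X X u := continuous_sphere_of_contDiffAt fun u =>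
    contDiffAt_mixed (h.normal_smooth u) (h.smooth u) (h.smooth u)
  by_cases hpos : ∀ u : S2, 0 < mixed n X X u
  · exact ⟨1, Or.inl rfl, fun u => by simpa using hpos u⟩
  · push Not at hpos
    obtain ⟨u₀, hu₀⟩ := hpos
    refine ⟨-1, Or.inr rfl, fun u => ?_⟩
    by_contra hu
    obtain ⟨z, -, hz⟩ := isPreconnected_univ_S2.intermediate_value (Set.mem_univ u₀)
      (Set.mem_univ u) hc.continuousOn (show (0 : ℝ) ∈ _ from ⟨hu₀, by linarith⟩)
    exact h.orientation_ne_zero z hz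

end IsConvexSurface

namespace IsOrientation
variable {X n : E3 → E3} {ε : ℝ}

lemma sq (hε : IsOrientation X n ε) : ε * ε = 1 := by
  rcases hε.1 with h | h <;> simp [h]

lemma eq_of_pos (hε : IsOrientation X n ε) {τ : ℝ} (hτ : τ = 1 ∨ τ = -1) {u : S2}
    (hu : 0 < τ * mixed n X X u) : τ = ε := by
  have h := hε.2 u
  rcases hε.1 with e | e <;> rcases hτ with e' | e' <;> rw [e] at h ⊢ <;>
    rw [e'] at hu ⊢ <;> exfalso <;> linarith

lemma abs_det3 (hε : IsOrientation X n ε) (u : S2) {v w : E3} (hf : IsFrame u v w) :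
    |det3 (n u) (fderiv ℝ X u v) (fderiv ℝ X u w)|
      = ε * det3 (n u) (fderiv ℝ X u v) (fderiv ℝ X u w) := by
  have h := hε.2 u
  rw [mixed, mixedAt_eq hf, det3_swap_right _ (fderiv ℝ X u w)] at h
  rcases hε.1 with e | e
  · rw [e, one_mul, abs_of_pos]; rw [e] at h; linarith
  · rw [e, abs_of_neg, neg_one_mul]; rw [e] at h; linarith

end IsOrientation

/-! ### Curvature densities -/

lemma trace_inv_mul (G B : Matrix (Fin 2) (Fin 2) ℝ) :
    (G⁻¹ * B).trace = (G 1 1 * B 0 0 - G 0 1 * B 1 0 - G 1 0 * B 0 1 + G 0 0 * B 1 1) / G.det := by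
  rw [Matrix.inv_def, Ring.inverse_eq_inv', Matrix.adjugate_fin_two, Matrix.trace_fin_two]
  simp [Matrix.mul_apply, Fin.sum_univ_two]
  ring

lemma christoffel_flatMetric (x v w z : E3) : christoffel flatMetric x v w z = 0 := by
  simp [christoffel, flatMetric]

/-- The second vector of `tangentFrame u` is the third vector of a positively oriented frame, up
to sign. -/
lemma tangentFrame_one (u : S2) : ∃ τ : ℝ, τ * τ = 1 ∧
    tangentFrame u 1 = τ • cross u (tangentFrame u 0) := by
  have hf := isFrame_tangentFrame u
  have e := hf.expand (tangentFrame u 1)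
  have h01 : ⟪tangentFrame u 0, tangentFrame u 1⟫ = 0 := by rw [tangentFrame_inner]; simp
  have h11 : ⟪tangentFrame u 1, tangentFrame u 1⟫ = 1 := by
    rw [tangentFrame_inner]; exact if_pos rfl
  rw [inner_tangentFrame, h01, zero_smul, zero_smul, zero_add, zero_add] at e
  refine ⟨_, ?_, e⟩
  rw [e, real_inner_smul_left, real_inner_smul_right, hf.ww, mul_one] at h11
  exact h11

namespace IsConvexSurface
variable {X n : E3 → E3} {ε : ℝ}

lemma det_firstForm (h : IsConvexSurface X n) (u : S2) :
    (firstForm flatMetric X u).det = det3 (n u) (fderiv ℝ X u (tangentFrame u 0))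
      (fderiv ℝ X u (cross u (tangentFrame u 0))) ^ 2 := by
  obtain ⟨τ, hτ, h1⟩ := tangentFrame_one u
  have hf := isFrame_tangentFrame u
  have hv := h.normal_orthogonal u _ hf.uv
  have hw := h.normal_orthogonal u _ hf.uw
  rw [Matrix.det_fin_two, sq, det3_mul_det3, h.normal_inner_self, hv, hw]
  simp only [firstForm, flatMetric, Matrix.of_apply, h1, map_smul, real_inner_smul_left,
    real_inner_smul_right]
  linear_combination (⟪fderiv ℝ X u (tangentFrame u 0), fderiv ℝ X u (tangentFrame u 0)⟫ *
    ⟪fderiv ℝ X u (cross u (tangentFrame u 0)), fderiv ℝ X u (cross u (tangentFrame u 0))⟫ -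
    ⟪fderiv ℝ X u (tangentFrame u 0), fderiv ℝ X u (cross u (tangentFrame u 0))⟫ *
    ⟪fderiv ℝ X u (cross u (tangentFrame u 0)), fderiv ℝ X u (tangentFrame u 0)⟫) * hτ

lemma areaDensity_eq (h : IsConvexSurface X n) (hε : IsOrientation X n ε) (u : S2) :
    areaDensity flatMetric X u = ε * det3 (n u) (fderiv ℝ X u (tangentFrame u 0))
      (fderiv ℝ X u (cross u (tangentFrame u 0))) := by
  rw [areaDensity, h.det_firstForm, Real.sqrt_sq_eq_abs, hε.abs_det3 u (isFrame_tangentFrame u)]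

/-- The mean curvature density `H dA` is `det (n, dn ∧ dX)`. -/
lemma meanCurvature_mul_areaDensity (h : IsConvexSurface X n) (hε : IsOrientation X n ε) (u : S2) :
    meanCurvature flatMetric X n u * areaDensity flatMetric X u = ε * mixed n n X u := by
  obtain ⟨τ, hτ, h1⟩ := tangentFrame_one u
  have hf := isFrame_tangentFrame u
  have hv := h.normal_orthogonal u _ hf.uv
  have hw := h.normal_orthogonal u _ hf.uw
  have hdne := h.det3_fderiv_ne_zero u hf
  rw [h.areaDensity_eq hε, meanCurvature, trace_inv_mul, h.det_firstForm, mixed, mixedAt_eq hf]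
  simp only [firstForm, secondForm, christoffel_flatMetric, flatMetric, Matrix.of_apply, h1,
    map_smul, real_inner_smul_left, real_inner_smul_right, add_zero]
  have hnv := h.inner_fderiv_normal u hf.uv
  have hnw := h.inner_fderiv_normal u hf.uw
  rw [real_inner_comm] at hnv hnw
  have hn := h.normal_inner_self u
  set a := fderiv ℝ X u (tangentFrame u 0)
  set b := fderiv ℝ X u (cross u (tangentFrame u 0))
  set p := fderiv ℝ n u (tangentFrame u 0)
  set q := fderiv ℝ n u (cross u (tangentFrame u 0))
  have k1 := det3_normal_mul a p b b hn hnv hw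
  have k2 := det3_normal_mul a q b a hn hnw hv
  rw [real_inner_comm p a, real_inner_comm p b] at k1
  rw [real_inner_comm q a, real_inner_comm q b] at k2
  rw [real_inner_comm a b] at k2 ⊢
  set d := det3 (n u) a b
  rw [div_mul_eq_mul_div, div_eq_iff (pow_ne_zero 2 hdne)]
  linear_combination ε * d * (⟪b, b⟫ * ⟪p, a⟫ - ⟪a, b⟫ * ⟪q, a⟫ - ⟪a, b⟫ * ⟪p, b⟫
    + ⟪a, a⟫ * ⟪q, b⟫) * hτ - ε * d * k1 + ε * d * k2

/-- The Gauss curvature density `K dA` is the Jacobian of the Gauss map. -/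
lemma gaussJacobian_mul (h : IsConvexSurface X n) (u : S2) {v w : E3} (hf : IsFrame u v w) :
    gaussJacobian n u * det3 (n u) (fderiv ℝ X u v) (fderiv ℝ X u w) =
      ⟪fderiv ℝ n u v, fderiv ℝ X u v⟫ * ⟪fderiv ℝ n u w, fderiv ℝ X u w⟫
      - ⟪fderiv ℝ n u v, fderiv ℝ X u w⟫ * ⟪fderiv ℝ n u w, fderiv ℝ X u v⟫ := by
  rw [gaussJacobian_eq n hf, det3_mul_det3, h.normal_inner_self, h.normal_orthogonal u v hf.uv,
    h.normal_orthogonal u w hf.uw]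
  ring

lemma secondForm_psd (h : IsConvexSurface X n) (u : S2) {v w : E3} (hv : ⟪(u : E3), v⟫ = 0)
    (hw : ⟪(u : E3), w⟫ = 0) : ⟪fderiv ℝ n u v, fderiv ℝ X u w⟫ ^ 2
      ≤ ⟪fderiv ℝ n u v, fderiv ℝ X u v⟫ * ⟪fderiv ℝ n u w, fderiv ℝ X u w⟫ := by
  refine sq_le_of_psd fun s t => ?_
  have h1 := h.secondForm_nonneg u (v := s • v + t • w) (by
    rw [inner_add_right, real_inner_smul_right, real_inner_smul_right, hv, hw]; ring)
  simp only [map_add, map_smul, inner_add_left, inner_add_right, real_inner_smul_left,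
    real_inner_smul_right] at h1
  rw [h.secondForm_symm u hw hv] at h1
  linarith

lemma abs_gaussJacobian (h : IsConvexSurface X n) (hε : IsOrientation X n ε) (u : S2) :
    |gaussJacobian n u| = ε * gaussJacobian n u := by
  have hf := isFrame_tangentFrame u
  have h1 := h.gaussJacobian_mul u hf
  have h2 := h.secondForm_psd u hf.uv hf.uw
  rw [h.secondForm_symm u hf.uw hf.uv, ← sq] at h1
  have h3 := hε.abs_det3 u hf
  have h4 := abs_pos.2 (h.det3_fderiv_ne_zero u hf)
  set d := det3 (n u) (fderiv ℝ X u (tangentFrame u 0))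
    (fderiv ℝ X u (cross u (tangentFrame u 0)))
  have h5 : 0 ≤ (ε * gaussJacobian n u) * |d| := by
    rw [h3]
    have := hε.sq
    have e : ε * gaussJacobian n u * (ε * d) = (ε * ε) * (gaussJacobian n u * d) := by ring
    rw [e, this, h1]
    linarith
  have h6 : 0 ≤ ε * gaussJacobian n u := nonneg_of_mul_nonneg_left h5 h4
  rw [← abs_of_nonneg h6, abs_mul]
  rcases hε.1 with e | e <;> simp [e]

lemma gaussCurvature_mul_areaDensity (h : IsConvexSurface X n) (hε : IsOrientation X n ε) (u : S2) :
    gaussCurvature X n u * areaDensity flatMetric X u = ε * gaussJacobian n u := by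
  obtain ⟨τ, hτ, h1⟩ := tangentFrame_one u
  have hf := isFrame_tangentFrame u
  have hdne := h.det3_fderiv_ne_zero u hf
  have h2 := h.gaussJacobian_mul u hf
  rw [h.areaDensity_eq hε, gaussCurvature, h.det_firstForm, Matrix.det_fin_two]
  simp only [secondForm, christoffel_flatMetric, flatMetric, Matrix.of_apply, h1,
    map_smul, real_inner_smul_left, real_inner_smul_right, add_zero]
  set d := det3 (n u) (fderiv ℝ X u (tangentFrame u 0))
    (fderiv ℝ X u (cross u (tangentFrame u 0)))
  rw [div_mul_eq_mul_div, div_eq_iff (pow_ne_zero 2 hdne)]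
  set a := fderiv ℝ X u (tangentFrame u 0)
  set b := fderiv ℝ X u (cross u (tangentFrame u 0))
  set p := fderiv ℝ n u (tangentFrame u 0)
  set q := fderiv ℝ n u (cross u (tangentFrame u 0))
  linear_combination ε * d * (⟪p, a⟫ * ⟪q, b⟫ - ⟪p, b⟫ * ⟪q, a⟫) * hτ - ε * d * h2

/-! ### Total mean curvature -/

lemma integrable_mixed {A B C : E3 → E3} (hA : ∀ u : S2, ContDiffAt ℝ ∞ A u)
    (hB : ∀ u : S2, ContDiffAt ℝ ∞ B u) (hC : ∀ u : S2, ContDiffAt ℝ ∞ C u) :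
    Integrable (fun u : S2 => mixed A B C u) sphereMeasure :=
  integrable_sphere (continuous_sphere_of_contDiffAt fun u => contDiffAt_mixed (hA u) (hB u) (hC u))

lemma mixed_normal_normal (h : IsConvexSurface X n) (Z : E3 → E3) (u : S2) :
    mixed Z n n u = 2 * (⟪Z u, n u⟫ * gaussJacobian n u) := by
  have hf := isFrame_tangentFrame u
  rw [mixed, mixedAt_eq hf, det3_swap_right _ (fderiv ℝ n u (cross _ _)),
    det3_of_perp (h.normal_inner_self u) (h.inner_fderiv_normal u hf.uv)
      (h.inner_fderiv_normal u hf.uw), gaussJacobian_eq n hf]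
  ring

/-- Minkowski's formula: the integral of the mean curvature is twice the integral of the support
function times the Gauss curvature. -/
lemma integral_mixed_eq (h : IsConvexSurface X n) (hε : IsOrientation X n ε) (p : E3) :
    ε * ∫ u : S2, mixed n n X u ∂sphereMeasure
      = 2 * ∫ u : S2, ⟪X u - p, n u⟫ * |gaussJacobian n u| ∂sphereMeasure := by
  set Z : E3 → E3 := fun x => X x - p with hZ
  have hZs : ∀ u : S2, ContDiffAt ℝ ∞ Z u := fun u => (h.smooth u).sub contDiffAt_const
  have e1 : ∀ u : S2, mixed n n X u = mixed n Z n u := by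
    intro u
    rw [mixed_comm]
    refine mixed_congr u rfl (fun v _ => ?_) fun v _ => rfl
    rw [hZ, fderiv_sub_const]
  simp_rw [e1]
  rw [integral_mixed_swap h.normal_smooth hZs h.normal_smooth, ← integral_const_mul,
    ← integral_const_mul]
  congr 1
  ext u
  rw [h.mixed_normal_normal, h.abs_gaussJacobian hε u]
  ring

lemma integral_mixed_nonneg (h : IsConvexSurface X n) (hε : IsOrientation X n ε) :
    0 ≤ ε * ∫ u : S2, mixed n n X u ∂sphereMeasure := by
  let u₀ : S2 := ⟨stdVec 0, by simp [stdVec]⟩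
  rw [h.integral_mixed_eq hε (X u₀)]
  refine mul_nonneg zero_le_two (integral_nonneg fun u => mul_nonneg ?_ (abs_nonneg _))
  have := h.convex u u₀
  rw [← neg_sub, inner_neg_right, real_inner_comm] at this
  linarith

/-- The integral of the mean curvature is at most twice the integral over the sphere of any
non-negative function which bounds the support function. -/
lemma integral_mixed_le (h : IsConvexSurface X n) (hε : IsOrientation X n ε) (p : E3) {φ : E3 → ℝ}
    (hφ : Continuous φ) (hφ0 : ∀ u : S2, 0 ≤ φ u) (hle : ∀ u : S2, ⟪X u - p, n u⟫ ≤ φ (n u)) :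
    ε * ∫ u : S2, mixed n n X u ∂sphereMeasure ≤ 2 * ∫ u : S2, φ u ∂sphereMeasure := by
  rw [h.integral_mixed_eq hε p]
  refine mul_le_mul_of_nonneg_left (le_trans ?_ (integral_gaussMap_le h.smooth h.normal_smooth
    h.normal_unit h.normal_orthogonal h.convex h.inj hφ hφ0)) zero_le_two
  have hJ : Continuous fun u : S2 => gaussJacobian n u := continuous_sphere_of_contDiffAt fun u =>
    (contDiffAt_mixed (h.normal_smooth u) (h.normal_smooth u) (h.normal_smooth u)).div_const 2
  have hc : ∀ {A : E3 → E3}, (∀ u : S2, ContDiffAt ℝ ∞ A u) → Continuous fun u : S2 => A u :=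
    fun hA => continuous_iff_continuousAt.2 fun u =>
      ContinuousAt.comp (f := fun u : S2 => (u : E3)) (hA u).continuousAt (by fun_prop)
  have hnc := hc h.normal_smooth
  refine integral_mono (integrable_sphere ?_) (integrable_sphere ?_) fun u => ?_
  · exact (((hc h.smooth).sub continuous_const).inner hnc).mul hJ.abs
  · exact (hφ.comp hnc).mul hJ.abs
  · exact mul_le_mul_of_nonneg_right (hle u) (abs_nonneg _)

end IsConvexSurface

/-! ### Orthonormal triples -/

/-- An orthonormal triple of vectors of Euclidean three-space, of either orientation. -/
def IsOrthonormalTriple (r : Fin 3 → E3) : Prop := ∀ i j, ⟪r i, r j⟫ = if i = j then 1 else 0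

namespace IsOrthonormalTriple
variable {r : Fin 3 → E3}

lemma parseval (h : IsOrthonormalTriple r) (x y : E3) : ∑ i, ⟪x, r i⟫ * ⟪r i, y⟫ = ⟪x, y⟫ := by
  have hon : Orthonormal ℝ r := orthonormal_iff_ite.2 h
  have hcard : Fintype.card (Fin 3) = Module.finrank ℝ E3 := by simp
  have hspan := (basisOfOrthonormalOfCardEqFinrank hon hcard).span_eq
  rw [coe_basisOfOrthonormalOfCardEqFinrank] at hspan
  have := (OrthonormalBasis.mk hon hspan.ge).sum_inner_mul_inner x y
  simpa using this

lemma eq_of_inner (h : IsOrthonormalTriple r) {x y : E3} (hxy : ∀ i, ⟪r i, x⟫ = ⟪r i, y⟫) :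
    x = y := by
  rw [← sub_eq_zero, ← inner_self_eq_zero (𝕜 := ℝ), ← h.parseval]
  refine Finset.sum_eq_zero fun i _ => ?_
  rw [inner_sub_right, hxy i, sub_self, mul_zero]

lemma sum_inner_self (h : IsOrthonormalTriple r) : ∑ i, ⟪r i, r i⟫ = 3 := by
  rw [Fin.sum_univ_three, h, h, h]
  norm_num

lemma sum_det3_cross (h : IsOrthonormalTriple r) (z φ : E3) :
    ∑ i, det3 z (r i) (cross (r i) φ) = -2 * ⟪z, φ⟫ := by
  have e : ∀ i, det3 z (r i) (cross (r i) φ) = ⟪z, r i⟫ * ⟪r i, φ⟫ - ⟪z, φ⟫ * ⟪r i, r i⟫ := by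
    intro i
    simp only [det3, inner_eq, cross_apply_zero, cross_apply_one, cross_apply_two]; ring
  simp_rw [e]
  rw [Finset.sum_sub_distrib, ← Finset.mul_sum, h.parseval, h.sum_inner_self]
  ring

lemma sum_det3_cross_cross (h : IsOrthonormalTriple r) (z θ φ : E3) :
    ∑ i, det3 z (cross (r i) θ) (cross (r i) φ) = det3 z θ φ := by
  have e : ∀ i, det3 z (cross (r i) θ) (cross (r i) φ) = ⟪z, r i⟫ * ⟪r i, cross θ φ⟫ := by
    intro i
    simp only [det3, inner_eq, cross_apply_zero, cross_apply_one, cross_apply_two]; ring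
  simp_rw [e]
  rw [h.parseval, inner_cross]

/-- An infinitesimal rotation of an orthonormal triple is given by an axial vector. -/
lemma exists_axial (h : IsOrthonormalTriple r) {D : Fin 3 → E3}
    (hD : ∀ i j, ⟪D i, r j⟫ + ⟪r i, D j⟫ = 0) : ∃ θ, ∀ i, D i = cross (r i) θ := by
  refine ⟨(-(1 / 2) : ℝ) • ∑ i, cross (r i) (D i), fun j => ?_⟩
  refine ext_inner_left ℝ fun y => ?_
  have e : ⟪y, cross (r j) ((-(1 / 2) : ℝ) • ∑ i, cross (r i) (D i))⟫
      = -(1 / 2) * ∑ i, (⟪y, r i⟫ * ⟪r j, D i⟫ - ⟪y, D i⟫ * ⟪r j, r i⟫) := by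
    simp only [inner_eq, Fin.sum_univ_three, PiLp.smul_apply, PiLp.add_apply, smul_eq_mul,
      cross_apply_zero, cross_apply_one, cross_apply_two]
    ring
  have e1 : ∑ i, ⟪y, r i⟫ * ⟪r j, D i⟫ = -⟪y, D j⟫ := by
    rw [← h.parseval y (D j), ← Finset.sum_neg_distrib]
    refine Finset.sum_congr rfl fun i _ => ?_
    have := hD j i
    rw [real_inner_comm (D j) (r i)]
    linear_combination ⟪y, r i⟫ * this
  have e2 : ∑ i, ⟪y, D i⟫ * ⟪r j, r i⟫ = ⟪y, D j⟫ := by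
    simp [h j]
  rw [e, Finset.sum_sub_distrib, e1, e2]
  ring

end IsOrthonormalTriple

/-! ### Isometric convex surfaces -/

lemma radialProj_radialProj (x : E3) : radialProj (radialProj x) = radialProj x := by
  by_cases hx : x = 0
  · simp [hx, radialProj]
  · exact radialProj_of_norm_eq_one (norm_radialProj hx)

lemma radial_radial (A : E3 → E3) : radial (radial A) = radial A := by
  funext x; simp [radial, radialProj_radialProj]

/-- A field of linear isometries that maps the differential and the normal of the surface `Y` to
those of the surface `X`; the `r i x` are the rows of its matrix at `x`. -/
structure IsTransport (r : Fin 3 → E3 → E3) (X n Y ν : E3 → E3) : Prop where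
  radial_eq : ∀ i, radial (r i) = r i
  smooth : ∀ i, ∀ x, x ≠ 0 → ContDiffAt ℝ ∞ (r i) x
  orthonormal : ∀ x, x ≠ 0 → IsOrthonormalTriple fun i => r i x
  normal : ∀ x, x ≠ 0 → ∀ i, ⟪r i x, radial ν x⟫ = ⟪stdVec i, radial n x⟫
  differential : ∀ x, x ≠ 0 → ∀ i w,
    ⟪r i x, fderiv ℝ (radial Y) x w⟫ = ⟪stdVec i, fderiv ℝ (radial X) x w⟫

/-- The linear map that maps `x` to the normal and acts on the tangent plane of the sphere as the
differential of the parametrisation. -/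
def adaptedFrame (X n : E3 → E3) (x : E3) : E3 →L[ℝ] E3 :=
  fderiv ℝ (radial X) x + (innerSL ℝ x).smulRight (radial n x)

namespace IsConvexSurface
variable {X n Y ν : E3 → E3}

lemma adaptedFrame_self (h : IsConvexSurface X n) (u : S2) : adaptedFrame X n u u = n u := by
  have e : fderiv ℝ (radial X) u u = 0 := by
    rw [fderiv_radial u.ne_zero ((h.smooth (toS2 u.ne_zero)).differentiableAt (by simp)),
      tangentPart, radialProj_of_norm_eq_one u.norm_eq, u.inner_self]
    simp
  simp [adaptedFrame, e, radial_coe]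

lemma adaptedFrame_tangent (h : IsConvexSurface X n) (u : S2) {v : E3} (hv : ⟪(u : E3), v⟫ = 0) :
    adaptedFrame X n u v = fderiv ℝ X u v := by
  simp [adaptedFrame, hv, fderiv_radial_coe ((h.smooth u).differentiableAt (by simp)) hv]

lemma contDiffAt_adaptedFrame (h : IsConvexSurface X n) (u : S2) :
    ContDiffAt ℝ ∞ (adaptedFrame X n) u := by
  have h1 := (contDiffAt_radial h.smooth u.ne_zero).fderiv_right (m := ∞) (by simp)
  have h2 := contDiffAt_radial h.normal_smooth u.ne_zero
  exact h1.add ((innerSL ℝ).contDiff.contDiffAt.smulRight h2)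

lemma tangent_decomp (u : S2) (v : E3) :
    ∃ t, ⟪(u : E3), t⟫ = 0 ∧ v = ⟪(u : E3), v⟫ • (u : E3) + t :=
  ⟨v - ⟪(u : E3), v⟫ • (u : E3), by
    rw [inner_sub_right, real_inner_smul_right, u.inner_self]; ring, by abel⟩

lemma inner_adaptedFrame (h : IsConvexSurface X n) (u : S2) {v w : E3} (hv : ⟪(u : E3), v⟫ = 0)
    (hw : ⟪(u : E3), w⟫ = 0) (s t : ℝ) :
    ⟪adaptedFrame X n u (s • (u : E3) + v), adaptedFrame X n u (t • (u : E3) + w)⟫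
      = s * t + ⟪fderiv ℝ X u v, fderiv ℝ X u w⟫ := by
  simp only [map_add, map_smul, h.adaptedFrame_self, h.adaptedFrame_tangent u hv,
    h.adaptedFrame_tangent u hw, inner_add_left, inner_add_right, real_inner_smul_left,
    real_inner_smul_right, h.normal_inner_self, h.normal_orthogonal u w hw]
  rw [real_inner_comm, h.normal_orthogonal u v hv]
  ring

lemma isInvertible_adaptedFrame (h : IsConvexSurface X n) (u : S2) :
    (adaptedFrame X n u).IsInvertible := by
  have hinj : Function.Injective (adaptedFrame X n u) := by
    rw [injective_iff_map_eq_zero]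
    intro z hz
    obtain ⟨t, ht, e⟩ := tangent_decomp u z
    have h1 := h.inner_adaptedFrame u ht ht ⟪(u : E3), z⟫ ⟪(u : E3), z⟫
    rw [← e, hz, inner_zero_left] at h1
    have h2 : ⟪fderiv ℝ X u t, fderiv ℝ X u t⟫ = 0 := by
      nlinarith [real_inner_self_nonneg (x := fderiv ℝ X u t), mul_self_nonneg ⟪(u : E3), z⟫]
    have h3 : ⟪(u : E3), z⟫ = 0 := by
      rw [h2] at h1; nlinarith
    rw [e, h3, h.immersion u t ht (inner_self_eq_zero.1 h2)]
    simp
  have hinj' : Function.Injective (adaptedFrame X n u : E3 →ₗ[ℝ] E3) := hinj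
  let e := LinearEquiv.ofInjectiveEndo _ hinj'
  exact ⟨e.toContinuousLinearEquiv, by ext v : 1; rfl⟩

/-- Isometric surfaces are related by a field of linear isometries. -/
lemma exists_transport (hX : IsConvexSurface X n) (hY : IsConvexSurface Y ν)
    (hiso : ∀ u : S2, ∀ v w : E3, ⟪(u : E3), v⟫ = 0 → ⟪(u : E3), w⟫ = 0 →
      ⟪fderiv ℝ Y u v, fderiv ℝ Y u w⟫ = ⟪fderiv ℝ X u v, fderiv ℝ X u w⟫) :
    ∃ r, IsTransport r X n Y ν := by
  set ρ : Fin 3 → E3 → E3 := fun i x =>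
    adaptedFrame Y ν x ((adaptedFrame X n x).inverse (stdVec i)) with hρ
  have hρs : ∀ i, ∀ u : S2, ContDiffAt ℝ ∞ (ρ i) u := by
    intro i u
    refine (hY.contDiffAt_adaptedFrame u).clm_apply (ContDiffAt.clm_apply ?_ contDiffAt_const)
    exact ((hX.isInvertible_adaptedFrame u).contDiffAt_map_inverse).comp (u : E3)
      (hX.contDiffAt_adaptedFrame u)
  have hinner : ∀ u : S2, ∀ v w, ⟪adaptedFrame Y ν u v, adaptedFrame Y ν u w⟫
      = ⟪adaptedFrame X n u v, adaptedFrame X n u w⟫ := by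
    intro u v w
    obtain ⟨s, hs, ev⟩ := tangent_decomp u v
    obtain ⟨t, ht, ew⟩ := tangent_decomp u w
    rw [ev, ew, hY.inner_adaptedFrame u hs ht, hX.inner_adaptedFrame u hs ht, hiso u s t hs ht]
  have hinv : ∀ u : S2, ∀ z, adaptedFrame X n u ((adaptedFrame X n u).inverse z) = z := by
    intro u z
    have := (hX.isInvertible_adaptedFrame u).self_comp_inverse
    exact congrArg (fun L : E3 →L[ℝ] E3 => L z) this
  have hρw : ∀ i, ∀ u : S2, ∀ w,
      ⟪ρ i u, adaptedFrame Y ν u w⟫ = ⟪stdVec i, adaptedFrame X n u w⟫ := by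
    intro i u w
    rw [hρ, hinner, hinv]
  refine ⟨fun i => radial (ρ i), fun i => radial_radial _, fun i x hx =>
    contDiffAt_radial (hρs i) hx, fun x hx i j => ?_, fun x hx i => ?_, fun x hx i w => ?_⟩
  · change ⟪ρ i (toS2 hx), ρ j (toS2 hx)⟫ = _
    rw [hρ, hinner, hinv, hinv, inner_stdVec, stdVec_apply]
    simp only [eq_comm]
  · have := hρw i (toS2 hx) (toS2 hx)
    rw [hY.adaptedFrame_self, hX.adaptedFrame_self] at this
    exact this
  · have ht := inner_tangentPart hx w
    rw [← coe_toS2 hx] at ht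
    have := hρw i (toS2 hx) (tangentPart x w)
    rw [hY.adaptedFrame_tangent _ ht, hX.adaptedFrame_tangent _ ht] at this
    rw [fderiv_radial hx ((hY.smooth (toS2 hx)).differentiableAt (by simp)),
      fderiv_radial hx ((hX.smooth (toS2 hx)).differentiableAt (by simp))]
    exact this

end IsConvexSurface

/-- For two symmetric positive semidefinite `2 × 2` matrices with the same determinant, the
determinant of the difference is not positive. -/
lemma det_sub_nonpos {a b c a' b' c' : ℝ} (ha : 0 ≤ a) (hc : 0 ≤ c) (ha' : 0 ≤ a') (hc' : 0 ≤ c')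
    (h : b ^ 2 ≤ a * c) (hdet : a * c - b * b = a' * c' - b' * b') :
    (a - a') * (c - c') - (b - b') * (b - b') ≤ 0 := by
  set δ := a * c - b * b with hδ
  have hδ0 : 0 ≤ δ := by rw [hδ]; nlinarith
  -- `a c' + a' c ≥ 2 √(a c a' c') ≥ 2 (δ + b b')`
  have h1 : 0 ≤ a * c' + a' * c := by positivity
  have h2 : (2 * (δ + b * b')) ^ 2 ≤ (a * c' + a' * c) ^ 2 := by
    have e1 : a * c = δ + b * b := by rw [hδ]; ring
    have e2 : a' * c' = δ + b' * b' := by linarith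
    have e3 : (a * c' + a' * c) ^ 2 = (a * c' - a' * c) ^ 2 + 4 * ((a * c) * (a' * c')) := by ring
    rw [e3, e1, e2]
    nlinarith [sq_nonneg (a * c' - a' * c), mul_nonneg hδ0 (sq_nonneg (b - b'))]
  have h3 := abs_le_of_sq_le_sq' h2 h1
  nlinarith [h3.2]

/-! ### Herglotz's comparison of total mean curvatures -/

lemma det3_cycle (a b c : E3) : det3 a b c = det3 b c a := by simp only [det3]; ring

lemma det3_cross_right (m p φ : E3) :
    det3 m p (cross φ m) = ⟪p, m⟫ * ⟪φ, m⟫ - ⟪p, φ⟫ * ⟪m, m⟫ := by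
  simp only [det3, inner_eq, cross_apply_zero, cross_apply_one, cross_apply_two]; ring

lemma det3_cross_cross (m θ φ : E3) :
    det3 m (cross θ m) (cross φ m) = ⟪m, m⟫ * det3 m θ φ := by
  simp only [det3, inner_eq, cross_apply_zero, cross_apply_one, cross_apply_two]; ring

lemma fderiv_inner_eq {A B C D : E3 → E3} {x : E3} (hA : DifferentiableAt ℝ A x)
    (hB : DifferentiableAt ℝ B x) (hC : DifferentiableAt ℝ C x) (hD : DifferentiableAt ℝ D x)
    (h : (fun y => ⟪A y, B y⟫) =ᶠ[nhds x] fun y => ⟪C y, D y⟫) (v : E3) :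
    ⟪A x, fderiv ℝ B x v⟫ + ⟪fderiv ℝ A x v, B x⟫
      = ⟪C x, fderiv ℝ D x v⟫ + ⟪fderiv ℝ C x v, D x⟫ := by
  rw [← fderiv_inner_apply ℝ hA hB, ← fderiv_inner_apply ℝ hC hD, h.fderiv_eq]

namespace IsTransport
variable {r : Fin 3 → E3 → E3} {X n Y ν : E3 → E3}

/-- The derivative of the transport in a fixed direction is an infinitesimal rotation. -/
lemma exists_axial (hr : IsTransport r X n Y ν) (hX : IsConvexSurface X n)
    (hY : IsConvexSurface Y ν) (u : S2) {z : E3} (hz : ⟪(u : E3), z⟫ = 0) :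
    ∃ θ, (∀ i, fderiv ℝ (r i) u z = cross (r i u) θ) ∧
      ∀ i, ⟪r i u, fderiv ℝ ν u z + cross θ (ν u)⟫ = ⟪stdVec i, fderiv ℝ n u z⟫ := by
  have hd : ∀ i, DifferentiableAt ℝ (r i) u := fun i =>
    (hr.smooth i u u.ne_zero).differentiableAt (by simp)
  obtain ⟨θ, hθ⟩ := (hr.orthonormal u u.ne_zero).exists_axial (D := fun i => fderiv ℝ (r i) u z) (by
    intro i j
    have h1 : (fun y => ⟪r i y, r j y⟫) =ᶠ[nhds (u : E3)]
        fun _ => ⟪stdVec 0, (if i = j then (1 : ℝ) else 0) • stdVec 0⟫ := by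
      filter_upwards [isOpen_ne.mem_nhds u.ne_zero] with y hy
      rw [hr.orthonormal y hy i j, real_inner_smul_right, inner_stdVec_self, mul_one]
    have h2 := fderiv_inner_eq (hd i) (hd j) (differentiableAt_const _) (differentiableAt_const _)
      h1 z
    simp at h2
    linarith)
  refine ⟨θ, hθ, fun i => ?_⟩
  have hdν := (contDiffAt_radial hY.normal_smooth u.ne_zero).differentiableAt (by simp)
  have hdn := (contDiffAt_radial hX.normal_smooth u.ne_zero).differentiableAt (by simp)
  have h1 : (fun y => ⟪r i y, radial ν y⟫) =ᶠ[nhds (u : E3)] fun y => ⟪stdVec i, radial n y⟫ := by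
    filter_upwards [isOpen_ne.mem_nhds u.ne_zero] with y hy using hr.normal y hy i
  have h2 := fderiv_inner_eq (hd i) hdν (differentiableAt_const _) hdn h1 z
  rw [fderiv_radial_coe ((hY.normal_smooth u).differentiableAt (by simp)) hz,
    fderiv_radial_coe ((hX.normal_smooth u).differentiableAt (by simp)) hz, radial_coe, hθ] at h2
  have e : ⟪cross (r i u) θ, ν u⟫ = ⟪r i u, cross θ (ν u)⟫ := by
    simp only [inner_eq, cross_apply_zero, cross_apply_one, cross_apply_two]; ring
  rw [inner_add_right, ← e, h2]
  simp

/-- The axial vectors of the transport are tangent to the surface `Y`, because the differential of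
`X` is closed. -/
lemma axial_tangent (hr : IsTransport r X n Y ν) (hX : IsConvexSurface X n)
    (hY : IsConvexSurface Y ν) {u : S2} {v w θ φ : E3} (hf : IsFrame u v w)
    (hθ : ∀ i, fderiv ℝ (r i) u v = cross (r i u) θ)
    (hφ : ∀ i, fderiv ℝ (r i) u w = cross (r i u) φ) : ⟪θ, ν u⟫ = 0 ∧ ⟪φ, ν u⟫ = 0 := by
  have hd : ∀ i, DifferentiableAt ℝ (r i) u := fun i =>
    (hr.smooth i u u.ne_zero).differentiableAt (by simp)
  have sY := contDiffAt_radial hY.smooth u.ne_zero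
  have sX := contDiffAt_radial hX.smooth u.ne_zero
  have key : ∀ i, ∀ v w, ⟪r i u, fderiv ℝ (fderiv ℝ (radial Y)) u v w⟫
      + ⟪fderiv ℝ (r i) u v, fderiv ℝ (radial Y) u w⟫
      = ⟪stdVec i, fderiv ℝ (fderiv ℝ (radial X)) u v w⟫ := by
    intro i v w
    have h1 : (fun y => ⟪r i y, fderiv ℝ (radial Y) y w⟫) =ᶠ[nhds (u : E3)]
        fun y => ⟪stdVec i, fderiv ℝ (radial X) y w⟫ := by
      filter_upwards [isOpen_ne.mem_nhds u.ne_zero] with y hy using hr.differential y hy i w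
    have h2 := fderiv_inner_eq (hd i) ((contDiffAt_fderiv_const sY w).differentiableAt (by simp))
      (differentiableAt_const _) ((contDiffAt_fderiv_const sX w).differentiableAt (by simp)) h1 v
    rw [fderiv_fderiv_const sY, fderiv_fderiv_const sX] at h2
    simpa using h2
  have hYv : fderiv ℝ (radial Y) u v = fderiv ℝ Y u v :=
    fderiv_radial_coe ((hY.smooth u).differentiableAt (by simp)) hf.uv
  have hYw : fderiv ℝ (radial Y) u w = fderiv ℝ Y u w :=
    fderiv_radial_coe ((hY.smooth u).differentiableAt (by simp)) hf.uw
  set a := fderiv ℝ Y u v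
  set b := fderiv ℝ Y u w
  have hab : cross θ b = cross φ a := by
    refine (hr.orthonormal u u.ne_zero).eq_of_inner fun i => ?_
    have k1 := key i v w
    have k2 := key i w v
    rw [fderiv_fderiv_symm sY, fderiv_fderiv_symm sX, hYw, hθ] at k1
    rw [hYv, hφ] at k2
    have e : ∀ s x y : E3, ⟪cross s x, y⟫ = ⟪s, cross x y⟫ := by
      intro s x y
      simp only [inner_eq, cross_apply_zero, cross_apply_one, cross_apply_two]; ring
    rw [← e, ← e]
    linarith
  have hd0 : det3 (ν u) a b ≠ 0 := hY.det3_fderiv_ne_zero u hf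
  have ha : ⟪a, ν u⟫ = 0 := by rw [real_inner_comm]; exact hY.normal_orthogonal u v hf.uv
  have hb : ⟪b, ν u⟫ = 0 := by rw [real_inner_comm]; exact hY.normal_orthogonal u w hf.uw
  constructor
  · have h1 : det3 θ a b = 0 := by
      have : det3 θ a b = ⟪a, -cross θ b⟫ := by
        rw [inner_neg_right, inner_cross, det3_swap_left]
      rw [this, hab, inner_neg_right, inner_cross, det3_swap_right]; simp
    rw [det3_of_perp (hY.normal_inner_self u) ha hb] at h1
    exact (mul_eq_zero.1 h1).resolve_right hd0
  · have h1 : det3 φ a b = 0 := by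
      have : det3 φ a b = ⟪b, cross φ a⟫ := by
        rw [inner_cross, det3_cycle b]
      rw [this, ← hab, inner_cross, det3_swap_right]; simp
    rw [det3_of_perp (hY.normal_inner_self u) ha hb] at h1
    exact (mul_eq_zero.1 h1).resolve_right hd0

/-- The one-form `∑ i, det (ν, r i, d (r i))` vanishes: its values are `-2 ⟪θ, ν⟫` for the axial
vectors `θ` of the transport. -/
lemma sum_det3_normal_eq_zero (hr : IsTransport r X n Y ν) (hX : IsConvexSurface X n)
    (hY : IsConvexSurface Y ν) {x : E3} (hx : x ≠ 0) (z : E3) :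
    ∑ i, det3 (radial ν x) (r i x) (fderiv ℝ (r i) x z) = 0 := by
  have key : ∀ u : S2, ∀ z, ⟪(u : E3), z⟫ = 0 →
      ∑ i, det3 (ν u) (r i u) (fderiv ℝ (r i) u z) = 0 := by
    intro u z hz
    have hf := isFrame_tangentFrame u
    obtain ⟨θ, hθ, -⟩ := hr.exists_axial hX hY u hf.uv
    obtain ⟨φ, hφ, -⟩ := hr.exists_axial hX hY u hf.uw
    obtain ⟨h1, h2⟩ := hr.axial_tangent hX hY hf hθ hφ
    have o := hr.orthonormal u u.ne_zero
    have e := hf.expand z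
    rw [hz, zero_smul, zero_add] at e
    rw [real_inner_comm] at h1 h2
    rw [e]
    simp only [map_add, map_smul, hθ, hφ, det3_add_right, det3_smul_right,
      Finset.sum_add_distrib, ← Finset.mul_sum, o.sum_det3_cross, h1, h2]
    ring
  have hd : ∀ i, DifferentiableAt ℝ (r i) (radialProj x) := fun i =>
    (hr.smooth i _ (radialProj_ne_zero hx)).differentiableAt (by simp)
  have e1 : ∀ i, r i x = r i (toS2 hx) := fun i => by
    conv_lhs => rw [← hr.radial_eq i]
    rfl
  have e2 : ∀ i, fderiv ℝ (r i) x z = fderiv ℝ (r i) (toS2 hx) (tangentPart x z) := fun i => by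
    conv_lhs => rw [← hr.radial_eq i, fderiv_radial hx (hd i)]
    rfl
  simp only [e1, e2]
  exact key (toS2 hx) _ (inner_tangentPart hx z)

/-- The Gauss equation: the curvature of the transport vanishes.  It is the exterior derivative of
the identity `sum_det3_normal_eq_zero`. -/
lemma det3_axial (hr : IsTransport r X n Y ν) (hX : IsConvexSurface X n)
    (hY : IsConvexSurface Y ν) {u : S2} {v w θ φ : E3} (hf : IsFrame u v w)
    (hθ : ∀ i, fderiv ℝ (r i) u v = cross (r i u) θ)
    (hφ : ∀ i, fderiv ℝ (r i) u w = cross (r i u) φ) :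
    det3 (ν u) θ φ = ⟪fderiv ℝ ν u v, φ⟫ - ⟪fderiv ℝ ν u w, θ⟫ := by
  have o := hr.orthonormal u u.ne_zero
  have sν := contDiffAt_radial hY.normal_smooth u.ne_zero
  have sr := fun i => hr.smooth i u u.ne_zero
  have key : ∀ v w, ∑ i, (det3 (fderiv ℝ (radial ν) u v) (r i u) (fderiv ℝ (r i) u w)
      + det3 (radial ν u) (fderiv ℝ (r i) u v) (fderiv ℝ (r i) u w)
      + det3 (radial ν u) (r i u) (fderiv ℝ (fderiv ℝ (r i)) u v w)) = 0 := by
    intro v w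
    have h1 : (fun y => ∑ i, det3 (radial ν y) (r i y) (fderiv ℝ (r i) y w)) =ᶠ[nhds (u : E3)]
        fun _ => (0 : ℝ) := by
      filter_upwards [isOpen_ne.mem_nhds u.ne_zero] with y hy using
        hr.sum_det3_normal_eq_zero hX hY hy w
    have h2 := h1.fderiv_eq (𝕜 := ℝ)
    have hdet : ∀ i ∈ Finset.univ, DifferentiableAt ℝ
        (fun y => det3 (radial ν y) (r i y) (fderiv ℝ (r i) y w)) u := fun i _ =>
      (contDiffAt_det3 sν (sr i) (contDiffAt_fderiv_const (sr i) w)).differentiableAt (by simp)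
    rw [fderiv_fun_sum hdet] at h2
    have h3 := DFunLike.congr_fun h2 v
    rw [sum_apply] at h3
    have e1 : ∀ i, fderiv ℝ (fun y => det3 (radial ν y) (r i y) (fderiv ℝ (r i) y w)) u v = _ :=
      fun i => fderiv_det3 (sν.differentiableAt (by simp)) ((sr i).differentiableAt (by simp))
        ((contDiffAt_fderiv_const (sr i) w).differentiableAt (by simp)) v
    simp only [e1, fderiv_fderiv_const (sr _)] at h3
    simpa using h3
  have k1 := key v w
  have k2 := key w v
  simp only [fderiv_fderiv_symm (sr _) w v] at k2
  simp only [radial_coe, fderiv_radial_coe ((hY.normal_smooth u).differentiableAt (by simp)) hf.uv,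
    fderiv_radial_coe ((hY.normal_smooth u).differentiableAt (by simp)) hf.uw, hθ, hφ,
    Finset.sum_add_distrib, o.sum_det3_cross, o.sum_det3_cross_cross] at k1 k2
  rw [det3_swap_right _ φ θ] at k2
  linarith

end IsTransport

namespace IsConvexSurface
variable {X n Y ν : E3 → E3} {ε ε' : ℝ}

/-- The mean curvature density in terms of the first and second fundamental forms. -/
lemma mixed_normal_mul (h : IsConvexSurface X n) (u : S2) {v w : E3} (hf : IsFrame u v w) :
    mixed n n X u * det3 (n u) (fderiv ℝ X u v) (fderiv ℝ X u w) =
      ⟪fderiv ℝ X u v, fderiv ℝ n u v⟫ * ⟪fderiv ℝ X u w, fderiv ℝ X u w⟫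
      - ⟪fderiv ℝ X u v, fderiv ℝ X u w⟫ * ⟪fderiv ℝ X u w, fderiv ℝ n u v⟫
      - (⟪fderiv ℝ X u v, fderiv ℝ n u w⟫ * ⟪fderiv ℝ X u w, fderiv ℝ X u v⟫
      - ⟪fderiv ℝ X u v, fderiv ℝ X u v⟫ * ⟪fderiv ℝ X u w, fderiv ℝ n u w⟫) := by
  have hnv := h.inner_fderiv_normal u hf.uv
  have hnw := h.inner_fderiv_normal u hf.uw
  rw [real_inner_comm] at hnv hnw
  rw [← det3_normal_mul _ _ _ _ (h.normal_inner_self u) hnv (h.normal_orthogonal u w hf.uw),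
    ← det3_normal_mul _ _ _ _ (h.normal_inner_self u) hnw (h.normal_orthogonal u v hf.uv),
    mixed, mixedAt_eq hf]
  ring

/-- Herglotz's inequality between the total mean curvatures of two isometric closed convex surfaces.
With the transport `r` from `Y` to `X`, Stokes' theorem gives
`∫ det (r i, d (r i) ∧ dY) = ∫ det (Y, d (r i) ∧ d (r i))`.  Summed over `i`, the left-hand side is
`-2` times the difference of the total mean curvatures, while the right-hand side is twice the
integral of the support function of `Y` times the determinant of the difference of the two second
fundamental forms, divided by the area density (all up to the signs `ε`, `ε'`).  These forms are
positive semidefinite with equal determinants by the Gauss equation, so the determinant of their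
difference is not positive.  Exchanging the roles of the surfaces gives equality, but one inequality
is enough for comparison with the leaves. -/
theorem integral_mixed_le_of_isometric (hX : IsConvexSurface X n) (hY : IsConvexSurface Y ν)
    (hε : IsOrientation X n ε) (hε' : IsOrientation Y ν ε')
    (hiso : ∀ u : S2, ∀ v w : E3, ⟪(u : E3), v⟫ = 0 → ⟪(u : E3), w⟫ = 0 →
      ⟪fderiv ℝ Y u v, fderiv ℝ Y u w⟫ = ⟪fderiv ℝ X u v, fderiv ℝ X u w⟫) :
    ε' * ∫ u : S2, mixed ν ν Y u ∂sphereMeasure ≤ ε * ∫ u : S2, mixed n n X u ∂sphereMeasure := by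
  obtain ⟨r, hr⟩ := exists_transport hX hY hiso
  have hrs : ∀ i, ∀ u : S2, ContDiffAt ℝ ∞ (r i) u := fun i u => hr.smooth i u u.ne_zero
  let u₀ : S2 := ⟨stdVec 0, by simp [stdVec]⟩
  -- a point of the surface as origin makes its support function non-negative
  set Z : E3 → E3 := fun x => Y x - Y u₀ with hZ
  have hZs : ∀ u : S2, ContDiffAt ℝ ∞ Z u := fun u => (hY.smooth u).sub contDiffAt_const
  have hZd : ∀ u : S2, fderiv ℝ Z u = fderiv ℝ Y u := fun u => by rw [hZ, fderiv_sub_const]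
  -- the pointwise values of both sides of Stokes' theorem
  have hpoint : ∀ u : S2,
      ε' * ∑ i, mixed (r i) (r i) Z u = -2 * (ε * mixed n n X u - ε' * mixed ν ν Y u) ∧
      ε' * ∑ i, mixed Z (r i) (r i) u ≤ 0 := by
    intro u
    have hf := isFrame_tangentFrame u
    set v := tangentFrame u 0
    set w := cross (u : E3) v
    obtain ⟨θ, hθ, hnθ⟩ := hr.exists_axial hX hY u hf.uv
    obtain ⟨φ, hφ, hnφ⟩ := hr.exists_axial hX hY u hf.uw
    obtain ⟨tθ, tφ⟩ := hr.axial_tangent hX hY hf hθ hφ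
    have o := hr.orthonormal u u.ne_zero
    have hG := hr.det3_axial hX hY hf hθ hφ
    have hνν := hY.normal_inner_self u
    have hpν := hY.inner_fderiv_normal u hf.uv
    have hqν := hY.inner_fderiv_normal u hf.uw
    have haν := hY.normal_orthogonal u v hf.uv
    have hbν := hY.normal_orthogonal u w hf.uw
    have hXa : ∀ z, ⟪(u : E3), z⟫ = 0 → ∀ i,
        ⟪r i u, fderiv ℝ Y u z⟫ = ⟪stdVec i, fderiv ℝ X u z⟫ := by
      intro z hz i
      have := hr.differential u u.ne_zero i z
      rwa [fderiv_radial_coe ((hY.smooth u).differentiableAt (by simp)) hz,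
        fderiv_radial_coe ((hX.smooth u).differentiableAt (by simp)) hz] at this
    have ostd : IsOrthonormalTriple stdVec := fun i j => by
      rw [inner_stdVec, stdVec_apply]; simp only [eq_comm]
    have htrans : ∀ {x y x' y' : E3}, (∀ i, ⟪r i u, x⟫ = ⟪stdVec i, x'⟫) →
        (∀ i, ⟪r i u, y⟫ = ⟪stdVec i, y'⟫) → ⟪x, y⟫ = ⟪x', y'⟫ := by
      intro x y x' y' hx hy
      rw [← o.parseval x y, ← ostd.parseval x' y']
      refine Finset.sum_congr rfl fun i _ => ?_
      rw [real_inner_comm, hx, hy, real_inner_comm]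
    have hAA := hiso u v v hf.uv hf.uv
    have hAB := hiso u v w hf.uv hf.uw
    have hBB := hiso u w w hf.uw hf.uw
    have hPA := htrans hnθ (hXa v hf.uv)
    have hPB := htrans hnθ (hXa w hf.uw)
    have hQA := htrans hnφ (hXa v hf.uv)
    have hQB := htrans hnφ (hXa w hf.uw)
    have hJY := hY.gaussJacobian_mul u hf
    have hMX := hX.mixed_normal_mul u hf
    have hbX := hX.secondForm_psd u hf.uv hf.uw
    have hsX := hX.secondForm_symm u hf.uv hf.uw
    have hsY := hY.secondForm_symm u hf.uv hf.uw
    have pX1 := hX.secondForm_nonneg u hf.uv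
    have pX2 := hX.secondForm_nonneg u hf.uw
    have pY1 := hY.secondForm_nonneg u hf.uv
    have pY2 := hY.secondForm_nonneg u hf.uw
    have hdX := hε.abs_det3 u hf
    have hdY := hε'.abs_det3 u hf
    have hdY0 := hY.det3_fderiv_ne_zero u hf
    have hdX2 := det3_normal_mul (fderiv ℝ X u v) (fderiv ℝ X u v) (fderiv ℝ X u w)
      (fderiv ℝ X u w) (hX.normal_inner_self u) (hX.normal_orthogonal u v hf.uv)
      (hX.normal_orthogonal u w hf.uw)
    have hdY2 := det3_normal_mul (fderiv ℝ Y u v) (fderiv ℝ Y u v) (fderiv ℝ Y u w)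
      (fderiv ℝ Y u w) hνν haν hbν
    have hmY : mixed ν ν Y u = det3 (ν u) (fderiv ℝ ν u v) (fderiv ℝ Y u w)
        - det3 (ν u) (fderiv ℝ ν u w) (fderiv ℝ Y u v) := by rw [mixed, mixedAt_eq hf]
    rw [gaussJacobian_eq ν hf] at hJY
    have hs1 : ∑ i, mixed (r i) (r i) Z u
        = -2 * ⟪fderiv ℝ Y u w, θ⟫ + 2 * ⟪fderiv ℝ Y u v, φ⟫ := by
      have e : ∀ i, mixed (r i) (r i) Z u = det3 (fderiv ℝ Y u w) (r i u) (cross (r i u) θ)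
          - det3 (fderiv ℝ Y u v) (r i u) (cross (r i u) φ) := by
        intro i
        rw [mixed, mixedAt_eq hf, hZd, hθ, hφ, det3_cycle (fderiv ℝ Y u w),
          det3_cycle (fderiv ℝ Y u v)]
      simp_rw [e]
      rw [Finset.sum_sub_distrib, o.sum_det3_cross, o.sum_det3_cross]
      ring
    have hs2 : ∑ i, mixed Z (r i) (r i) u = 2 * (⟪Z u, ν u⟫ * det3 (ν u) θ φ) := by
      have e : ∀ i, mixed Z (r i) (r i) u
          = 2 * det3 (Z u) (cross (r i u) θ) (cross (r i u) φ) := by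
        intro i
        rw [mixed, mixedAt_eq hf, hθ, hφ, det3_swap_right _ (cross (r i u) φ)]
        ring
      simp_rw [e]
      rw [← Finset.mul_sum, o.sum_det3_cross_cross, det3_of_perp hνν tθ tφ]
    have hZν : 0 ≤ ⟪Z u, ν u⟫ := by
      have := hY.convex u u₀
      rw [← neg_sub, inner_neg_right, real_inner_comm] at this
      simp only [hZ]
      linarith
    rw [hs1, hs2]
    set m := ν u
    set a := fderiv ℝ Y u v
    set b := fderiv ℝ Y u w
    set A := fderiv ℝ X u v
    set B := fderiv ℝ X u w
    set p := fderiv ℝ ν u v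
    set q := fderiv ℝ ν u w
    set P := fderiv ℝ n u v
    set Q := fderiv ℝ n u w
    set d := det3 m a b
    set D := det3 (n u) A B
    -- the second fundamental form of `X`, transported to `Y`
    set β := p + cross θ m with hβ
    set γ := q + cross φ m with hγ
    have hmβ : ⟪m, β⟫ = 0 := by
      rw [hβ, inner_add_right, real_inner_comm, hpν, inner_cross, det3_swap_right]; simp
    have hmγ : ⟪m, γ⟫ = 0 := by
      rw [hγ, inner_add_right, real_inner_comm, hqν, inner_cross, det3_swap_right]; simp
    have k1 := det3_normal_mul a β b b hνν hmβ hbν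
    have k2 := det3_normal_mul a γ b a hνν hmγ haν
    have k3 := det3_normal_mul β a γ b hνν haν hbν
    have k4 := det3_normal_mul (cross θ m) a (cross φ m) b hνν haν hbν
    rw [det3_cross_cross, hνν, one_mul] at k4
    have e1 : ∀ z, ⟪cross θ m, z⟫ = ⟪β, z⟫ - ⟪p, z⟫ := by
      intro z; rw [hβ, inner_add_left]; ring
    have e2 : ∀ z, ⟪cross φ m, z⟫ = ⟪γ, z⟫ - ⟪q, z⟫ := by
      intro z; rw [hγ, inner_add_left]; ring
    -- both second fundamental forms have the same determinant
    have hdet : det3 m β γ = det3 m p q := by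
      rw [hβ, hγ, det3_add_mid, det3_add_right, det3_add_right, det3_cross_cross, hνν,
        det3_swap_right m (cross θ m) q, det3_cross_right, det3_cross_right, hνν, tθ, tφ, hG]
      ring
    rw [hdet] at k3
    rw [e1, e1, e2, e2, hPA, hPB, hQA, hQB] at k4
    rw [hPA, hPB, hQA, hQB] at k3
    have hεd : 0 < ε' * d := by rw [← hdY]; exact abs_pos.2 hdY0
    -- isometric surfaces have the same area density
    have hεD : ε * D = ε' * d := by
      rw [← hdX, ← hdY]
      refine (sq_eq_sq₀ (abs_nonneg _) (abs_nonneg _)).1 ?_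
      rw [sq_abs, sq_abs, sq, sq, hdX2, hdY2, hAA, hBB, hAB, real_inner_comm A B,
        real_inner_comm a b, hAB]
    have hneg : ε' * det3 m θ φ ≤ 0 := by
      have h1 : det3 m θ φ * d ≤ 0 := by
        rw [k4, ← hsX, ← hsY]
        refine det_sub_nonpos pX1 pX2 pY1 pY2 hbX ?_
        rw [← hsX] at k3
        rw [← hsY] at hJY
        linarith
      have h2 : (ε' * det3 m θ φ) * (ε' * d) ≤ 0 := by
        have := hε'.sq
        have e : (ε' * det3 m θ φ) * (ε' * d) = (ε' * ε') * (det3 m θ φ * d) := by ring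
        rw [e, this, one_mul]; exact h1
      by_contra hcon
      push Not at hcon
      have := mul_pos hcon hεd
      linarith
    constructor
    · have hM : ε * mixed n n X u = ε' * (det3 m β b - det3 m γ a) := by
        have h1 : mixed n n X u * D = (det3 m β b - det3 m γ a) * d := by
          rw [hMX]
          have e : (det3 m β b - det3 m γ a) * d = d * det3 m β b - d * det3 m γ a := by ring
          rw [e, k1, k2, real_inner_comm β a, real_inner_comm β b, real_inner_comm γ a,
            real_inner_comm γ b, hPA, hPB, hQA, hQB, hAA, hBB, real_inner_comm a b, hAB,
            real_inner_comm P A, real_inner_comm P B, real_inner_comm Q A, real_inner_comm Q B,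
            real_inner_comm A B]
        refine mul_right_cancel₀ hεd.ne' ?_
        have e1 := hε.sq
        have e2 := hε'.sq
        calc ε * mixed n n X u * (ε' * d) = ε * mixed n n X u * (ε * D) := by rw [hεD]
          _ = (ε * ε) * (mixed n n X u * D) := by ring
          _ = (ε' * ε') * ((det3 m β b - det3 m γ a) * d) := by rw [e1, e2, h1]
          _ = _ := by ring
      have f1 : det3 m β b = det3 m p b + ⟪b, θ⟫ := by
        rw [hβ, det3_add_mid, det3_swap_right m (cross θ m) b, det3_cross_right, hνν, tθ]; ring
      have f2 : det3 m γ a = det3 m q a + ⟪a, φ⟫ := by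
        rw [hγ, det3_add_mid, det3_swap_right m (cross φ m) a, det3_cross_right, hνν, tφ]; ring
      rw [hM, hmY, f1, f2]
      ring
    · have := mul_nonneg hZν (neg_nonneg.2 hneg)
      linarith
  -- Stokes' theorem
  have hS : ∫ u : S2, ∑ i, mixed (r i) (r i) Z u ∂sphereMeasure
      = ∫ u : S2, ∑ i, mixed Z (r i) (r i) u ∂sphereMeasure := by
    rw [integral_finsetSum _ fun i _ => integrable_mixed (hrs i) (hrs i) hZs,
      integral_finsetSum _ fun i _ => integrable_mixed hZs (hrs i) (hrs i)]
    refine Finset.sum_congr rfl fun i _ => ?_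
    simp_rw [mixed_comm (r i) (r i) Z]
    exact integral_mixed_swap (hrs i) hZs (hrs i)
  have h1 : ε' * ∫ u : S2, ∑ i, mixed Z (r i) (r i) u ∂sphereMeasure ≤ 0 := by
    rw [← integral_const_mul]
    exact integral_nonpos fun u => (hpoint u).2
  rw [← hS, ← integral_const_mul] at h1
  simp_rw [fun u => (hpoint u).1] at h1
  rw [integral_const_mul,
    integral_sub ((integrable_mixed hX.normal_smooth hX.normal_smooth hX.smooth).const_mul _)
    ((integrable_mixed hY.normal_smooth hY.normal_smooth hY.smooth).const_mul _),
    integral_const_mul, integral_const_mul] at h1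
  linarith

end IsConvexSurface

/-! ### The mean width of a planar set -/

/-- The measurable equivalence between space and the product of an axis and a complex plane. -/
def axisPlaneEquiv : E3 ≃ᵐ ℝ × ℂ :=
  ((MeasurableEquiv.toLp 2 (Fin 3 → ℝ)).symm.trans
    (MeasurableEquiv.piFinSuccAbove (fun _ => ℝ) 0)).trans
    ((MeasurableEquiv.refl ℝ).prodCongr Complex.measurableEquivPi.symm)

lemma axisPlaneEquiv_apply (x : E3) : axisPlaneEquiv x = (x 0, ⟨x 1, x 2⟩) := by
  refine Prod.ext rfl ?_
  change Complex.measurableEquivPi.symm (fun i : Fin 2 => x (Fin.succAbove 0 i)) = _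
  rw [Complex.measurableEquivPi_symm_apply]
  refine Complex.ext ?_ ?_ <;> simp

lemma measurePreserving_axisPlaneEquiv : MeasurePreserving axisPlaneEquiv := by
  have h1 := EuclideanSpace.volume_preserving_symm_measurableEquiv_toLp (Fin 3)
  have h2 := volume_preserving_piFinSuccAbove (fun _ : Fin 3 => ℝ) 0
  have h3 := (MeasurePreserving.id (volume : Measure ℝ)).prod
    Complex.volume_preserving_equiv_pi.symm
  exact h3.comp (h2.comp h1)

/-- The integral over the sphere of the distance from an axis.  The integral of the distance from
the axis against a Gaussian is computed in polar and in cylindrical coordinates. -/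
lemma integral_sphere_dist_axis :
    ∫ u : S2, √((u : E3) 1 ^ 2 + (u : E3) 2 ^ 2) ∂sphereMeasure = Real.pi ^ 2 := by
  have e := integral_norm_mul_radialProj (fun r => r * Real.exp (-r ^ (2 : ℝ)))
    (fun x => √(x 1 ^ 2 + x 2 ^ 2))
  have h1 : ∫ r in Set.Ioi (0 : ℝ), r ^ 2 * (r * Real.exp (-r ^ (2 : ℝ))) = 1 / 2 := by
    have := integral_rpow_mul_exp_neg_rpow (p := 2) (q := 3) (by norm_num) (by norm_num)
    norm_num at this
    rw [← this]
    refine setIntegral_congr_fun measurableSet_Ioi fun r _ => ?_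
    simp only [Real.rpow_two]
    ring
  have h2 : ∀ x : E3, ‖x‖ * Real.exp (-‖x‖ ^ (2 : ℝ)) *
      √(radialProj x 1 ^ 2 + radialProj x 2 ^ 2) =
      (fun p : ℝ × ℂ => Real.exp (-1 * p.1 ^ 2) * (‖p.2‖ ^ (1 : ℝ) * Real.exp (-‖p.2‖ ^ (2 : ℝ))))
        (axisPlaneEquiv x) := by
    intro x
    have hz : ‖(⟨x 1, x 2⟩ : ℂ)‖ = √(x 1 ^ 2 + x 2 ^ 2) := by
      rw [Complex.norm_def, Complex.normSq_mk, sq, sq]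
    have hr : ‖x‖ * √(radialProj x 1 ^ 2 + radialProj x 2 ^ 2) = √(x 1 ^ 2 + x 2 ^ 2) := by
      by_cases hx : x = 0
      · simp [hx]
      · have hn : ‖x‖ ≠ 0 := by simpa using hx
        have : x 1 ^ 2 + x 2 ^ 2 = ‖x‖ ^ 2 * (radialProj x 1 ^ 2 + radialProj x 2 ^ 2) := by
          simp only [radialProj, PiLp.smul_apply, smul_eq_mul]
          field_simp
        rw [this, Real.sqrt_mul (sq_nonneg _), Real.sqrt_sq (norm_nonneg _)]
    have hnorm : ‖x‖ ^ 2 = x 0 ^ 2 + (x 1 ^ 2 + x 2 ^ 2) := by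
      rw [← real_inner_self_eq_norm_sq, inner_eq]; ring
    simp only [axisPlaneEquiv_apply, hz, Real.rpow_one, Real.rpow_two]
    rw [Real.sq_sqrt (by positivity), hnorm, ← hr, neg_add, Real.exp_add]
    ring_nf
  simp_rw [h2] at e
  rw [measurePreserving_axisPlaneEquiv.integral_comp axisPlaneEquiv.measurableEmbedding
    (fun p : ℝ × ℂ => Real.exp (-1 * p.1 ^ 2) * (‖p.2‖ ^ (1 : ℝ) * Real.exp (-‖p.2‖ ^ (2 : ℝ)))),
    h1, Measure.volume_eq_prod, integral_prod_mul (fun t : ℝ => Real.exp (-1 * t ^ 2))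
      (fun z : ℂ => ‖z‖ ^ (1 : ℝ) * Real.exp (-‖z‖ ^ (2 : ℝ))), integral_gaussian,
    Complex.integral_rpow_mul_exp_neg_rpow (by norm_num) (by norm_num),
    show ((1 : ℝ) + 2) / 2 = 1 / 2 + 1 by norm_num, Real.Gamma_add_one (by norm_num),
    Real.Gamma_one_half_eq] at e
  have hs : √Real.pi * √Real.pi = Real.pi := Real.mul_self_sqrt Real.pi_pos.le
  simp only [div_one] at e
  linear_combination (-2) * e + Real.pi * hs

/-- The support function of `D - p`. -/
def supportFun (D : Set E3) (p : E3) (q : E3) : ℝ := sSup ((fun x => ⟪x - p, q⟫) '' D)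

lemma continuous_supportFun {D : Set E3} (hD : IsCompact D) (p : E3) :
    Continuous (supportFun D p) :=
  hD.continuous_sSup (f := fun q x => ⟪x - p, q⟫) (by
    have : Continuous fun q : E3 × E3 => ⟪q.2 - p, q.1⟫ := by fun_prop
    exact this)

lemma le_supportFun {D : Set E3} (hD : IsCompact D) (p : E3) {x : E3} (hx : x ∈ D) (q : E3) :
    ⟪x - p, q⟫ ≤ supportFun D p q := by
  have hc : Continuous fun x : E3 => ⟪x - p, q⟫ := by fun_prop
  exact le_csSup (hD.image hc).bddAbove ⟨x, hx, rfl⟩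

lemma supportFun_nonneg {D : Set E3} (hD : IsCompact D) {p : E3} (hp : p ∈ D) (q : E3) :
    0 ≤ supportFun D p q := by
  simpa using le_supportFun hD p hp q

/-- The integral over the sphere of the support function of a planar set is at most that of a disk
of the same diameter: in every direction `q` the width is at most the diameter times the length of
the projection of `q` to the plane. -/
lemma integral_supportFun_le {D : Set E3} (hD : IsCompact D) {p : E3} (hp : p ∈ D)
    (hplane : IsPlanar D) :
    ∫ u : S2, supportFun D p u ∂sphereMeasure ≤ Metric.diam D * Real.pi ^ 2 / 2 := by
  obtain ⟨a₀, ha₀, c, hc⟩ := hplane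
  set a := toS2 ha₀ with ha
  have hac : ∀ x ∈ D, ∀ y ∈ D, ⟪(a : E3), x - y⟫ = 0 := by
    intro x hx y hy
    rw [ha, coe_toS2, radialProj, real_inner_smul_left, inner_sub_right, hc x hx, hc y hy]
    ring
  have hf := isFrame_tangentFrame a
  set v := tangentFrame a 0
  set w := cross (a : E3) v
  have hcont := continuous_supportFun hD p
  -- the isometry that maps the frame to the standard basis
  let L : E3 →ₗ[ℝ] E3 :=
    { toFun := fun x => !₂[⟪(a : E3), x⟫, ⟪v, x⟫, ⟪w, x⟫]
      map_add' := fun x y => by refine ext3 ?_ ?_ ?_ <;> simp [inner_add_right]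
      map_smul' := fun c x => by refine ext3 ?_ ?_ ?_ <;> simp [inner_smul_right] }
  have hL : ∀ x, ‖L x‖ = ‖x‖ := by
    intro x
    have h1 : ⟪L x, L x⟫ = ⟪x, x⟫ := by
      have e : ⟪x, x⟫ = ⟪⟪(a : E3), x⟫ • (a : E3) + ⟪v, x⟫ • v + ⟪w, x⟫ • w, x⟫ := by
        rw [← hf.expand x]
      rw [e, inner_eq]
      simp only [inner_add_left, real_inner_smul_left]
      rfl
    rw [real_inner_self_eq_norm_sq, real_inner_self_eq_norm_sq] at h1
    exact (sq_eq_sq₀ (norm_nonneg _) (norm_nonneg _)).1 h1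
  let T : E3 ≃ₗᵢ[ℝ] E3 := (⟨L, hL⟩ : E3 →ₗᵢ[ℝ] E3).toLinearIsometryEquiv rfl
  have hT := integral_sphere_comp_isometry T (fun x => √(x 1 ^ 2 + x 2 ^ 2))
  rw [integral_sphere_dist_axis] at hT
  have hT' : ∀ x : E3, √((T x) 1 ^ 2 + (T x) 2 ^ 2) = √(⟪v, x⟫ ^ 2 + ⟪w, x⟫ ^ 2) := fun x => rfl
  simp_rw [hT'] at hT
  have hwidth : ∀ u : E3, supportFun D p u + supportFun D p (-u)
      ≤ Metric.diam D * √(⟪v, u⟫ ^ 2 + ⟪w, u⟫ ^ 2) := by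
    intro u
    have hpair : ∀ x ∈ D, ∀ y ∈ D, ⟪x - p, u⟫ + ⟪y - p, -u⟫
        ≤ Metric.diam D * √(⟪v, u⟫ ^ 2 + ⟪w, u⟫ ^ 2) := by
      intro x hx y hy
      have e1 : ⟪x - p, u⟫ + ⟪y - p, -u⟫ = ⟪x - y, u⟫ := by
        simp only [inner_sub_left, inner_neg_right]; ring
      have e2 : ⟪x - y, u⟫ = ⟪x - y, ⟪v, u⟫ • v + ⟪w, u⟫ • w⟫ := by
        conv_lhs => rw [hf.expand u]
        simp only [inner_add_right, real_inner_smul_right]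
        rw [real_inner_comm (a : E3) (x - y), hac x hx y hy]
        ring
      have e3 : ‖⟪v, u⟫ • v + ⟪w, u⟫ • w‖ = √(⟪v, u⟫ ^ 2 + ⟪w, u⟫ ^ 2) := by
        rw [norm_eq_sqrt_real_inner]
        congr 1
        simp only [inner_add_left, inner_add_right, real_inner_smul_left, real_inner_smul_right,
          hf.vv, hf.ww, hf.vw, real_inner_comm v w]
        ring
      rw [e1, e2, ← e3]
      refine (real_inner_le_norm _ _).trans (mul_le_mul_of_nonneg_right ?_ (norm_nonneg _))
      rw [← dist_eq_norm]
      exact Metric.dist_le_diam_of_mem hD.isBounded hx hy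
    have hne : ∀ q : E3, ((fun x => ⟪x - p, q⟫) '' D).Nonempty := fun q => ⟨_, p, hp, rfl⟩
    have h1 : ∀ y ∈ D, supportFun D p u ≤
        Metric.diam D * √(⟪v, u⟫ ^ 2 + ⟪w, u⟫ ^ 2) - ⟪y - p, -u⟫ := by
      intro y hy
      refine csSup_le (hne u) ?_
      rintro _ ⟨x, hx, rfl⟩
      linarith [hpair x hx y hy]
    have h2 : supportFun D p (-u) ≤
        Metric.diam D * √(⟪v, u⟫ ^ 2 + ⟪w, u⟫ ^ 2) - supportFun D p u := by
      refine csSup_le (hne (-u)) ?_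
      rintro _ ⟨y, hy, rfl⟩
      linarith [h1 y hy]
    linarith
  have hneg := integral_sphere_comp_isometry (LinearIsometryEquiv.neg ℝ) (supportFun D p)
  simp only [LinearIsometryEquiv.coe_neg] at hneg
  have hi1 : Integrable (fun u : S2 => supportFun D p u) sphereMeasure :=
    integrable_sphere (hcont.comp continuous_subtype_val)
  have hi2 : Integrable (fun u : S2 => supportFun D p (-(u : E3))) sphereMeasure :=
    integrable_sphere (hcont.comp continuous_subtype_val.neg)
  have hi3 : Integrable (fun u : S2 => Metric.diam D * √(⟪v, (u : E3)⟫ ^ 2 + ⟪w, (u : E3)⟫ ^ 2))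
      sphereMeasure := integrable_sphere (by fun_prop)
  have h3 := integral_mono (hi1.add hi2) hi3 fun u => hwidth u
  simp only [Pi.add_apply] at h3
  rw [integral_add hi1 hi2, integral_const_mul, hT, hneg] at h3
  linarith

/-- A closed convex surface within distance `δ` of a planar set has total mean curvature at most
that of a disk of the same diameter, up to an error of order `δ`. -/
lemma IsConvexSurface.integral_mixed_le_of_planar {X n : E3 → E3} {ε : ℝ}
    (h : IsConvexSurface X n) (hε : IsOrientation X n ε) {D : Set E3} (hD : IsCompact D)
    (hne : D.Nonempty) (hplane : IsPlanar D) {δ : ℝ} (hδ : 0 ≤ δ)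
    (hclose : ∀ u : S2, ∃ x ∈ D, dist (X u) x ≤ δ) :
    ε * ∫ u : S2, mixed n n X u ∂sphereMeasure
      ≤ Metric.diam D * Real.pi ^ 2 + 2 * sphereMeasure.real Set.univ * δ := by
  obtain ⟨p, hp⟩ := hne
  have hcont := continuous_supportFun hD p
  refine (h.integral_mixed_le hε p (φ := fun q => supportFun D p q + δ)
    (hcont.add continuous_const) (fun u => add_nonneg (supportFun_nonneg hD hp _) hδ)
    fun u => ?_).trans ?_
  · obtain ⟨x, hx, hd⟩ := hclose u
    have e : ⟪X u - p, n u⟫ = ⟪x - p, n u⟫ + ⟪X u - x, n u⟫ := by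
      rw [← inner_add_left]; congr 1; abel
    have h1 := real_inner_le_norm (X u - x) (n u)
    rw [h.normal_unit, mul_one, ← dist_eq_norm] at h1
    rw [e]
    exact add_le_add (le_supportFun hD p hx _) (h1.trans hd)
  · have hint : Integrable (fun u : S2 => supportFun D p u) sphereMeasure :=
      integrable_sphere (hcont.comp continuous_subtype_val)
    rw [integral_add hint (integrable_const _), integral_const, smul_eq_mul]
    linarith [integral_supportFun_le hD hp hplane]

/-! ### Families of surfaces -/

section Families

variable {A B C : ℝ × E3 → E3} {s : ℝ}

lemma fderiv_slice_right {V : Type*} [NormedAddCommGroup V] [NormedSpace ℝ V] {B : ℝ × E3 → V}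
    {t : ℝ} {x : E3} (hB : DifferentiableAt ℝ B (t, x)) (v : E3) :
    fderiv ℝ (fun y => B (t, y)) x v = fderiv ℝ B (t, x) (0, v) := by
  have h := hB.hasFDerivAt.comp x (hasFDerivAt_prodMk_right t x)
  have e := h.fderiv
  simp only [Function.comp_def] at e
  rw [e]
  rfl

lemma fderiv_slice_left {V : Type*} [NormedAddCommGroup V] [NormedSpace ℝ V] {B : ℝ × E3 → V}
    {t : ℝ} {x : E3} (hB : DifferentiableAt ℝ B (t, x)) (r : ℝ) :
    fderiv ℝ (fun t' => B (t', x)) t r = fderiv ℝ B (t, x) (r, 0) := by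
  have h := HasFDerivAt.comp (g := B) (f := fun t' : ℝ => (t', x)) t hB.hasFDerivAt
    (hasFDerivAt_prodMk_left t x)
  have e := h.fderiv
  simp only [Function.comp_def] at e
  rw [e]
  rfl

lemma contDiffAt_slice {V : Type*} [NormedAddCommGroup V] [NormedSpace ℝ V] {B : ℝ × E3 → V}
    {t : ℝ} {x : E3} (hB : ContDiffAt ℝ ∞ B (t, x)) : ContDiffAt ℝ ∞ (fun y => B (t, y)) x :=
  ContDiffAt.comp (g := B) (f := fun y : E3 => (t, y)) x hB (by fun_prop)

/-- The derivative of a family of maps with respect to the parameter. -/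
def paramDeriv (A : ℝ × E3 → E3) (p : ℝ × E3) : E3 := fderiv ℝ A p (1, 0)

lemma contDiffAt_paramDeriv {p : ℝ × E3} (hA : ContDiffAt ℝ ∞ A p) :
    ContDiffAt ℝ ∞ (paramDeriv A) p :=
  (hA.fderiv_right (m := ∞) (by simp)).clm_apply contDiffAt_const

lemma mixed_slice {t : ℝ} {x : E3} (hB : DifferentiableAt ℝ B (t, x))
    (hC : DifferentiableAt ℝ C (t, x)) :
    mixed (fun y => A (t, y)) (fun y => B (t, y)) (fun y => C (t, y)) x =
      ∑ j, det3 (A (t, x)) (fderiv ℝ B (t, x) (0, cross (stdVec j) x))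
        (fderiv ℝ C (t, x) (0, stdVec j)) := by
  simp only [mixed, mixedAt, fderiv_slice_right hB, fderiv_slice_right hC]

lemma eventually_differentiableAt {V : Type*} [NormedAddCommGroup V] [NormedSpace ℝ V]
    {B : ℝ × E3 → V} {p : ℝ × E3} (hB : ContDiffAt ℝ ∞ B p) :
    ∀ᶠ q in nhds p, DifferentiableAt ℝ B q :=
  ((hB.of_le (m := 1) ENat.LEInfty.out).eventually (by simp)).mono
    fun q hq => hq.differentiableAt (by simp)

lemma contDiffAt_mixed_slice {p : ℝ × E3} (hA : ContDiffAt ℝ ∞ A p) (hB : ContDiffAt ℝ ∞ B p)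
    (hC : ContDiffAt ℝ ∞ C p) :
    ContDiffAt ℝ ∞ (fun q : ℝ × E3 =>
      mixed (fun y => A (q.1, y)) (fun y => B (q.1, y)) (fun y => C (q.1, y)) q.2) p := by
  have h : ContDiffAt ℝ ∞ (fun q : ℝ × E3 => ∑ j, det3 (A q)
      (fderiv ℝ B q (0, cross (stdVec j) q.2)) (fderiv ℝ C q (0, stdVec j))) p := by
    refine ContDiffAt.sum fun j _ => contDiffAt_det3 hA ?_ ?_
    · refine (hB.fderiv_right (m := ∞) (by simp)).clm_apply (contDiffAt_const.prodMk ?_)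
      refine ContDiff.contDiffAt ?_
      rw [contDiff_euclidean]
      intro i
      fin_cases i <;> simp <;> fun_prop
    · exact (hC.fderiv_right (m := ∞) (by simp)).clm_apply contDiffAt_const
  refine h.congr_of_eventuallyEq ?_
  filter_upwards [eventually_differentiableAt hB, eventually_differentiableAt hC] with q h1 h2
  exact mixed_slice h1 h2

/-- Mixed partial derivatives commute. -/
lemma fderiv_paramDeriv {x : E3} (hB : ContDiffAt ℝ ∞ B (s, x)) (v : E3) :
    fderiv ℝ (fun t => fderiv ℝ B (t, x) (0, v)) s 1
      = fderiv ℝ (fun y => paramDeriv B (s, y)) x v := by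
  have hd : DifferentiableAt ℝ (fderiv ℝ B) (s, x) :=
    (hB.fderiv_right (m := ∞) (by simp)).differentiableAt (by simp)
  have hd' : ∀ w, DifferentiableAt ℝ (fun y => fderiv ℝ B y w) (s, x) := fun w =>
    hd.clm_apply (differentiableAt_const _)
  rw [fderiv_slice_left (hd' _), fderiv_slice_right (B := paramDeriv B) (hd' _),
    fderiv_fderiv_const hB, fderiv_fderiv_symm hB, ← fderiv_fderiv_const hB]
  rfl

/-- Differentiation of the integral of `det (A, dB ∧ dC)` with respect to a parameter. -/
lemma hasDerivAt_integral_mixed (hA : ∀ u : S2, ContDiffAt ℝ ∞ A (s, (u : E3)))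
    (hB : ∀ u : S2, ContDiffAt ℝ ∞ B (s, (u : E3)))
    (hC : ∀ u : S2, ContDiffAt ℝ ∞ C (s, (u : E3))) :
    HasDerivAt (fun t => ∫ u : S2,
        mixed (fun y => A (t, y)) (fun y => B (t, y)) (fun y => C (t, y)) u ∂sphereMeasure)
      (∫ u : S2, (mixed (fun y => paramDeriv A (s, y)) (fun y => B (s, y)) (fun y => C (s, y)) u
        + mixed (fun y => A (s, y)) (fun y => paramDeriv B (s, y)) (fun y => C (s, y)) u
        + mixed (fun y => A (s, y)) (fun y => B (s, y)) (fun y => paramDeriv C (s, y)) u)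
          ∂sphereMeasure) s := by
  have hm := fun u : S2 => contDiffAt_mixed_slice (hA u) (hB u) (hC u)
  have h := hasDerivAt_integral_sphere fun u : S2 => (hm u).of_le (m := 1) ENat.LEInfty.out
  refine h.congr_deriv (integral_congr_ae (Filter.Eventually.of_forall fun u => ?_))
  have hd : ∀ {D : ℝ × E3 → E3}, ContDiffAt ℝ ∞ D (s, (u : E3)) →
      DifferentiableAt ℝ (fun t => D (t, (u : E3))) s := fun hD =>
    DifferentiableAt.comp (g := _) (f := fun t : ℝ => (t, (u : E3))) s
      (hD.differentiableAt (by simp)) (by fun_prop)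
  have hd' : ∀ {D : ℝ × E3 → E3}, ContDiffAt ℝ ∞ D (s, (u : E3)) → ∀ v : E3,
      DifferentiableAt ℝ (fun t => fderiv ℝ D (t, (u : E3)) (0, v)) s := fun hD v =>
    hd (D := fun p => fderiv ℝ _ p (0, v))
      ((hD.fderiv_right (m := ∞) (by simp)).clm_apply contDiffAt_const)
  have hev : (fun t : ℝ => mixed (fun y => A (t, y)) (fun y => B (t, y)) (fun y => C (t, y)) u)
      =ᶠ[nhds s] fun t => ∑ j, det3 (A (t, (u : E3)))
        (fderiv ℝ B (t, (u : E3)) (0, cross (stdVec j) u))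
        (fderiv ℝ C (t, (u : E3)) (0, stdVec j)) := by
    have ht : Filter.Tendsto (fun t : ℝ => (t, (u : E3))) (nhds s) (nhds (s, (u : E3))) :=
      (by fun_prop : Continuous fun t : ℝ => (t, (u : E3))).continuousAt
    filter_upwards [ht.eventually (eventually_differentiableAt (hB u)),
      ht.eventually (eventually_differentiableAt (hC u))] with t h1 h2
    exact mixed_slice h1 h2
  have hsm := fun (D : ℝ × E3 → E3) (hD : ContDiffAt ℝ ∞ D (s, (u : E3))) =>
    fderiv_slice_right (B := D) (hD.differentiableAt (by simp))
  beta_reduce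
  rw [← fderiv_slice_left ((hm u).differentiableAt (by simp))]
  simp only
  rw [hev.fderiv_eq (𝕜 := ℝ), fderiv_fun_sum fun j _ => ?_]
  · simp only [_root_.sum_apply, mixed, mixedAt]
    rw [← Finset.sum_add_distrib, ← Finset.sum_add_distrib]
    refine Finset.sum_congr rfl fun j _ => ?_
    rw [fderiv_det3 (hd (hA u)) (hd' (hB u) _) (hd' (hC u) _), fderiv_paramDeriv (hB u),
      fderiv_paramDeriv (hC u), fderiv_slice_left ((hA u).differentiableAt (by simp)),
      hsm B (hB u), hsm C (hC u)]
    rfl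
  · have := contDiff_det3 (n := 1)
    exact (this.differentiable (by simp)).differentiableAt.comp s
      ((hd (hA u)).prodMk ((hd' (hB u) _).prodMk (hd' (hC u) _)))

end Families

/-! ### The leaves of the foliation -/

namespace IsConvexEquipotentialFoliation

variable {f : E3 → ℝ} {Ω : Set E3} {σ₀ : ℝ} {F : ℝ → ℝ} {Φ : ℝ → E3 → E3} {s : ℝ} {ε : ℝ}

lemma coordVector_eventuallyEq (h : IsConvexEquipotentialFoliation f Ω σ₀ F Φ)
    (hs : s ∈ Set.Ioc 0 σ₀) (u : S2) :
    (fun p : ℝ × E3 => coordVector Φ p.1 p.2) =ᶠ[nhds (s, (u : E3))]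
      paramDeriv fun p => Φ p.1 p.2 := by
  filter_upwards [eventually_differentiableAt (h.smooth s hs u)] with p hp
  have := fderiv_slice_left (B := fun p : ℝ × E3 => Φ p.1 p.2) (t := p.1) (x := p.2) hp 1
  rw [paramDeriv, coordVector, ← fderiv_apply_one_eq_deriv, this]

lemma contDiffAt_coordVector (h : IsConvexEquipotentialFoliation f Ω σ₀ F Φ)
    (hs : s ∈ Set.Ioc 0 σ₀) (u : S2) :
    ContDiffAt ℝ ∞ (fun p : ℝ × E3 => coordVector Φ p.1 p.2) (s, (u : E3)) :=
  (contDiffAt_paramDeriv (h.smooth s hs u)).congr_of_eventuallyEq (h.coordVector_eventuallyEq hs u)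

lemma contDiffAt_unitNormal (h : IsConvexEquipotentialFoliation f Ω σ₀ F Φ)
    (hs : s ∈ Set.Ioc 0 σ₀) (u : S2) :
    ContDiffAt ℝ ∞ (fun p : ℝ × E3 => unitNormal flatMetric Φ p.1 p.2) (s, (u : E3)) := by
  have hV := h.contDiffAt_coordVector hs u
  have hpos := real_inner_self_pos.2 (h.coordVector_ne s hs u)
  exact (((hV.inner ℝ hV).sqrt hpos.ne').inv (Real.sqrt_pos.2 hpos).ne').smul hV

lemma unitNormal_inner_self {x : E3} (hne : coordVector Φ s x ≠ 0) :
    ⟪unitNormal flatMetric Φ s x, unitNormal flatMetric Φ s x⟫ = 1 := by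
  have hpos := real_inner_self_pos.2 hne
  simp only [unitNormal, flatMetric, real_inner_smul_left, real_inner_smul_right]
  rw [← mul_assoc, ← mul_inv, Real.mul_self_sqrt hpos.le, inv_mul_cancel₀ hpos.ne']

lemma isConvexSurface (h : IsConvexEquipotentialFoliation f Ω σ₀ F Φ) (hs : s ∈ Set.Ioc 0 σ₀) :
    IsConvexSurface (Φ s) (unitNormal flatMetric Φ s) where
  smooth u := contDiffAt_slice (B := fun p : ℝ × E3 => Φ p.1 p.2) (h.smooth s hs u)
  normal_smooth u := contDiffAt_slice (B := fun p : ℝ × E3 => unitNormal flatMetric Φ p.1 p.2)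
    (h.contDiffAt_unitNormal hs u)
  normal_unit u := by
    have := unitNormal_inner_self (h.coordVector_ne s hs u)
    rw [real_inner_self_eq_norm_sq] at this
    exact (pow_eq_one_iff_of_nonneg (norm_nonneg _) two_ne_zero).1 this
  normal_orthogonal u v hv := by
    rw [unitNormal, real_inner_smul_left, h.orthogonal s hs u v hv, mul_zero]
  immersion := h.immersion s hs
  inj := h.inj s hs
  convex := h.convex s hs

/-- All leaves have the same orientation, as the foliation is connected. -/
lemma exists_isOrientation (h : IsConvexEquipotentialFoliation f Ω σ₀ F Φ) :
    ∃ ε, ∀ s ∈ Set.Ioc 0 σ₀, IsOrientation (Φ s) (unitNormal flatMetric Φ s) ε := by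
  have hσ : σ₀ ∈ Set.Ioc 0 σ₀ := ⟨h.pos, le_rfl⟩
  obtain ⟨ε, hε⟩ := (h.isConvexSurface hσ).exists_isOrientation
  let u₀ : S2 := ⟨stdVec 0, by simp [stdVec]⟩
  have hε0 : ε ≠ 0 := fun h0 => by simpa [h0] using hε.2 u₀
  set q : ℝ → ℝ := fun t => ε * mixed (unitNormal flatMetric Φ t) (Φ t) (Φ t) u₀ with hq
  have hcont : ContinuousOn q (Set.Ioc 0 σ₀) := by
    intro t ht
    have := (contDiffAt_mixed_slice (h.contDiffAt_unitNormal ht u₀) (h.smooth t ht u₀)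
      (h.smooth t ht u₀)).continuousAt
    exact (continuousAt_const.mul (ContinuousAt.comp (f := fun t : ℝ => (t, (u₀ : E3))) (x := t)
      this (by fun_prop))).continuousWithinAt
  refine ⟨ε, fun s hs => ?_⟩
  have hpos : 0 < q s := by
    by_contra hneg
    push Not at hneg
    obtain ⟨t, ht, ht0⟩ := isPreconnected_Ioc.intermediate_value hs hσ hcont
      (show (0 : ℝ) ∈ _ from ⟨hneg, (hε.2 u₀).le⟩)
    exact (mul_ne_zero hε0 ((h.isConvexSurface ht).orientation_ne_zero u₀)) ht0
  obtain ⟨ε', hε'⟩ := (h.isConvexSurface hs).exists_isOrientation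
  rwa [hε'.eq_of_pos hε.1 hpos]

/-- The derivative of the unit normal in the direction of the parameter is tangent to the leaf. -/
lemma inner_paramDeriv_unitNormal (h : IsConvexEquipotentialFoliation f Ω σ₀ F Φ)
    (hs : s ∈ Set.Ioc 0 σ₀) (u : S2) :
    ⟪paramDeriv (fun p => unitNormal flatMetric Φ p.1 p.2) (s, (u : E3)),
      unitNormal flatMetric Φ s u⟫ = 0 := by
  have hd := (h.contDiffAt_unitNormal hs u).differentiableAt (by simp)
  have h1 : (fun p : ℝ × E3 => ⟪unitNormal flatMetric Φ p.1 p.2, unitNormal flatMetric Φ p.1 p.2⟫)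
      =ᶠ[nhds (s, (u : E3))] fun _ => (1 : ℝ) := by
    filter_upwards [(h.contDiffAt_coordVector hs u).continuousAt.eventually_ne
      (h.coordVector_ne s hs u)] with p hp using unitNormal_inner_self hp
  have h2 := fderiv_inner_apply ℝ hd hd (1, 0)
  rw [h1.fderiv_eq (𝕜 := ℝ), real_inner_comm] at h2
  simp only [fderiv_fun_const, Pi.zero_apply, zero_apply] at h2
  unfold paramDeriv
  linarith

lemma hoopDensity_eq (h : IsConvexEquipotentialFoliation f Ω σ₀ F Φ) (hs : s ∈ Set.Ioc 0 σ₀)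
    (hε : IsOrientation (Φ s) (unitNormal flatMetric Φ s) ε) :
    8 * Real.pi * hoopDensity Φ s =
      2 * ∫ u : S2, |gaussJacobian (unitNormal flatMetric Φ s) u|
        * normalLower flatMetric Φ s u ∂sphereMeasure := by
  have hX := h.isConvexSurface hs
  rw [hoopDensity, ← mul_assoc, mul_one_div_cancel (by positivity), one_mul, surfaceIntegral]
  congr 2
  ext u
  rw [hX.abs_gaussJacobian hε u, ← hX.gaussCurvature_mul_areaDensity hε u, leafGaussCurvature]
  ring

lemma normalLower_nonneg (u : S2) : 0 ≤ normalLower flatMetric Φ s u := by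
  rw [normalLower, flatMetric, unitNormal, real_inner_smul_left]
  exact mul_nonneg (inv_nonneg.2 (Real.sqrt_nonneg _)) real_inner_self_nonneg

lemma hoopDensity_nonneg (h : IsConvexEquipotentialFoliation f Ω σ₀ F Φ)
    (hs : s ∈ Set.Ioc 0 σ₀) : 0 ≤ hoopDensity Φ s := by
  obtain ⟨ε, hε⟩ := h.exists_isOrientation
  have h1 := h.hoopDensity_eq hs (hε s hs)
  have h2 : 0 ≤ ∫ u : S2, |gaussJacobian (unitNormal flatMetric Φ s) u|
        * normalLower flatMetric Φ s u ∂sphereMeasure :=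
    integral_nonneg fun u => mul_nonneg (abs_nonneg _) (normalLower_nonneg u)
  have hpi := Real.pi_pos
  by_contra hneg
  push Not at hneg
  nlinarith [mul_neg_of_pos_of_neg hpi hneg]

/-- The first variation of the total mean curvature along the foliation is twice the integral of
the Gauss curvature times the normal speed: by Stokes' theorem the derivative may be moved to any
of the three entries of the integrand, and the derivative of the normal, being tangent to the
leaf, contributes nothing. -/
lemma hasDerivAt_totalMeanCurvature (h : IsConvexEquipotentialFoliation f Ω σ₀ F Φ)
    (hs : s ∈ Set.Ioc 0 σ₀) (hε : IsOrientation (Φ s) (unitNormal flatMetric Φ s) ε) :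
    HasDerivAt (fun t => ε * ∫ u : S2,
        mixed (unitNormal flatMetric Φ t) (unitNormal flatMetric Φ t) (Φ t) u ∂sphereMeasure)
      (8 * Real.pi * hoopDensity Φ s) s := by
  have hX := h.isConvexSurface hs
  set N : ℝ × E3 → E3 := fun p => unitNormal flatMetric Φ p.1 p.2 with hN
  set G : ℝ × E3 → E3 := fun p => Φ p.1 p.2 with hG
  have sN : ∀ u : S2, ContDiffAt ℝ ∞ N (s, (u : E3)) := fun u => h.contDiffAt_unitNormal hs u
  have sG : ∀ u : S2, ContDiffAt ℝ ∞ G (s, (u : E3)) := fun u => h.smooth s hs u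
  have cN : ∀ u : S2, ContDiffAt ℝ ∞ (fun y => N (s, y)) u := fun u => contDiffAt_slice (sN u)
  have cG : ∀ u : S2, ContDiffAt ℝ ∞ (fun y => G (s, y)) u := fun u => contDiffAt_slice (sG u)
  have cN' : ∀ u : S2, ContDiffAt ℝ ∞ (fun y => paramDeriv N (s, y)) u :=
    fun u => contDiffAt_slice (contDiffAt_paramDeriv (sN u))
  have cG' : ∀ u : S2, ContDiffAt ℝ ∞ (fun y => paramDeriv G (s, y)) u :=
    fun u => contDiffAt_slice (contDiffAt_paramDeriv (sG u))
  refine ((hasDerivAt_integral_mixed sN sN sG).const_mul ε).congr_deriv ?_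
  have i1 := IsConvexSurface.integrable_mixed cN' cN cG
  have i2 := IsConvexSurface.integrable_mixed cN cN' cG
  have i3 := IsConvexSurface.integrable_mixed cN cN cG'
  have z : ∀ u : S2, mixed (fun y => paramDeriv N (s, y)) (fun y => N (s, y))
      (fun y => G (s, y)) u = 0 := by
    intro u
    have hf := isFrame_tangentFrame u
    have ho : ∀ v, ⟪(u : E3), v⟫ = 0 → ⟪fderiv ℝ (Φ s) u v, unitNormal flatMetric Φ s u⟫ = 0 :=
      fun v hv => by rw [real_inner_comm]; exact hX.normal_orthogonal u v hv
    have key : ∀ v w, ⟪(u : E3), v⟫ = 0 → ⟪(u : E3), w⟫ = 0 →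
        det3 (paramDeriv N (s, (u : E3))) (fderiv ℝ (unitNormal flatMetric Φ s) u v)
          (fderiv ℝ (Φ s) u w) = 0 := fun v w hv hw =>
      det3_eq_zero_of_perp (hX.normal_inner_self u) (h.inner_paramDeriv_unitNormal hs u)
        (hX.inner_fderiv_normal u hv) (ho w hw)
    rw [mixed, mixedAt_eq hf]
    exact (congrArg₂ (· - ·) (key _ _ hf.uv hf.uw) (key _ _ hf.uw hf.uv)).trans (sub_zero 0)
  have e3 : ∫ u : S2, mixed (fun y => N (s, y)) (fun y => N (s, y))
      (fun y => paramDeriv G (s, y)) u ∂sphereMeasure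
      = ∫ u : S2, mixed (fun y => paramDeriv G (s, y)) (fun y => N (s, y))
      (fun y => N (s, y)) u ∂sphereMeasure := by
    simp_rw [mixed_comm _ _ (fun y => paramDeriv G (s, y))]
    exact integral_mixed_swap cN cG' cN
  have e0 := integral_add (i1.add i2) i3
  simp only [Pi.add_apply] at e0
  rw [e0, integral_add i1 i2, integral_mixed_swap cN cN' cG, e3]
  simp_rw [z]
  rw [integral_zero, zero_add, zero_add, h.hoopDensity_eq hs hε, ← integral_const_mul,
    ← integral_const_mul]
  refine integral_congr_ae (Filter.Eventually.of_forall fun u => ?_)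
  have e := hX.mixed_normal_normal (fun y => paramDeriv G (s, y)) u
  have e' : paramDeriv G (s, (u : E3)) = coordVector Φ s u :=
    (h.coordVector_eventuallyEq hs u).self_of_nhds.symm
  beta_reduce
  rw [hX.abs_gaussJacobian hε u]
  refine (congrArg (ε * ·) e).trans ?_
  simp only [e', normalLower, flatMetric]
  rw [real_inner_comm]
  ring

end IsConvexEquipotentialFoliation

/-! ### Convergence of the leaves to the degenerate leaf -/

namespace IsConvexEquipotentialFoliation

variable {f : E3 → ℝ} {Ω : Set E3} {σ₀ : ℝ} {F : ℝ → ℝ} {Φ : ℝ → E3 → E3} {s : ℝ} {ε : ℝ}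

lemma leaf_mem (h : IsConvexEquipotentialFoliation f Ω σ₀ F Φ) (hs : s ∈ Set.Ioc 0 σ₀) (u : S2) :
    Φ s u ∈ Ω \ maxSet f Ω := by
  rw [← h.cover]; exact ⟨s, hs, u, rfl⟩

lemma exists_leaf (h : IsConvexEquipotentialFoliation f Ω σ₀ F Φ) {x : E3} (hx : x ∈ Ω)
    (hx' : x ∉ maxSet f Ω) : ∃ s ∈ Set.Ioc 0 σ₀, ∃ u : S2, Φ s u = x := by
  have : x ∈ Ω \ maxSet f Ω := ⟨hx, hx'⟩
  rwa [← h.cover] at this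

lemma maxSet_nonempty (h : IsConvexEquipotentialFoliation f Ω σ₀ F Φ) : (maxSet f Ω).Nonempty := by
  let u₀ : S2 := ⟨stdVec 0, by simp [stdVec]⟩
  obtain ⟨x, hx, hmax⟩ := h.isCompact.exists_isMaxOn
    ⟨_, (h.leaf_mem ⟨h.pos, le_rfl⟩ u₀).1⟩ h.factor_continuous
  exact ⟨x, hx, fun y hy => hmax hy⟩

lemma isCompact_maxSet (h : IsConvexEquipotentialFoliation f Ω σ₀ F Φ) :
    IsCompact (maxSet f Ω) := by
  obtain ⟨x, hx, hmax⟩ := h.maxSet_nonempty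
  have e : maxSet f Ω = Ω ∩ f ⁻¹' Set.Ici (f x) := by
    ext y
    exact ⟨fun hy => ⟨hy.1, hy.2 x hx⟩, fun hy => ⟨hy.1, fun z hz => (hmax z hz).trans hy.2⟩⟩
  rw [e]
  exact h.isCompact.of_isClosed_subset (h.factor_continuous.preimage_isClosed_of_isClosed
    h.isCompact.isClosed isClosed_Ici) Set.inter_subset_left

lemma continuousOn_factor (h : IsConvexEquipotentialFoliation f Ω σ₀ F Φ) :
    ContinuousOn F (Set.Ioc 0 σ₀) := by
  let u₀ : S2 := ⟨stdVec 0, by simp [stdVec]⟩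
  have hc : ContinuousOn (fun t => f (Φ t u₀)) (Set.Ioc 0 σ₀) := by
    intro t ht
    have h1 := (h.factor_smooth _ (h.leaf_mem ht u₀)).continuousAt
    have h2 : ContinuousAt (fun t => Φ t u₀) t :=
      ContinuousAt.comp (g := fun p : ℝ × E3 => Φ p.1 p.2) (f := fun t : ℝ => (t, (u₀ : E3)))
        (h.smooth t ht u₀).continuousAt (by fun_prop)
    exact (ContinuousAt.comp (f := fun t => Φ t u₀) h1 h2).continuousWithinAt
  exact hc.congr fun t ht => (h.factor_eq t ht u₀).symm

/-- The conformal factor has no largest value among the leaves.  Otherwise the union of the leaves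
would be compact, so that the factor would also have a smallest value among the leaves; but it is
injective and continuous, hence monotone, in the parameter, which has no smallest value. -/
lemma exists_factor_lt (h : IsConvexEquipotentialFoliation f Ω σ₀ F Φ) {t : ℝ}
    (ht : t ∈ Set.Ioc 0 σ₀) : ∃ s ∈ Set.Ioc 0 σ₀, F t < F s := by
  by_contra hmax
  push Not at hmax
  let u₀ : S2 := ⟨stdVec 0, by simp [stdVec]⟩
  have hlt : ∀ x ∈ maxSet f Ω, F t < f x := by
    intro x hx
    have hm := h.leaf_mem ht u₀
    rw [← h.factor_eq t ht u₀]
    refine lt_of_le_of_ne (hx.2 _ hm.1) fun he => hm.2 ⟨hm.1, fun y hy => ?_⟩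
    rw [he]
    exact hx.2 y hy
  have e : Ω \ maxSet f Ω = Ω ∩ f ⁻¹' Set.Iic (F t) := by
    ext x
    refine ⟨fun hx => ⟨hx.1, ?_⟩, fun hx => ⟨hx.1, fun hx' => ?_⟩⟩
    · obtain ⟨s, hs, u, rfl⟩ := h.exists_leaf hx.1 hx.2
      change f (Φ s u) ≤ F t
      rw [h.factor_eq s hs u]
      exact hmax s hs
    · exact absurd hx.2 (not_le.2 (hlt x hx'))
  have hcomp : IsCompact (Ω \ maxSet f Ω) := by
    rw [e]
    exact h.isCompact.of_isClosed_subset (h.factor_continuous.preimage_isClosed_of_isClosed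
      h.isCompact.isClosed isClosed_Iic) Set.inter_subset_left
  obtain ⟨x, hx, hmin⟩ := hcomp.exists_isMinOn ⟨_, h.leaf_mem ht u₀⟩
    (h.factor_continuous.mono Set.sdiff_subset)
  obtain ⟨t', ht', u, rfl⟩ := h.exists_leaf hx.1 hx.2
  have hmin' : ∀ s ∈ Set.Ioc 0 σ₀, F t' ≤ F s := by
    intro s hs
    have := hmin (h.leaf_mem hs u₀)
    simpa only [Set.mem_ofPred_eq, h.factor_eq s hs u₀, h.factor_eq t' ht' u] using this
  set a := min t t' / 2 with ha
  have hm0 : 0 < min t t' := lt_min ht.1 ht'.1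
  have hat : a < t := by have := min_le_left t t'; linarith
  have hat' : a < t' := by have := min_le_right t t'; linarith
  have ha0 : 0 < a := by positivity
  have hsub : Set.Icc a σ₀ ⊆ Set.Ioc 0 σ₀ := fun x hx => ⟨ha0.trans_le hx.1, hx.2⟩
  have haσ : a ≤ σ₀ := hat.le.trans ht.2
  have ham : a ∈ Set.Icc a σ₀ := ⟨le_rfl, haσ⟩
  rcases (h.continuousOn_factor.mono hsub).strictMonoOn_of_injOn_Icc' haσ
    (h.level_inj.mono hsub) with hm | hm
  · exact absurd (hm ham ⟨hat'.le, ht'.2⟩ hat') (not_lt.2 (hmin' a (hsub ham)))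
  · exact absurd (hm ham ⟨hat.le, ht.2⟩ hat) (not_lt.2 (hmax a (hsub ham)))

/-- There are leaves arbitrarily close to the degenerate leaf: the conformal factor on a leaf can be
made larger than its maximum over the points at distance at least `δ` from the degenerate leaf. -/
lemma exists_leaf_close (h : IsConvexEquipotentialFoliation f Ω σ₀ F Φ) {δ : ℝ} (hδ : 0 < δ) :
    ∃ s ∈ Set.Ioc 0 σ₀, ∀ u : S2, ∃ x ∈ maxSet f Ω, dist (Φ s u) x ≤ δ := by
  -- the points at distance at least `δ` from the degenerate leaf
  set K : Set E3 := Ω ∩ ⋂ y ∈ maxSet f Ω, {x | δ ≤ dist x y} with hK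
  have hKc : IsCompact K := h.isCompact.inter_right <| isClosed_biInter fun y _ =>
    isClosed_le continuous_const (by fun_prop)
  have key : ∀ s ∈ Set.Ioc 0 σ₀, ∀ u : S2, Φ s u ∉ K →
      ∃ x ∈ maxSet f Ω, dist (Φ s u) x ≤ δ := by
    intro s hs u hu
    by_contra hcon
    push Not at hcon
    refine hu ⟨(h.leaf_mem hs u).1, ?_⟩
    simp only [Set.mem_iInter, Set.mem_ofPred_eq]
    exact fun y hy => (hcon y hy).le
  rcases K.eq_empty_or_nonempty with hE | hne
  · exact ⟨σ₀, ⟨h.pos, le_rfl⟩, fun u => key _ ⟨h.pos, le_rfl⟩ u (by simp [hE])⟩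
  · obtain ⟨x, hx, hmax⟩ := hKc.exists_isMaxOn hne
      (h.factor_continuous.mono Set.inter_subset_left)
    have hxS : x ∉ maxSet f Ω := by
      intro hxS
      have := hx.2
      simp only [Set.mem_iInter, Set.mem_ofPred_eq] at this
      have := this x hxS
      rw [dist_self] at this
      linarith
    obtain ⟨t, ht, u, rfl⟩ := h.exists_leaf hx.1 hxS
    obtain ⟨s, hs, hts⟩ := h.exists_factor_lt ht
    refine ⟨s, hs, fun v => key s hs v fun hv => ?_⟩
    have := hmax hv
    simp only [Set.mem_ofPred_eq, h.factor_eq s hs v, h.factor_eq t ht u] at this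
    linarith

/-- The total mean curvature of the boundary is at most the accumulated hoop density plus the bound
for the total mean curvature of surfaces close to a planar set. -/
theorem totalMeanCurvature_le (h : IsConvexEquipotentialFoliation f Ω σ₀ F Φ)
    (hdisk : IsPlanar (maxSet f Ω)) (hε : IsOrientation (Φ σ₀) (unitNormal flatMetric Φ σ₀) ε) :
    ε * ∫ u : S2, mixed (unitNormal flatMetric Φ σ₀) (unitNormal flatMetric Φ σ₀) (Φ σ₀) u
        ∂sphereMeasure
      ≤ 8 * Real.pi * (∫ s in (0 : ℝ)..σ₀, hoopDensity Φ s)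
        + Metric.diam (maxSet f Ω) * Real.pi ^ 2 := by
  have hσ : σ₀ ∈ Set.Ioc 0 σ₀ := ⟨h.pos, le_rfl⟩
  obtain ⟨ε', hor⟩ := h.exists_isOrientation
  let u₀ : S2 := ⟨stdVec 0, by simp [stdVec]⟩
  rw [← (hor σ₀ hσ).eq_of_pos hε.1 (hε.2 u₀)] at hor
  set M : ℝ → ℝ := fun t => ε * ∫ u : S2,
    mixed (unitNormal flatMetric Φ t) (unitNormal flatMetric Φ t) (Φ t) u ∂sphereMeasure with hM
  have hd : ∀ t ∈ Set.Ioc 0 σ₀, HasDerivAt M (8 * Real.pi * hoopDensity Φ t) t :=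
    fun t ht => h.hasDerivAt_totalMeanCurvature ht (hor t ht)
  have hC : ∀ t ∈ Set.Ioc 0 σ₀, 0 ≤ 8 * Real.pi * hoopDensity Φ t := fun t ht =>
    mul_nonneg (by positivity) (h.hoopDensity_nonneg ht)
  have hsub : ∀ {a}, 0 < a → Set.Icc a σ₀ ⊆ Set.Ioc 0 σ₀ := fun ha x hx =>
    ⟨ha.trans_le hx.1, hx.2⟩
  have hcont : ∀ {a}, 0 < a → ContinuousOn M (Set.Icc a σ₀) := fun ha t ht =>
    (hd t (hsub ha ht)).continuousAt.continuousWithinAt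
  have hint : ∀ {a}, 0 < a → IntegrableOn (fun t => 8 * Real.pi * hoopDensity Φ t)
      (Set.Ioc a σ₀) := fun ha => intervalIntegral.integrableOn_deriv_of_nonneg (hcont ha)
    (fun x hx => hd x (hsub ha (Set.Ioo_subset_Icc_self hx)))
    (fun x hx => hC x (hsub ha (Set.Ioo_subset_Icc_self hx)))
  have hftc : ∀ a ∈ Set.Ioc 0 σ₀,
      ∫ t in a..σ₀, 8 * Real.pi * hoopDensity Φ t = M σ₀ - M a := fun a ha =>
    intervalIntegral.integral_eq_sub_of_hasDerivAt_of_le ha.2 (hcont ha.1)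
      (fun x hx => hd x (hsub ha.1 (Set.Ioo_subset_Icc_self hx)))
      ((intervalIntegrable_iff_integrableOn_Ioc_of_le ha.2).2 (hint ha.1))
  have hM0 : ∀ a ∈ Set.Ioc 0 σ₀, 0 ≤ M a := fun a ha =>
    (h.isConvexSurface ha).integral_mixed_nonneg (hor a ha)
  -- the hoop density is integrable up to `0` since the total mean curvatures are non-negative
  have hint0 : IntegrableOn (fun t => 8 * Real.pi * hoopDensity Φ t) (Set.Ioc 0 σ₀) := by
    have hpos : ∀ i : ℕ, σ₀ / ((i : ℝ) + 1) ∈ Set.Ioc 0 σ₀ := fun i =>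
      ⟨div_pos h.pos (by positivity), div_le_self h.pos.le (by
        have : (0 : ℝ) ≤ i := by positivity
        linarith)⟩
    refine integrableOn_Ioc_of_intervalIntegral_norm_bounded_left (I := M σ₀)
      (a := fun i : ℕ => σ₀ / ((i : ℝ) + 1)) (l := Filter.atTop)
      (fun i => hint (hpos i).1) (tendsto_const_div_atTop_nhds_zero_nat σ₀ |>.comp
        (Filter.tendsto_add_atTop_nat 1) |>.congr fun i => by simp) ?_
    refine Filter.Eventually.of_forall fun i => ?_
    have e : ∫ t in Set.Ioc (σ₀ / ((i : ℝ) + 1)) σ₀, ‖8 * Real.pi * hoopDensity Φ t‖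
        = ∫ t in (σ₀ / ((i : ℝ) + 1))..σ₀, 8 * Real.pi * hoopDensity Φ t := by
      rw [intervalIntegral.integral_of_le (hpos i).2]
      refine setIntegral_congr_fun measurableSet_Ioc fun t ht => ?_
      exact Real.norm_of_nonneg (hC t ⟨(hpos i).1.trans ht.1, ht.2⟩)
    rw [e, hftc _ (hpos i)]
    linarith [hM0 _ (hpos i)]
  have hle : ∀ a ∈ Set.Ioc 0 σ₀,
      M σ₀ - M a ≤ 8 * Real.pi * ∫ s in (0 : ℝ)..σ₀, hoopDensity Φ s := by
    intro a ha
    rw [← hftc a ha, ← intervalIntegral.integral_const_mul]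
    refine intervalIntegral.integral_mono_interval ha.1.le ha.2 le_rfl ?_
      ((intervalIntegrable_iff_integrableOn_Ioc_of_le h.pos.le).2 hint0)
    exact (ae_restrict_iff' measurableSet_Ioc).2 (Filter.Eventually.of_forall hC)
  change M σ₀ ≤ _
  set c := 2 * sphereMeasure.real Set.univ with hc
  have hc0 : 0 ≤ c := by positivity
  refine le_of_forall_pos_le_add fun η hη => ?_
  have hδ : 0 < η / (c + 1) := by positivity
  obtain ⟨s, hs, hclose⟩ := h.exists_leaf_close hδ
  have h1 := (h.isConvexSurface hs).integral_mixed_le_of_planar (hor s hs) h.isCompact_maxSet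
    h.maxSet_nonempty hdisk hδ.le hclose
  have h2 := hle s hs
  have h3 : c * (η / (c + 1)) ≤ η := by
    rw [mul_div_assoc', div_le_iff₀ (by positivity)]
    nlinarith
  change M s ≤ _ at h1
  linarith

end IsConvexEquipotentialFoliation

/-! ### Conformal change of the ambient metric -/

namespace IsConvexSurface

variable {X n : E3 → E3} {ε c : ℝ}

lemma fderiv_const_smul (h : IsConvexSurface X n) (c : ℝ) (u : S2) (v : E3) :
    fderiv ℝ (fun x => c • X x) u v = c • fderiv ℝ X u v := by
  rw [fderiv_fun_const_smul ((h.smooth u).differentiableAt (by simp))]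
  rfl

lemma const_smul (h : IsConvexSurface X n) (hc : 0 < c) : IsConvexSurface (fun x => c • X x) n where
  smooth u := (h.smooth u).const_smul c
  normal_smooth := h.normal_smooth
  normal_unit := h.normal_unit
  normal_orthogonal u v hv := by
    rw [h.fderiv_const_smul, real_inner_smul_right, h.normal_orthogonal u v hv, mul_zero]
  immersion u v hv h0 := by
    rw [h.fderiv_const_smul] at h0
    exact h.immersion u v hv ((smul_eq_zero.1 h0).resolve_left hc.ne')
  inj u v huv := h.inj (smul_right_injective E3 hc.ne' huv)
  convex u v := by
    rw [← smul_sub, real_inner_smul_right]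
    exact mul_nonpos_of_nonneg_of_nonpos hc.le (h.convex u v)

lemma mixed_const_smul (h : IsConvexSurface X n) (c : ℝ) (u : S2) :
    mixed n n (fun x => c • X x) u = c * mixed n n X u := by
  simp only [mixed, mixedAt, h.fderiv_const_smul, det3_smul_right, Finset.mul_sum]

lemma isOrientation_const_smul (h : IsConvexSurface X n) (hc : 0 < c) (hε : IsOrientation X n ε) :
    IsOrientation (fun x => c • X x) n ε := by
  refine ⟨hε.1, fun u => ?_⟩
  have e : mixed n (fun x => c • X x) (fun x => c • X x) u = c * (c * mixed n X X u) := by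
    simp only [mixed, mixedAt, h.fderiv_const_smul, det3_smul_right, det3_smul_mid, Finset.mul_sum]
  rw [e]
  have := mul_pos (mul_pos hc hc) (hε.2 u)
  linarith

lemma areaDensity_eq_mixed (h : IsConvexSurface X n) (hε : IsOrientation X n ε) (u : S2) :
    areaDensity flatMetric X u = ε * mixed n X X u / 2 := by
  rw [h.areaDensity_eq hε, mixed, mixedAt_eq (isFrame_tangentFrame u),
    det3_swap_right _ (fderiv ℝ X u (cross _ _))]
  ring

lemma areaDensity_pos (h : IsConvexSurface X n) (u : S2) : 0 < areaDensity flatMetric X u := by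
  obtain ⟨ε, hε⟩ := h.exists_isOrientation
  rw [h.areaDensity_eq_mixed hε]
  exact half_pos (hε.2 u)

lemma continuous_areaDensity (h : IsConvexSurface X n) :
    Continuous fun u : S2 => areaDensity flatMetric X u := by
  obtain ⟨ε, hε⟩ := h.exists_isOrientation
  simp_rw [h.areaDensity_eq_mixed hε]
  exact (continuous_const.mul (continuous_sphere_of_contDiffAt fun u =>
    contDiffAt_mixed (h.normal_smooth u) (h.smooth u) (h.smooth u))).div_const 2

lemma continuous_meanCurvature (h : IsConvexSurface X n) :
    Continuous fun u : S2 => meanCurvature flatMetric X n u := by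
  obtain ⟨ε, hε⟩ := h.exists_isOrientation
  have e : ∀ u : S2, meanCurvature flatMetric X n u
      = ε * mixed n n X u / areaDensity flatMetric X u := fun u => by
    rw [eq_div_iff (h.areaDensity_pos u).ne', h.meanCurvature_mul_areaDensity hε]
  simp_rw [e]
  exact (continuous_const.mul (continuous_sphere_of_contDiffAt fun u =>
    contDiffAt_mixed (h.normal_smooth u) (h.normal_smooth u) (h.smooth u))).div
      h.continuous_areaDensity fun u => (h.areaDensity_pos u).ne'

end IsConvexSurface

lemma christoffel_conformalMetric {f : E3 → ℝ} {x v w z : E3} (hf : DifferentiableAt ℝ f x)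
    (hvw : ⟪v, w⟫ = 0) (hwz : ⟪w, z⟫ = 0) :
    christoffel (conformalMetric f) x v w z = 2 * f x ^ 3 * fderiv ℝ f x w * ⟪v, z⟫ := by
  have e : ∀ a b d : E3, fderiv ℝ (fun y => conformalMetric f y a b) x d
      = 4 * f x ^ 3 * fderiv ℝ f x d * ⟪a, b⟫ := by
    intro a b d
    have h1 := ((hf.hasFDerivAt.pow 4).mul_const ⟪a, b⟫).fderiv
    simp only [conformalMetric]
    rw [h1]
    simp
    ring
  rw [christoffel, e, e, e, hvw, hwz]
  ring

/-- The transformation of the mean curvature under a conformal change of the ambient metric. -/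
lemma IsConvexSurface.meanCurvature_conformalMetric {X n : E3 → E3} (h : IsConvexSurface X n)
    {f : E3 → ℝ} {u : S2} (hf : DifferentiableAt ℝ f (X u)) (hf0 : f (X u) ≠ 0) :
    meanCurvature (conformalMetric f) X (fun y => (f (X y) ^ 2)⁻¹ • n y) u
      = (f (X u) ^ 2)⁻¹ * meanCurvature flatMetric X n u
        + 4 * (f (X u) ^ 3)⁻¹ * fderiv ℝ f (X u) (n u) := by
  have hdet : (firstForm flatMetric X u).det ≠ 0 := by
    rw [h.det_firstForm]
    exact pow_ne_zero 2 (h.det3_fderiv_ne_zero u (isFrame_tangentFrame u))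
  have hX := (h.smooth u).differentiableAt (by simp)
  have hn := (h.normal_smooth u).differentiableAt (by simp)
  have hfX : DifferentiableAt ℝ (fun y => (f (X y) ^ 2)⁻¹) u :=
    ((DifferentiableAt.comp (g := f) (f := X) (u : E3) hf hX).pow 2).inv (pow_ne_zero 2 hf0)
  have ho : ∀ i, ⟪n u, fderiv ℝ X u (tangentFrame u i)⟫ = 0 := fun i =>
    h.normal_orthogonal u _ (inner_tangentFrame u i)
  have e1 : firstForm (conformalMetric f) X u = f (X u) ^ 4 • firstForm flatMetric X u := by
    ext i j
    simp [firstForm, conformalMetric, flatMetric]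
  have e2 : secondForm (conformalMetric f) X (fun y => (f (X y) ^ 2)⁻¹ • n y) u
      = f (X u) ^ 2 • secondForm flatMetric X n u
        + (2 * f (X u) * fderiv ℝ f (X u) (n u)) • firstForm flatMetric X u := by
    ext i j
    have hd : fderiv ℝ (fun y => (f (X y) ^ 2)⁻¹ • n y) u (tangentFrame u i)
        = (f (X u) ^ 2)⁻¹ • fderiv ℝ n u (tangentFrame u i)
          + fderiv ℝ (fun y => (f (X y) ^ 2)⁻¹) u (tangentFrame u i) • n u := by
      rw [fderiv_fun_smul hfX hn]
      simp
    have hc := christoffel_conformalMetric (v := fderiv ℝ X u (tangentFrame u i))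
      (w := (f (X u) ^ 2)⁻¹ • n u) (z := fderiv ℝ X u (tangentFrame u j)) hf
      (by rw [real_inner_smul_right, real_inner_comm, ho, mul_zero])
      (by rw [real_inner_smul_left, ho, mul_zero])
    simp only [secondForm, Matrix.of_apply, hc, hd, Matrix.add_apply, Matrix.smul_apply,
      firstForm, smul_eq_mul, christoffel_flatMetric, conformalMetric, flatMetric, inner_add_left,
      real_inner_smul_left, ho, map_smul]
    field_simp
    ring
  rw [meanCurvature, meanCurvature, trace_inv_mul, trace_inv_mul, e1, e2, Matrix.det_smul]
  simp only [Matrix.add_apply, Matrix.smul_apply, smul_eq_mul, Fintype.card_fin]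
  have hd2 := Matrix.det_fin_two (firstForm flatMetric X u)
  set d := (firstForm flatMetric X u).det
  field_simp
  rw [hd2]
  ring

lemma unitNormal_conformalMetric (f : E3 → ℝ) (Φ : ℝ → E3 → E3) (s : ℝ) :
    unitNormal (conformalMetric f) Φ s
      = fun y => (f (Φ s y) ^ 2)⁻¹ • unitNormal flatMetric Φ s y := by
  funext y
  have e : f (Φ s y) ^ 4 = (f (Φ s y) ^ 2) ^ 2 := by ring
  simp only [unitNormal, conformalMetric, flatMetric, smul_smul]
  rw [e, Real.sqrt_mul (sq_nonneg _), Real.sqrt_sq (sq_nonneg _), mul_inv]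

lemma IsWeylEmbedding.isConvexSurface {X n Y ν : E3 → E3} {f : E3 → ℝ} (hX : IsConvexSurface X n)
    (hf : ∀ u : S2, f (X u) ≠ 0) (hY : IsWeylEmbedding (conformalMetric f) X Y ν) :
    IsConvexSurface Y ν where
  smooth := hY.smooth
  normal_smooth := hY.normal_smooth
  normal_unit := hY.normal_unit
  normal_orthogonal := hY.normal_orthogonal
  immersion u v hv h0 := by
    have e := hY.isometric u v v hv hv
    rw [h0, inner_zero_left, conformalMetric] at e
    refine hX.immersion u v hv (inner_self_eq_zero (𝕜 := ℝ).1 ?_)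
    exact (mul_eq_zero.1 e.symm).resolve_left (pow_ne_zero 4 (hf u))
  inj := hY.inj
  convex := hY.convex

lemma IsWeylEmbedding.areaDensity_eq {g : MetricTensor} {X Y ν : E3 → E3}
    (hY : IsWeylEmbedding g X Y ν) (u : S2) : areaDensity g X u = areaDensity flatMetric Y u := by
  have e : firstForm g X u = firstForm flatMetric Y u := by
    ext i j
    exact (hY.isometric u _ _ (inner_tangentFrame u i) (inner_tangentFrame u j)).symm
  rw [areaDensity, areaDensity, e]

/-! ### The trapping criterion -/

namespace IsConvexEquipotentialFoliation

variable {f : E3 → ℝ} {Ω : Set E3} {σ₀ : ℝ} {F : ℝ → ℝ} {Φ : ℝ → E3 → E3} {s : ℝ}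

lemma factor_pos_leaf (h : IsConvexEquipotentialFoliation f Ω σ₀ F Φ) (hs : s ∈ Set.Ioc 0 σ₀) :
    0 < F s := by
  let u₀ : S2 := ⟨stdVec 0, by simp [stdVec]⟩
  rw [← h.factor_eq s hs u₀]
  exact h.factor_pos _ (h.leaf_mem hs u₀).1

lemma continuous_leafMeanCurvature (h : IsConvexEquipotentialFoliation f Ω σ₀ F Φ)
    (hs : s ∈ Set.Ioc 0 σ₀) : Continuous (leafMeanCurvature (conformalMetric f) Φ s) := by
  have hX := h.isConvexSurface hs
  have hF := h.factor_pos_leaf hs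
  have hf := fun u => h.factor_smooth _ (h.leaf_mem hs u)
  have e : ∀ u : S2, leafMeanCurvature (conformalMetric f) Φ s u
      = (F s ^ 2)⁻¹ * meanCurvature flatMetric (Φ s) (unitNormal flatMetric Φ s) u
        + 4 * (F s ^ 3)⁻¹ * fderiv ℝ f (Φ s u) (unitNormal flatMetric Φ s u) := by
    intro u
    have := hX.meanCurvature_conformalMetric ((hf u).differentiableAt (by simp))
      (by rw [h.factor_eq s hs u]; exact hF.ne')
    rw [leafMeanCurvature, unitNormal_conformalMetric, this, h.factor_eq s hs u]
  rw [show leafMeanCurvature (conformalMetric f) Φ s = _ from funext e]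
  refine (continuous_const.mul hX.continuous_meanCurvature).add (continuous_const.mul ?_)
  refine continuous_iff_continuousAt.2 fun u => ?_
  have h1 : ContinuousAt (fun v : S2 => Φ s v) u :=
    ContinuousAt.comp (f := fun v : S2 => (v : E3)) (hX.smooth u).continuousAt (by fun_prop)
  have h2 : ContinuousAt (fun v : S2 => unitNormal flatMetric Φ s v) u :=
    ContinuousAt.comp (f := fun v : S2 => (v : E3)) (hX.normal_smooth u).continuousAt (by fun_prop)
  have h3 : ContinuousAt (fderiv ℝ f) (Φ s u) :=
    ((hf u).fderiv_right (m := ∞) (by simp)).continuousAt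
  exact (ContinuousAt.comp (f := fun v : S2 => Φ s v) h3 h1).clm_apply h2

lemma metric_coordVector_pos (h : IsConvexEquipotentialFoliation f Ω σ₀ F Φ)
    (hs : s ∈ Set.Ioc 0 σ₀) (u : S2) :
    0 < conformalMetric f (Φ s u) (coordVector Φ s u) (coordVector Φ s u) :=
  mul_pos (pow_pos (h.factor_pos _ (h.leaf_mem hs u).1) 4)
    (real_inner_self_pos.2 (h.coordVector_ne s hs u))

lemma normalLower_eq (h : IsConvexEquipotentialFoliation f Ω σ₀ F Φ)
    (hs : s ∈ Set.Ioc 0 σ₀) (u : S2) : normalLower (conformalMetric f) Φ s u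
      = √(conformalMetric f (Φ s u) (coordVector Φ s u) (coordVector Φ s u)) := by
  have hpos := h.metric_coordVector_pos hs u
  have e : normalLower (conformalMetric f) Φ s u
      = (√(conformalMetric f (Φ s u) (coordVector Φ s u) (coordVector Φ s u)))⁻¹
        * conformalMetric f (Φ s u) (coordVector Φ s u) (coordVector Φ s u) := by
    rw [normalLower, unitNormal]
    nth_rw 1 [conformalMetric]
    rw [real_inner_smul_left, conformalMetric]
    ring
  rw [e, inv_mul_eq_div, Real.div_sqrt]

lemma normalLower_pos (h : IsConvexEquipotentialFoliation f Ω σ₀ F Φ)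
    (hs : s ∈ Set.Ioc 0 σ₀) (u : S2) : 0 < normalLower (conformalMetric f) Φ s u := by
  rw [h.normalLower_eq hs]
  exact Real.sqrt_pos.2 (h.metric_coordVector_pos hs u)

lemma normalUpper_eq (h : IsConvexEquipotentialFoliation f Ω σ₀ F Φ)
    (hs : s ∈ Set.Ioc 0 σ₀) (u : S2) :
    normalUpper (conformalMetric f) Φ s u = (normalLower (conformalMetric f) Φ s u)⁻¹ := by
  rw [normalUpper, h.normalLower_eq hs, Real.sqrt_div_self', one_div]

lemma continuous_normalLower (h : IsConvexEquipotentialFoliation f Ω σ₀ F Φ)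
    (hs : s ∈ Set.Ioc 0 σ₀) : Continuous (normalLower (conformalMetric f) Φ s) := by
  have e : normalLower (conformalMetric f) Φ s
      = fun u : S2 => √(F s ^ 4 * ⟪coordVector Φ s u, coordVector Φ s u⟫) := by
    funext u
    rw [h.normalLower_eq hs, conformalMetric, h.factor_eq s hs]
  have hc : Continuous fun u : S2 => coordVector Φ s u := by
    refine continuous_iff_continuousAt.2 fun u => ?_
    exact ContinuousAt.comp (f := fun v : S2 => (s, (v : E3)))
      (h.contDiffAt_coordVector hs u).continuousAt (by fun_prop)
  rw [e]
  exact (continuous_const.mul (hc.inner hc)).sqrt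

/-- If the mean curvature is non-negative somewhere, the boundary term compensates the integral of
the mean curvature in the Brown-York mass. -/
lemma neg_integral_le_boundaryTerm (h : IsConvexEquipotentialFoliation f Ω σ₀ F Φ)
    (hs : s ∈ Set.Ioc 0 σ₀)
    (harea : Continuous fun u : S2 => areaDensity (conformalMetric f) (Φ s) u) {u₀ : S2}
    (hu₀ : 0 ≤ leafMeanCurvature (conformalMetric f) Φ s u₀) :
    -(1 / (8 * Real.pi) * surfaceIntegral (conformalMetric f) (Φ s)
        (leafMeanCurvature (conformalMetric f) Φ s))
      ≤ boundaryTerm (conformalMetric f) Φ s := by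
  have hk := h.continuous_leafMeanCurvature hs
  have hl := h.continuous_normalLower hs
  set k := leafMeanCurvature (conformalMetric f) Φ s
  set l := normalLower (conformalMetric f) Φ s with hl'
  have hlpos : ∀ u, 0 < l u := h.normalLower_pos hs
  set S := ⨆ v : S2, l v * k v with hS
  have hS0 : 0 ≤ S := (mul_nonneg (hlpos u₀).le hu₀).trans
    (le_ciSup (f := fun v => l v * k v) (isCompact_range (hl.mul hk)).bddAbove u₀)
  have hup : normalUpper (conformalMetric f) Φ s = fun u => (l u)⁻¹ :=
    funext (h.normalUpper_eq hs)
  rw [boundaryTerm, ← mul_neg, surfaceIntegral, surfaceIntegral, ← integral_neg, hup]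
  refine mul_le_mul_of_nonneg_left (integral_mono (integrable_sphere ?_) (integrable_sphere ?_)
    fun u => ?_) (by positivity)
  · exact (hk.mul harea).neg
  · exact ((hl.inv₀ fun u => (hlpos u).ne').mul (continuous_const.sub (hl.mul hk))).mul harea
  · have ha : 0 ≤ areaDensity (conformalMetric f) (Φ s) u := Real.sqrt_nonneg _
    have e : (l u)⁻¹ * (S - l u * k u) = (l u)⁻¹ * S - k u := by
      have := (hlpos u).ne'
      field_simp
    have h1 : 0 ≤ (l u)⁻¹ * S := mul_nonneg (inv_nonneg.2 (hlpos u).le) hS0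
    change -(k u * _) ≤ (l u)⁻¹ * (S - l u * k u) * _
    rw [e, ← neg_mul]
    exact mul_le_mul_of_nonneg_right (by linarith) ha

/-- The bound for the total mean curvature of the Weyl embedding of the boundary.  The metric of the
boundary is that of the outermost leaf dilated by the square of the conformal factor, so Herglotz's
inequality applies to the Weyl embedding and the dilated leaf. -/
lemma surfaceIntegral_meanCurvature_le (h : IsConvexEquipotentialFoliation f Ω σ₀ F Φ)
    (hdisk : IsPlanar (maxSet f Ω)) {Y ν : E3 → E3}
    (hWeyl : IsWeylEmbedding (conformalMetric f) (Φ σ₀) Y ν) :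
    surfaceIntegral (conformalMetric f) (Φ σ₀) (fun u => meanCurvature flatMetric Y ν u)
      ≤ F σ₀ ^ 2 * (8 * Real.pi * (∫ s in (0 : ℝ)..σ₀, hoopDensity Φ s)
        + Metric.diam (maxSet f Ω) * Real.pi ^ 2) := by
  have hσ : σ₀ ∈ Set.Ioc 0 σ₀ := ⟨h.pos, le_rfl⟩
  have hX := h.isConvexSurface hσ
  have hF := h.factor_pos_leaf hσ
  have hF2 : 0 < F σ₀ ^ 2 := by positivity
  have hY := hWeyl.isConvexSurface hX fun u => by rw [h.factor_eq _ hσ]; exact hF.ne'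
  obtain ⟨ε, hε⟩ := hX.exists_isOrientation
  obtain ⟨ε', hε'⟩ := hY.exists_isOrientation
  have h1 := IsConvexSurface.integral_mixed_le_of_isometric (hX.const_smul hF2) hY
    (hX.isOrientation_const_smul hF2 hε) hε' fun u v w hv hw => by
      rw [hWeyl.isometric u v w hv hw, conformalMetric, h.factor_eq _ hσ,
        hX.fderiv_const_smul, hX.fderiv_const_smul, real_inner_smul_left, real_inner_smul_right]
      ring
  have h2 := h.totalMeanCurvature_le hdisk hε
  simp_rw [hX.mixed_const_smul] at h1
  rw [integral_const_mul] at h1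
  have e : surfaceIntegral (conformalMetric f) (Φ σ₀) (fun u => meanCurvature flatMetric Y ν u)
      = ε' * ∫ u : S2, mixed ν ν Y u ∂sphereMeasure := by
    rw [surfaceIntegral, ← integral_const_mul]
    refine integral_congr_ae (Filter.Eventually.of_forall fun u => ?_)
    beta_reduce
    rw [hWeyl.areaDensity_eq, hY.meanCurvature_mul_areaDensity hε']
  rw [e]
  refine h1.trans ?_
  rw [mul_left_comm]
  exact mul_le_mul_of_nonneg_left h2 hF2.le

end IsConvexEquipotentialFoliation

end ConformallyFlat

end

theorem mainTheorem1 (f : E3 → ℝ) (Ω : Set E3) (σ₀ : ℝ) (F : ℝ → ℝ) (Φ : ℝ → E3 → E3)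
    (hfol : IsConvexEquipotentialFoliation f Ω σ₀ F Φ)
    (hdisk : IsPlanar (maxSet f Ω))
    (hgauss : ∀ u : S2, 0 < leafGaussCurvature Φ σ₀ u)
    (Y ν : E3 → E3)
    (hWeyl : IsWeylEmbedding (conformalMetric f) (Φ σ₀) Y ν)
    (hmass : boundaryTerm (conformalMetric f) Φ σ₀
        + F σ₀ ^ 2 * Real.pi / 4 * flatRadius (maxSet f Ω)
        + F σ₀ ^ 2 * (∫ s in (0 : ℝ)..σ₀, hoopDensity Φ s)
      < brownYorkMass (conformalMetric f) Φ σ₀ Y ν) :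
    IsTrapped (conformalMetric f) Φ σ₀ := by
  intro u₀
  by_contra hk
  push Not at hk
  have hσ : σ₀ ∈ Set.Ioc 0 σ₀ := ⟨hfol.pos, le_rfl⟩
  have hX := hfol.isConvexSurface hσ
  have hY := hWeyl.isConvexSurface hX fun u => by
    rw [hfol.factor_eq _ hσ]; exact (hfol.factor_pos_leaf hσ).ne'
  -- the area density is continuous since it is that of the smooth surface `Y`
  have harea : Continuous fun u : S2 => areaDensity (conformalMetric f) (Φ σ₀) u := by
    simp_rw [hWeyl.areaDensity_eq]
    exact hY.continuous_areaDensity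
  have h1 := hfol.neg_integral_le_boundaryTerm hσ harea hk
  have h2 := hfol.surfaceIntegral_meanCurvature_le hdisk hWeyl
  have e : brownYorkMass (conformalMetric f) Φ σ₀ Y ν
      = 1 / (8 * Real.pi) * surfaceIntegral (conformalMetric f) (Φ σ₀)
          (fun u => meanCurvature flatMetric Y ν u)
        - 1 / (8 * Real.pi) * surfaceIntegral (conformalMetric f) (Φ σ₀)
          (leafMeanCurvature (conformalMetric f) Φ σ₀) := by
    simp only [brownYorkMass, surfaceIntegral, sub_mul]
    rw [← mul_sub]
    congr 1
    exact integral_sub (integrable_sphere (hY.continuous_meanCurvature.mul harea))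
      (integrable_sphere ((hfol.continuous_leafMeanCurvature hσ).mul harea))
  have hpi := Real.pi_pos
  have h3 := mul_le_mul_of_nonneg_left h2 (by positivity : 0 ≤ 1 / (8 * Real.pi))
  have e3 : 1 / (8 * Real.pi) * (F σ₀ ^ 2 * (8 * Real.pi * (∫ s in (0 : ℝ)..σ₀, hoopDensity Φ s)
        + Metric.diam (maxSet f Ω) * Real.pi ^ 2))
      = F σ₀ ^ 2 * Real.pi / 4 * flatRadius (maxSet f Ω)
        + F σ₀ ^ 2 * ∫ s in (0 : ℝ)..σ₀, hoopDensity Φ s := by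
    rw [flatRadius]
    field_simp
    ring
  rw [e3] at h3
  linarith
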